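/- \textbf{Knots.} A piecewise $C^2$ knot is a simple closed curve $K\subset\mathbb{R}^3$ parametrised by a continuous $1$-periodic map $\gamma$ (injective on $[0,1)$) which is $C^2$ except at finitely many parameters (the corners), and such that at every parameter the one-sided limits of $\dot\gamma$ exist, are non-zero, and do not have opposite directions. A PL knot is a simple closed polygon; it is parametrised by such a $\gamma$ which is locally affine with non-zero velocity off the corners (its vertices). \textbf{Tait number.} For $\xi\in S^2$ let $p_\xi$ be the orthogonal projection along $\xi$. If $K$ is PL, $\xi$ is \emph{good} if every fibre of $p_\xi|_K$ is empty, one point, or two points which are not corners. If $K$ is piecewise $C^2$, we require in addition that the two strands at each double point of the diagram be transverse. For good $\xi$, a double point of the diagram whose upper strand (the one further in the direction $\xi$) has tangent vector $a$ and whose lower strand has tangent vector $b$ gets the sign of $\det(a,b,\xi)$, that is, $+1$ if the upper strand has to be turned counterclockwise to coincide with the lower one, and $-1$ otherwise. $T_K(\xi)$ is the sum of the signs of all double points. \textbf{Indicatrix.} Let $\Gamma\subset S^2$ be the closed oriented curve traced by the unit tangent $\dot\gamma/\|\dot\gamma\|$, completed at each corner by the oriented shorter arc of great circle from the incoming to the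 outgoing unit tangent. Let $-\Gamma$ be the same curve for the opposite orientation of $K$ (the antipodal image of $\Gamma$, with orientation reversed). The indicatrix is $I=\Gamma\cup-\Gamma$. \textbf{Intersection number.} A path $c:[0,1]\to S^2$ with end points off $I$ is \emph{transverse to} $I$ if it meets $I$ for finitely many pairs of parameters, avoids the end points of the corner arcs (and their antipodes), and wherever it meets $I$ is differentiable and transverse to each strand of $I$. Its signed number of crossings with $I$ counts each meeting of parameters with sign $+1$ if (direction of $c$, direction of $I$) is a positive frame of $S^2$ oriented by the outward normal, and $-1$ otherwise. The intersection number of $I$ with an arbitrary continuous path $c$ joining $\xi\notin I$ to $\xi'\notin I$ is the signed number of crossings of any transverse path homotopic to $c$ in $S^2$ with fixed end points. \textbf{Statement.} Let $K$ be a PL knot or a piecewise $C^2$ knot. For good $\xi\in S^2\setminus I$ the diagram has finitely many double points. Every connected component of $S^2\setminus I$ contains good $\xi$, and $T_K$ takes the same value at all good $\xi$ of the component; this value defines $T_K$ on all of $S^2\setminus I$. For all $\xi,\xi'\in S^2\setminus I$ and every continuous path $c$ on $S^2$ joining $\xi$ to $\xi'$, the intersection number $n$ of $I$ with $c$ is well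 defined (some transverse path is homotopic to $c$ with fixed end points, and all such paths give the same number), and $$T_K(\xi)=T_K(\xi')+n .$$ -/

import Mathlib

open Set Filter Topology

noncomputable section

/-- Euclidean three-space. -/
abbrev E3 : Type := EuclideanSpace ℝ (Fin 3)

/-- The unit sphere of Euclidean three-space. -/
abbrev S2 : Type := Metric.sphere (0 : E3) 1

/-- The determinant of three vectors, that is, the triple product `(a × b) · c`. -/
def det3 (a b c : E3) : ℝ :=
  Matrix.det !![a 0, a 1, a 2; b 0, b 1, b 2; c 0, c 1, c 2]

/-- Orthogonal projection along the line spanned by the unit vector `ξ`. -/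
def projAlong (ξ : S2) (x : E3) : E3 := x - (inner ℝ (ξ : E3) x) • (ξ : E3)

/-- The (shorter) arc of great circle joining the unit vectors `p` and `q`, for `q ≠ -p`.
It is the single point `p` if `p = q`. -/
def greatArc (p q : E3) : Set E3 :=
  {x | ‖x‖ = 1 ∧ ∃ a b : ℝ, 0 ≤ a ∧ 0 ≤ b ∧ x = a • p + b • q}

/-- An oriented simple closed curve in space, parametrised by one period `[0, 1)`, with a finite
set of marked parameters (the corners). -/
structure SimpleClosedCurve where
  toFun : ℝ → E3
  corners : Finset ℝ
  corners_subset : (corners : Set ℝ) ⊆ Ico 0 1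
  periodic : Function.Periodic toFun 1
  continuous : Continuous toFun
  injective : InjOn toFun (Ico 0 1)

namespace SimpleClosedCurve

variable (K : SimpleClosedCurve)

/-- The underlying set of the curve. -/
def carrier : Set E3 := K.toFun '' Ico 0 1

/-- The vertices (corner points) of the curve. -/
def vertices : Set E3 := K.toFun '' (K.corners : Set ℝ)

/-- Polygonal (PL) knots: away from the finitely many vertices, the curve moves along a segment. -/
def IsPLKnot : Prop :=
  ∀ t ∈ Ico (0 : ℝ) 1, t ∉ K.corners →
    ∃ w : E3, w ≠ 0 ∧ ∀ᶠ s in 𝓝 t, K.toFun s = K.toFun t + (s - t) • w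

/-- Piecewise `C²` knots: the curve is `C²` off the corners, and everywhere its velocity has nonzero
one-sided limits which do not point in opposite directions. -/
def IsPiecewiseC2Knot : Prop :=
  (∀ t ∈ Ico (0 : ℝ) 1, t ∉ K.corners → ContDiffAt ℝ 2 K.toFun t) ∧
  ∀ t ∈ Ico (0 : ℝ) 1, ∃ l r : E3, l ≠ 0 ∧ r ≠ 0 ∧
    Tendsto (deriv K.toFun) (𝓝[<] t) (𝓝 l) ∧
    Tendsto (deriv K.toFun) (𝓝[>] t) (𝓝 r) ∧
    ‖r‖⁻¹ • r ≠ -(‖l‖⁻¹ • l)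

/-! ### The Tait number -/

/-- The part of the curve which is projected onto `v` along `ξ`. -/
def fibre (ξ : S2) (v : E3) : Set E3 := {x ∈ K.carrier | projAlong ξ x = v}

/-- `ξ` gives a good (generic) projection: every fibre is empty, one point, or two interior
points. -/
def IsGood (ξ : S2) : Prop :=
  ∀ v : E3, K.fibre ξ v = ∅ ∨ (∃ x, K.fibre ξ v = {x}) ∨
    ∃ x y, x ≠ y ∧ x ∉ K.vertices ∧ y ∉ K.vertices ∧ K.fibre ξ v = {x, y}

/-- The double points of the diagram seen from `ξ`. A double point is recorded by the pair `(s, t)`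
of parameters of its upper and its lower strand, so it occurs exactly once. -/
def doublePoints (ξ : S2) : Set (ℝ × ℝ) :=
  {p | p.1 ∈ Ico (0 : ℝ) 1 ∧ p.2 ∈ Ico (0 : ℝ) 1 ∧
    projAlong ξ (K.toFun p.1) = projAlong ξ (K.toFun p.2) ∧
    inner ℝ (ξ : E3) (K.toFun p.2) < inner ℝ (ξ : E3) (K.toFun p.1)}

/-- Both strands meet transversally in the diagram at each of its double points. -/
def IsTransverseDiagram (ξ : S2) : Prop :=
  ∀ p ∈ K.doublePoints ξ, det3 (deriv K.toFun p.1) (deriv K.toFun p.2) (ξ : E3) ≠ 0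

/-- The sign of a double point: `+1` if the upper strand has to be turned counterclockwise (seen
from `ξ`) to coincide with the lower one, `-1` if clockwise. -/
def crossingSign (ξ : S2) (p : ℝ × ℝ) : ℤ :=
  (SignType.sign (det3 (deriv K.toFun p.1) (deriv K.toFun p.2) (ξ : E3)) : ℤ)

/-- The Tait number of the diagram seen from `ξ`. -/
def tait (ξ : S2) : ℤ := ∑ᶠ p ∈ K.doublePoints ξ, K.crossingSign ξ p

/-- The good projections. -/
def goodDirections : Set S2 := {ξ | K.IsGood ξ}

/-- The good projections with only transverse double points (for polygonal knots the transversality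
is automatic). -/
def regularDirections : Set S2 := {ξ | K.IsGood ξ ∧ K.IsTransverseDiagram ξ}

/-! ### The indicatrix -/

/-- The unit tangent vector (off the corners). -/
def unitTangent (t : ℝ) : E3 := ‖deriv K.toFun t‖⁻¹ • deriv K.toFun t

/-- The direction in which the curve arrives at the parameter `t`. -/
def leftTangent (t : ℝ) : E3 := limUnder (𝓝[<] t) K.unitTangent

/-- The direction in which the curve leaves from the parameter `t`. -/
def rightTangent (t : ℝ) : E3 := limUnder (𝓝[>] t) K.unitTangent

open Classical in
/-- The piece of the tangent indicatrix `Γ` over the parameter `t`: the unit tangent vector off the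
corners, the arc of great circle from the incoming to the outgoing direction at a corner. -/
def tangentPiece (t : ℝ) : Set E3 :=
  if t ∈ K.corners then greatArc (K.leftTangent t) (K.rightTangent t) else {K.unitTangent t}

/-- The tangent indicatrix `Γ`, as a set. -/
def tangentIndicatrix : Set E3 := ⋃ t ∈ Ico (0 : ℝ) 1, K.tangentPiece t

/-- The indicatrix `I = Γ ∪ -Γ`, as a set of points of the sphere. -/
def indicatrix : Set S2 :=
  {x | (x : E3) ∈ K.tangentIndicatrix ∨ -(x : E3) ∈ K.tangentIndicatrix}

open Classical in
/-- The direction in which `Γ` runs over the parameter `t`, up to positive factors and (at corners)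
up to multiples of the point of the sphere at which it is taken: the derivative of the
unit tangent off the corners; at a corner `Γ` runs from `leftTangent` to `rightTangent`.

The curve `-Γ` is the tangent indicatrix of the knot with the opposite orientation, that is,
the antipodal image of `Γ` with the orientation reversed. Two changes of sign cancel, so that
the same vector also gives the direction of `-Γ` at the antipodal point. -/
def tangentDir (t : ℝ) : E3 :=
  if t ∈ K.corners then K.rightTangent t - K.leftTangent t else deriv K.unitTangent t

/-- The Tait number extended to the directions off the indicatrix: its value at any direction of
`O` (the good projections) in the same connected component of the complement of the indicatrix. -/
def taitExt (O : Set S2) (ξ : S2) : ℤ :=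
  open Classical in
  if h : ∃ η ∈ O, η ∈ connectedComponentIn K.indicatrixᶜ ξ then K.tait h.choose else 0

/-! ### Intersection numbers with the indicatrix -/

variable {ξ ξ' : S2}

/-- A path on the sphere, as a map from the reals to space (constant outside `[0, 1]`). -/
def pathMap (c : Path ξ ξ') (s : ℝ) : E3 := (c.extend s : E3)

/-- The parameters `(s, t)` at which the path `c` meets `Γ`. -/
def meets (c : Path ξ ξ') : Set (ℝ × ℝ) :=
  {p | p.1 ∈ Icc (0 : ℝ) 1 ∧ p.2 ∈ Ico (0 : ℝ) 1 ∧ pathMap c p.1 ∈ K.tangentPiece p.2}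

/-- The parameters `(s, t)` at which the path `c` meets `-Γ`. -/
def meetsNeg (c : Path ξ ξ') : Set (ℝ × ℝ) :=
  {p | p.1 ∈ Icc (0 : ℝ) 1 ∧ p.2 ∈ Ico (0 : ℝ) 1 ∧ -pathMap c p.1 ∈ K.tangentPiece p.2}

/-- The orientation determinant of (path, indicatrix) at a common point, for the orientation of
the sphere by its outward normal. -/
def crossingDet (c : Path ξ ξ') (p : ℝ × ℝ) : ℝ :=
  det3 (pathMap c p.1) (deriv (pathMap c) p.1) (K.tangentDir p.2)

/-- The path `c` is transverse to the indicatrix: it meets it finitely often, does not pass through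
the end points of the arcs belonging to the corners, and is differentiable and transverse to each
strand of the indicatrix wherever it meets it. -/
def IsTransversePath (c : Path ξ ξ') : Prop :=
  (K.meets c).Finite ∧ (K.meetsNeg c).Finite ∧
  ∀ p ∈ K.meets c ∪ K.meetsNeg c,
    DifferentiableAt ℝ (pathMap c) p.1 ∧ K.crossingDet c p ≠ 0 ∧
    (p.2 ∈ K.corners →
      pathMap c p.1 ≠ K.leftTangent p.2 ∧ pathMap c p.1 ≠ K.rightTangent p.2 ∧
      pathMap c p.1 ≠ -K.leftTangent p.2 ∧ pathMap c p.1 ≠ -K.rightTangent p.2)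

/-- The number of crossings of the transverse path `c` with the indicatrix `Γ ∪ -Γ`, counted with
multiplicity and with signs: `+1` where (path, indicatrix) is a positively oriented frame of the
sphere, that is, where the path crosses from the left of the indicatrix to its right. -/
def signedCrossings (c : Path ξ ξ') : ℤ :=
  (∑ᶠ p ∈ K.meets c, (SignType.sign (K.crossingDet c p) : ℤ)) +
    (∑ᶠ p ∈ K.meetsNeg c, (SignType.sign (K.crossingDet c p) : ℤ))

/-- `n` is the intersection number of the indicatrix with the (arbitrary continuous) path `c`:
the signed number of crossings of a transverse path homotopic to `c` with fixed end points. -/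
def IsIntersectionNumber (c : Path ξ ξ') (n : ℤ) : Prop :=
  ∃ c' : Path ξ ξ', c.Homotopic c' ∧ K.IsTransversePath c' ∧ n = K.signedCrossings c'

end SimpleClosedCurve

end

noncomputable section

/-! ### Continuous logarithms -/

/-! Write γ for the parametrisation. A double point seen from ξ is the same as a chord γ(s + u) -
γ(s), with s modulo 1 and 0 < u < 1, that is a positive multiple of ξ, and its sign is, up to
convention, the local degree of the chord direction there. So the Tait number counts preimages of ξ
under a map from an open annulus to the sphere. As u tends to 0 or to 1 the chord directions tend to
the tangent indicatrix Γ or to -Γ, with the arcs of great circle filled in at the corners, and the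
count changes only when ξ crosses one of these boundary curves.

The proof makes this exact with winding numbers. Fix a regular pole q off the indicatrix. The
function `twoRay (stereo ξ)` on space vanishes exactly on the rays of q and of ξ, and its
derivatives there have opposite orientations. By the argument principle `bdry_eq_sum_sign`, its
composite with the chord map winds T(q) - T(ξ) times along the boundary of [a, a + 1] × [ε, 1 - ε]
(`bdry_chord`). The sides s = a and s = a + 1 cancel by periodicity; the sides u = ε and u = 1 - ε
consist of short chords and their opposites. Hence `boundaryLog` equals 2πi (T(q) - T(ξ)) for small
ε (`boundaryLog_eq`).

The same boundary terms are computed as ε tends to 0 while ξ moves along a transverse path c. Near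
one parameter all short chords lie in a convex cone on which the two-ray functions at both ends of c
have logarithms, so that only the unit tangents at the ends of the parameter interval matter. The
argument principle in the plane of (path parameter, curve parameter) then counts the meetings of c
with Γ; at a corner the tangent is replaced by the straight segment from the incoming to the
outgoing tangent, whose radial projection is the arc of great circle. Telescoping over a period
(`rel_of_local`) gives `tendsto_chordLog_sub`, and the antipodal frame gives the same for -Γ
(`tendsto_boundaryLog_sub`). Comparing the two computations yields the variation formula, first for
paths missing a pole (`localTait_eq_add_of_pole`), then for all transverse paths.

Four further facts complete the proof. Degenerate directions form a null set (`volume_badCone`), so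
regular directions are dense and `localTait` is defined and locally constant off the indicatrix. For
polygonal knots, good directions off the indicatrix are automatically transverse
(`IsPLKnot.isTransverseDiagram`). Generic arcs of great circle give transverse paths
(`exists_isTransversePath`). The sphere is simply connected (`homotopic_S2`). -/

theorem Convex.exists_continuousOn_log {E : Type*} [NormedAddCommGroup E] [NormedSpace ℝ E]
    {s : Set E} (hs : Convex ℝ s) {f : E → ℂ} (hf : ContinuousOn f s)
    (h0 : ∀ x ∈ s, f x ≠ 0) :
    ∃ g : E → ℂ, ContinuousOn g s ∧ ∀ x ∈ s, Complex.exp (g x) = f x := by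
  classical
  rcases s.eq_empty_or_nonempty with rfl | ⟨x₀, hx₀⟩
  · exact ⟨fun _ => 0, continuousOn_empty _, by simp⟩
  -- A convex set is simply connected and locally path connected, so f lifts through the covering
  -- map exp.
  have := hs.contractibleSpace ⟨x₀, hx₀⟩
  have := hs.locallyPathConnectedSpace
  obtain ⟨F, ⟨-, hF⟩, -⟩ := Complex.isCoveringMapOn_exp.existsUnique_continuousMap_lifts
    (⟨fun x : s => f x, continuousOn_iff_continuous_domRestrict.mp hf⟩ : C(s, ℂ))
    (a₀ := ⟨x₀, hx₀⟩) (Complex.exp_log (h0 x₀ hx₀)) (fun x => h0 x x.2)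
  refine ⟨fun z => if hz : z ∈ s then F ⟨z, hz⟩ else 0, ?_, fun x hx => ?_⟩
  · rw [continuousOn_iff_continuous_domRestrict]
    convert! map_continuous F using 1
    ext z
    simp
  · have := congr_fun hF ⟨x, hx⟩
    simp only [hx, dite_true]
    exact this

/-- The change of a continuous logarithm of `g` along `[a, b]`. -/
def dlog (g : ℝ → ℂ) (a b : ℝ) : ℂ :=
  open Classical in
  -- The choice of the logarithm is immaterial by `dlog_eq`; the value 0 is only a default for
  -- functions without a continuous logarithm.
  if h : ∃ l : ℝ → ℂ, ContinuousOn l (Icc a b) ∧ ∀ x ∈ Icc a b, Complex.exp (l x) = g x then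
    h.choose b - h.choose a else 0

/-- A continuous function on an interval with values in the discrete group 2πiℤ is constant. -/
theorem eq_of_continuousOn_of_exp_eq_one {d : ℝ → ℂ} {a b : ℝ} (hab : a ≤ b)
    (hd : ContinuousOn d (Icc a b)) (h1 : ∀ x ∈ Icc a b, Complex.exp (d x) = 1) : d b = d a := by
  have hmaps : MapsTo d (Icc a b) (AddSubgroup.zmultiples (2 * Real.pi * Complex.I) : Set ℂ) := by
    intro x hx
    obtain ⟨n, hn⟩ := Complex.exp_eq_one_iff.mp (h1 x hx)
    exact ⟨n, by simp [hn]⟩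
  have hdisc : DiscreteTopology (AddSubgroup.zmultiples (2 * Real.pi * Complex.I)) := inferInstance
  exact isPreconnected_Icc.constant_of_mapsTo (T := _) ⟨hdisc⟩ hd hmaps
    (right_mem_Icc.mpr hab) (left_mem_Icc.mpr hab)

theorem dlog_eq {g l : ℝ → ℂ} {a b : ℝ} (hab : a ≤ b) (hl : ContinuousOn l (Icc a b))
    (he : ∀ x ∈ Icc a b, Complex.exp (l x) = g x) : dlog g a b = l b - l a := by
  have h : ∃ l : ℝ → ℂ, ContinuousOn l (Icc a b) ∧ ∀ x ∈ Icc a b, Complex.exp (l x) = g x :=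
    ⟨l, hl, he⟩
  rw [dlog, dif_pos h]
  obtain ⟨h1, h2⟩ := h.choose_spec
  have := eq_of_continuousOn_of_exp_eq_one (d := fun x => h.choose x - l x) hab (h1.sub hl)
    (fun x hx => by rw [Complex.exp_sub, h2 x hx, he x hx, div_self]; rw [← he x hx]
                    exact Complex.exp_ne_zero _)
  linear_combination this

theorem exists_log_Icc {g : ℝ → ℂ} {a b : ℝ} (hg : ContinuousOn g (Icc a b))
    (h0 : ∀ x ∈ Icc a b, g x ≠ 0) :
    ∃ l : ℝ → ℂ, ContinuousOn l (Icc a b) ∧ ∀ x ∈ Icc a b, Complex.exp (l x) = g x :=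
  (convex_Icc a b).exists_continuousOn_log hg h0

theorem dlog_congr {g g' : ℝ → ℂ} {a b : ℝ} (hab : a ≤ b) (hg : ContinuousOn g (Icc a b))
    (h0 : ∀ x ∈ Icc a b, g x ≠ 0) (h : ∀ x ∈ Icc a b, g x = g' x) :
    dlog g a b = dlog g' a b := by
  obtain ⟨l, hl, he⟩ := exists_log_Icc hg h0
  rw [dlog_eq hab hl he, dlog_eq hab hl (fun x hx => (he x hx).trans (h x hx))]

theorem dlog_mul {g g' : ℝ → ℂ} {a b : ℝ} (hab : a ≤ b) (hg : ContinuousOn g (Icc a b))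
    (h0 : ∀ x ∈ Icc a b, g x ≠ 0) (hg' : ContinuousOn g' (Icc a b))
    (h0' : ∀ x ∈ Icc a b, g' x ≠ 0) :
    dlog (fun x => g x * g' x) a b = dlog g a b + dlog g' a b := by
  obtain ⟨l, hl, he⟩ := exists_log_Icc hg h0
  obtain ⟨l', hl', he'⟩ := exists_log_Icc hg' h0'
  rw [dlog_eq hab hl he, dlog_eq hab hl' he', dlog_eq (l := fun x => l x + l' x) hab (hl.add hl')
    (fun x hx => by rw [Complex.exp_add, he x hx, he' x hx])]
  ring

theorem dlog_const {w : ℂ} (hw : w ≠ 0) {a b : ℝ} (hab : a ≤ b) : dlog (fun _ => w) a b = 0 := by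
  rw [dlog_eq (l := fun _ => Complex.log w) hab continuousOn_const
    (fun x _ => Complex.exp_log hw), sub_self]

theorem dlog_const_mul {w : ℂ} (hw : w ≠ 0) {g : ℝ → ℂ} {a b : ℝ} (hab : a ≤ b)
    (hg : ContinuousOn g (Icc a b)) (h0 : ∀ x ∈ Icc a b, g x ≠ 0) :
    dlog (fun x => w * g x) a b = dlog g a b := by
  rw [dlog_mul hab continuousOn_const (fun _ _ => hw) hg h0, dlog_const hw hab, zero_add]

theorem dlog_trans {g : ℝ → ℂ} {a b c : ℝ} (hab : a ≤ b) (hbc : b ≤ c)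
    (hg : ContinuousOn g (Icc a c)) (h0 : ∀ x ∈ Icc a c, g x ≠ 0) :
    dlog g a b + dlog g b c = dlog g a c := by
  obtain ⟨l, hl, he⟩ := exists_log_Icc hg h0
  have h1 : Icc a b ⊆ Icc a c := Icc_subset_Icc_right hbc
  have h2 : Icc b c ⊆ Icc a c := Icc_subset_Icc_left hab
  rw [dlog_eq hab (hl.mono h1) (fun x hx => he x (h1 hx)),
    dlog_eq hbc (hl.mono h2) (fun x hx => he x (h2 hx)), dlog_eq (hab.trans hbc) hl he]
  ring

theorem dlog_slitPlane {g : ℝ → ℂ} {a b : ℝ} (hab : a ≤ b) (hg : ContinuousOn g (Icc a b))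
    (h0 : ∀ x ∈ Icc a b, g x ∈ Complex.slitPlane) :
    dlog g a b = Complex.log (g b) - Complex.log (g a) :=
  dlog_eq (l := fun x => Complex.log (g x)) hab (hg.clog h0)
    (fun x hx => Complex.exp_log (Complex.slitPlane_ne_zero (h0 x hx)))

theorem dlog_conj {g : ℝ → ℂ} {a b : ℝ} (hab : a ≤ b) (hg : ContinuousOn g (Icc a b))
    (h0 : ∀ x ∈ Icc a b, g x ≠ 0) :
    dlog (fun x => (starRingEnd ℂ) (g x)) a b = (starRingEnd ℂ) (dlog g a b) := by
  obtain ⟨l, hl, he⟩ := exists_log_Icc hg h0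
  rw [dlog_eq hab hl he, dlog_eq (l := fun x => (starRingEnd ℂ) (l x)) hab
    (Complex.continuous_conj.comp_continuousOn hl)
    (fun x hx => by rw [Complex.exp_conj, he x hx]), map_sub]

theorem dlog_comp_add {g : ℝ → ℂ} {a b : ℝ} (e : ℝ) (hab : a ≤ b)
    (hg : ContinuousOn g (Icc (a + e) (b + e))) (h0 : ∀ x ∈ Icc (a + e) (b + e), g x ≠ 0) :
    dlog (fun x => g (x + e)) a b = dlog g (a + e) (b + e) := by
  obtain ⟨l, hl, he⟩ := exists_log_Icc hg h0
  have hm : MapsTo (fun x => x + e) (Icc a b) (Icc (a + e) (b + e)) :=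
    fun x hx => ⟨by linarith [hx.1], by linarith [hx.2]⟩
  rw [dlog_eq (by linarith) hl he, dlog_eq (l := fun x => l (x + e)) hab
    (hl.comp (by fun_prop) hm) (fun x hx => he _ (hm hx))]

/-- Both sides differ from the change along [a, b + 1] by the change along [a, b] or its translate
by one period. -/
theorem dlog_periodic {g : ℝ → ℂ} (hg : Continuous g) (h0 : ∀ x, g x ≠ 0)
    (hp : Function.Periodic g 1) (a b : ℝ) : dlog g a (a + 1) = dlog g b (b + 1) := by
  wlog hab : a ≤ b generalizing a b
  · exact (this b a (le_of_not_ge hab)).symm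
  have h1 := dlog_trans (g := g) (a := a) (b := b) (c := b + 1) hab (by linarith)
    hg.continuousOn (fun x _ => h0 x)
  have h2 := dlog_trans (g := g) (a := a) (b := a + 1) (c := b + 1) (by linarith) (by linarith)
    hg.continuousOn (fun x _ => h0 x)
  have h3 := dlog_comp_add (g := g) (a := a) (b := b) 1 hab hg.continuousOn (fun x _ => h0 x)
  have h4 : (fun x => g (x + 1)) = g := funext hp
  rw [h4] at h3
  linear_combination h2 - h1 + h3

/-- The positive factor has its own real logarithm, which returns to its initial value. -/
theorem dlog_pos_smul {g : ℝ → ℂ} {r : ℝ → ℝ} {a b : ℝ} (hab : a ≤ b)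
    (hg : ContinuousOn g (Icc a b)) (h0 : ∀ x ∈ Icc a b, g x ≠ 0)
    (hr : ContinuousOn r (Icc a b)) (hr0 : ∀ x ∈ Icc a b, 0 < r x) (heq : r a = r b) :
    dlog (fun x => (r x : ℂ) * g x) a b = dlog g a b := by
  have hr' : ContinuousOn (fun x => (r x : ℂ)) (Icc a b) :=
    Complex.continuous_ofReal.comp_continuousOn hr
  rw [dlog_mul hab hr' (fun x hx => by simpa using (hr0 x hx).ne') hg h0, dlog_slitPlane hab hr'
    (fun x hx => by simpa using hr0 x hx), heq, sub_self, zero_add]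

/-! ### The winding number along the boundary of a rectangle -/

/-- The change of the logarithm of `F` along the boundary of `[a, b] × [c, d]`. -/
def bdry (F : ℝ × ℝ → ℂ) (a b c d : ℝ) : ℂ :=
  dlog (fun x => F (x, c)) a b + dlog (fun y => F (b, y)) c d -
    dlog (fun x => F (x, d)) a b - dlog (fun y => F (a, y)) c d

/-- The Jacobian determinant. -/
def jac (L : ℝ × ℝ →L[ℝ] ℂ) : ℝ :=
  (L (1, 0)).re * (L (0, 1)).im - (L (1, 0)).im * (L (0, 1)).re

/-- The boundary of a rectangle. -/
def rectBdry (a b c d : ℝ) : Set (ℝ × ℝ) := (Icc a b ×ˢ Icc c d) \ (Ioo a b ×ˢ Ioo c d)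

section

variable {F G : ℝ × ℝ → ℂ} {a b c d : ℝ}

theorem mem_rectBdry_bottom (hcd : c ≤ d) {x : ℝ} (hx : x ∈ Icc a b) :
    (x, c) ∈ rectBdry a b c d := by
  simp only [rectBdry, Set.mem_sdiff, mem_prod, mem_Icc, mem_Ioo]; grind

theorem mem_rectBdry_top (hcd : c ≤ d) {x : ℝ} (hx : x ∈ Icc a b) :
    (x, d) ∈ rectBdry a b c d := by
  simp only [rectBdry, Set.mem_sdiff, mem_prod, mem_Icc, mem_Ioo]; grind

theorem mem_rectBdry_left (hab : a ≤ b) {x : ℝ} (hx : x ∈ Icc c d) :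
    (a, x) ∈ rectBdry a b c d := by
  simp only [rectBdry, Set.mem_sdiff, mem_prod, mem_Icc, mem_Ioo]; grind

theorem mem_rectBdry_right (hab : a ≤ b) {x : ℝ} (hx : x ∈ Icc c d) :
    (b, x) ∈ rectBdry a b c d := by
  simp only [rectBdry, Set.mem_sdiff, mem_prod, mem_Icc, mem_Ioo]; grind

theorem continuousOn_bottom (hcd : c ≤ d) (hF : ContinuousOn F (rectBdry a b c d)) :
    ContinuousOn (fun x => F (x, c)) (Icc a b) :=
  hF.comp (by fun_prop) (fun _ hx => mem_rectBdry_bottom hcd hx)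

theorem continuousOn_top (hcd : c ≤ d) (hF : ContinuousOn F (rectBdry a b c d)) :
    ContinuousOn (fun x => F (x, d)) (Icc a b) :=
  hF.comp (by fun_prop) (fun _ hx => mem_rectBdry_top hcd hx)

theorem continuousOn_left (hab : a ≤ b) (hF : ContinuousOn F (rectBdry a b c d)) :
    ContinuousOn (fun x => F (a, x)) (Icc c d) :=
  hF.comp (by fun_prop) (fun _ hx => mem_rectBdry_left hab hx)

theorem continuousOn_right (hab : a ≤ b) (hF : ContinuousOn F (rectBdry a b c d)) :
    ContinuousOn (fun x => F (b, x)) (Icc c d) :=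
  hF.comp (by fun_prop) (fun _ hx => mem_rectBdry_right hab hx)

theorem bdry_mul (hab : a ≤ b) (hcd : c ≤ d) (hF : ContinuousOn F (rectBdry a b c d))
    (hG : ContinuousOn G (rectBdry a b c d)) (hF0 : ∀ p ∈ rectBdry a b c d, F p ≠ 0)
    (hG0 : ∀ p ∈ rectBdry a b c d, G p ≠ 0) :
    bdry (fun p => F p * G p) a b c d = bdry F a b c d + bdry G a b c d := by
  unfold bdry
  rw [dlog_mul hab (continuousOn_bottom hcd hF) (fun x hx => hF0 _ (mem_rectBdry_bottom hcd hx))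
      (continuousOn_bottom hcd hG) (fun x hx => hG0 _ (mem_rectBdry_bottom hcd hx)),
    dlog_mul hab (continuousOn_top hcd hF) (fun x hx => hF0 _ (mem_rectBdry_top hcd hx))
      (continuousOn_top hcd hG) (fun x hx => hG0 _ (mem_rectBdry_top hcd hx)),
    dlog_mul hcd (continuousOn_left hab hF) (fun x hx => hF0 _ (mem_rectBdry_left hab hx))
      (continuousOn_left hab hG) (fun x hx => hG0 _ (mem_rectBdry_left hab hx)),
    dlog_mul hcd (continuousOn_right hab hF) (fun x hx => hF0 _ (mem_rectBdry_right hab hx))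
      (continuousOn_right hab hG) (fun x hx => hG0 _ (mem_rectBdry_right hab hx))]
  ring

theorem bdry_congr (hab : a ≤ b) (hcd : c ≤ d) (hF : ContinuousOn F (rectBdry a b c d))
    (hF0 : ∀ p ∈ rectBdry a b c d, F p ≠ 0) (h : ∀ p ∈ rectBdry a b c d, F p = G p) :
    bdry F a b c d = bdry G a b c d := by
  unfold bdry
  rw [dlog_congr hab (continuousOn_bottom hcd hF) (fun x hx => hF0 _ (mem_rectBdry_bottom hcd hx))
      (fun x hx => h _ (mem_rectBdry_bottom hcd hx)),
    dlog_congr hab (continuousOn_top hcd hF) (fun x hx => hF0 _ (mem_rectBdry_top hcd hx))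
      (fun x hx => h _ (mem_rectBdry_top hcd hx)),
    dlog_congr hcd (continuousOn_left hab hF) (fun x hx => hF0 _ (mem_rectBdry_left hab hx))
      (fun x hx => h _ (mem_rectBdry_left hab hx)),
    dlog_congr hcd (continuousOn_right hab hF) (fun x hx => hF0 _ (mem_rectBdry_right hab hx))
      (fun x hx => h _ (mem_rectBdry_right hab hx))]

theorem bdry_conj (hab : a ≤ b) (hcd : c ≤ d) (hF : ContinuousOn F (rectBdry a b c d))
    (hF0 : ∀ p ∈ rectBdry a b c d, F p ≠ 0) :
    bdry (fun p => (starRingEnd ℂ) (F p)) a b c d = (starRingEnd ℂ) (bdry F a b c d) := by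
  unfold bdry
  rw [dlog_conj hab (continuousOn_bottom hcd hF) (fun x hx => hF0 _ (mem_rectBdry_bottom hcd hx)),
    dlog_conj hab (continuousOn_top hcd hF) (fun x hx => hF0 _ (mem_rectBdry_top hcd hx)),
    dlog_conj hcd (continuousOn_left hab hF) (fun x hx => hF0 _ (mem_rectBdry_left hab hx)),
    dlog_conj hcd (continuousOn_right hab hF) (fun x hx => hF0 _ (mem_rectBdry_right hab hx))]
  simp

theorem bdry_eq_zero_of_log {l : ℝ × ℝ → ℂ} (hab : a ≤ b) (hcd : c ≤ d)
    (hl : ContinuousOn l (rectBdry a b c d))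
    (he : ∀ p ∈ rectBdry a b c d, Complex.exp (l p) = F p) : bdry F a b c d = 0 := by
  unfold bdry
  rw [dlog_eq (l := fun x => l (x, c)) hab (continuousOn_bottom hcd hl)
      (fun x hx => he _ (mem_rectBdry_bottom hcd hx)),
    dlog_eq (l := fun x => l (x, d)) hab (continuousOn_top hcd hl)
      (fun x hx => he _ (mem_rectBdry_top hcd hx)),
    dlog_eq (l := fun x => l (a, x)) hcd (continuousOn_left hab hl)
      (fun x hx => he _ (mem_rectBdry_left hab hx)),
    dlog_eq (l := fun x => l (b, x)) hcd (continuousOn_right hab hl)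
      (fun x hx => he _ (mem_rectBdry_right hab hx))]
  ring

theorem rectBdry_subset : rectBdry a b c d ⊆ Icc a b ×ˢ Icc c d := sdiff_subset

theorem bdry_eq_zero (hab : a ≤ b) (hcd : c ≤ d) (hF : ContinuousOn F (Icc a b ×ˢ Icc c d))
    (hF0 : ∀ p ∈ Icc a b ×ˢ Icc c d, F p ≠ 0) : bdry F a b c d = 0 := by
  obtain ⟨l, hl, he⟩ :=
    ((convex_Icc a b).prod (convex_Icc c d)).exists_continuousOn_log hF hF0
  exact bdry_eq_zero_of_log hab hcd (hl.mono rectBdry_subset) (fun p hp => he p (rectBdry_subset hp))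

theorem bdry_const {w : ℂ} (hw : w ≠ 0) (hab : a ≤ b) (hcd : c ≤ d) :
    bdry (fun _ => w) a b c d = 0 :=
  bdry_eq_zero hab hcd continuousOn_const (fun _ _ => hw)

theorem Complex.log_I_mul_of_re_pos {z : ℂ} (hz : 0 < z.re) :
    Complex.log (Complex.I * z) = Complex.log z + Complex.I * (Real.pi / 2) := by
  have h := abs_lt.mp (Complex.abs_arg_lt_pi_div_two_iff.mpr (Or.inl hz))
  have h0 : z ≠ 0 := by rintro rfl; simp at hz
  rw [(Complex.log_mul_eq_add_log_iff Complex.I_ne_zero h0).mpr, Complex.log_I]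
  · ring
  · rw [Complex.arg_I]; constructor <;> linarith [h.1, h.2]

theorem bdry_id {z : ℝ × ℝ} (hz : z ∈ Ioo a b ×ˢ Ioo c d) :
    bdry (fun p => ⟨p.1 - z.1, p.2 - z.2⟩) a b c d = 2 * Real.pi * Complex.I := by
  obtain ⟨⟨h1, h2⟩, h3, h4⟩ := hz
  have hab : a ≤ b := by linarith
  have hcd : c ≤ d := by linarith
  have hc : Continuous (fun p : ℝ × ℝ => (⟨p.1 - z.1, p.2 - z.2⟩ : ℂ)) := by
    have : (fun p : ℝ × ℝ => (⟨p.1 - z.1, p.2 - z.2⟩ : ℂ)) =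
        fun p => ((p.1 - z.1 : ℝ) : ℂ) + ((p.2 - z.2 : ℝ) : ℂ) * Complex.I := by
      ext p
      apply Complex.ext <;> simp
    rw [this]; fun_prop
  -- Each side of the rectangle is rotated by w = I, 1, -I or -1 into the right half-plane, where
  -- the principal logarithm is continuous. At each of the four corners the two logarithms involved
  -- differ by a quarter turn.
  have key : ∀ (w : ℂ) (g : ℝ → ℂ) (x y : ℝ), w ≠ 0 → x ≤ y → Continuous g →
      (∀ t ∈ Icc x y, 0 < (w * g t).re) →
      dlog g x y = Complex.log (w * g y) - Complex.log (w * g x) := by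
    intro w g x y hw hxy hg hpos
    have hne : ∀ t ∈ Icc x y, g t ≠ 0 := by
      intro t ht h0
      have := hpos t ht
      simp [h0] at this
    rw [← dlog_const_mul hw hxy hg.continuousOn hne]
    exact dlog_slitPlane hxy (by fun_prop) (fun t ht => Or.inl (hpos t ht))
  have q2 := Complex.log_I_mul_of_re_pos (z := ⟨b - z.1, c - z.2⟩) (by simpa using h2)
  have q3 := Complex.log_I_mul_of_re_pos (z := -Complex.I * ⟨b - z.1, d - z.2⟩) (by simpa using h4)
  have q4 := Complex.log_I_mul_of_re_pos (z := -⟨a - z.1, d - z.2⟩) (by simpa using h1)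
  have q1 := Complex.log_I_mul_of_re_pos (z := Complex.I * ⟨a - z.1, c - z.2⟩) (by simpa using h3)
  have e3 : Complex.I * (-Complex.I * ⟨b - z.1, d - z.2⟩) = (⟨b - z.1, d - z.2⟩ : ℂ) := by
    rw [← mul_assoc]; simp
  have e1 : Complex.I * (Complex.I * ⟨a - z.1, c - z.2⟩) = -(⟨a - z.1, c - z.2⟩ : ℂ) := by
    rw [← mul_assoc]; simp
  have e4 : Complex.I * -⟨a - z.1, d - z.2⟩ = -Complex.I * (⟨a - z.1, d - z.2⟩ : ℂ) := by ring
  rw [e3] at q3; rw [e1] at q1; rw [e4] at q4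
  unfold bdry
  rw [key Complex.I (fun x => ⟨x - z.1, c - z.2⟩) a b Complex.I_ne_zero hab
      (hc.comp (f := fun x => (x, c)) (by fun_prop)) (fun t ht => by simpa using h3),
    key 1 (fun x => ⟨b - z.1, x - z.2⟩) c d one_ne_zero hcd
      (hc.comp (f := fun x => (b, x)) (by fun_prop)) (fun t ht => by simpa using h2),
    key (-Complex.I) (fun x => ⟨x - z.1, d - z.2⟩) a b (by simp) hab
      (hc.comp (f := fun x => (x, d)) (by fun_prop)) (fun t ht => by simpa using h4),
    key (-1) (fun x => ⟨a - z.1, x - z.2⟩) c d (by simp) hcd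
      (hc.comp (f := fun x => (a, x)) (by fun_prop)) (fun t ht => by simpa using h1)]
  simp only [one_mul, neg_one_mul]
  rw [q2, q3, q4, q1]
  ring

end

/-! ### Nondegenerate zeros and the argument principle. -/

section

variable {F G : ℝ × ℝ → ℂ} {a b c d : ℝ}

theorem continuous_complex_mk_sub (z : ℝ × ℝ) :
    Continuous (fun p : ℝ × ℝ => (⟨p.1 - z.1, p.2 - z.2⟩ : ℂ)) := by
  have : (fun p : ℝ × ℝ => (⟨p.1 - z.1, p.2 - z.2⟩ : ℂ)) =
      fun p => ((p.1 - z.1 : ℝ) : ℂ) + ((p.2 - z.2 : ℝ) : ℂ) * Complex.I := by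
    ext p
    apply Complex.ext <;> simp
  rw [this]; fun_prop

theorem ne_of_mem_rectBdry {z p : ℝ × ℝ} (hz : z ∈ Ioo a b ×ˢ Ioo c d)
    (hp : p ∈ rectBdry a b c d) : p ≠ z := fun h => hp.2 (h ▸ hz)

theorem complex_mk_sub_ne_zero {z p : ℝ × ℝ} (hp : p ≠ z) :
    (⟨p.1 - z.1, p.2 - z.2⟩ : ℂ) ≠ 0 := by
  intro h
  apply hp
  have h1 := congrArg Complex.re h
  have h2 := congrArg Complex.im h
  simp only [Complex.zero_re, Complex.zero_im] at h1 h2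
  ext <;> linarith

/-- Factor α w + β w̄ as α · (1 + (β/α)(w̄/w)) · w. The middle factor stays at distance less than
one from 1 and has a principal logarithm, so only w winds. -/
theorem bdry_add_conj {z : ℝ × ℝ} (hz : z ∈ Ioo a b ×ˢ Ioo c d) {α β : ℂ} (h : ‖β‖ < ‖α‖) :
    bdry (fun p => α * ⟨p.1 - z.1, p.2 - z.2⟩ + β * (starRingEnd ℂ) ⟨p.1 - z.1, p.2 - z.2⟩) a b c d
      = 2 * Real.pi * Complex.I := by
  have hab : a ≤ b := (hz.1.1.trans hz.1.2).le
  have hcd : c ≤ d := (hz.2.1.trans hz.2.2).le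
  have hα : α ≠ 0 := by rintro rfl; simp at h; exact absurd h (not_lt.mpr (norm_nonneg _))
  set w : ℝ × ℝ → ℂ := fun p => ⟨p.1 - z.1, p.2 - z.2⟩ with hw
  have hwc : Continuous w := continuous_complex_mk_sub z
  have hw0 : ∀ p ∈ rectBdry a b c d, w p ≠ 0 := fun p hp =>
    complex_mk_sub_ne_zero (ne_of_mem_rectBdry hz hp)
  set S : ℝ × ℝ → ℂ := fun p => 1 + β / α * ((starRingEnd ℂ) (w p) / w p) with hS
  have hSc : ContinuousOn S (rectBdry a b c d) := by
    apply continuousOn_const.add (continuousOn_const.mul _)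
    exact (Complex.continuous_conj.comp hwc).continuousOn.div hwc.continuousOn hw0
  have hSs : ∀ p ∈ rectBdry a b c d, S p ∈ Complex.slitPlane := by
    intro p hp
    apply Complex.mem_slitPlane_of_norm_lt_one
    rw [norm_mul, norm_div, norm_div, Complex.norm_conj, div_self (norm_ne_zero_iff.mpr (hw0 p hp)),
      mul_one, div_lt_one (norm_pos_iff.mpr hα)]
    exact h
  have hS0 : ∀ p ∈ rectBdry a b c d, S p ≠ 0 := fun p hp => Complex.slitPlane_ne_zero (hSs p hp)
  have e : ∀ p ∈ rectBdry a b c d, α * S p * w p = α * w p + β * (starRingEnd ℂ) (w p) := by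
    intro p hp
    have := hw0 p hp
    simp only [hS]
    field_simp
  have hαS : ContinuousOn (fun p => α * S p) (rectBdry a b c d) := continuousOn_const.mul hSc
  have hαS0 : ∀ p ∈ rectBdry a b c d, α * S p ≠ 0 := fun p hp => mul_ne_zero hα (hS0 p hp)
  rw [← bdry_congr (F := fun p => α * S p * w p) hab hcd (hαS.mul hwc.continuousOn) (fun p hp => mul_ne_zero (hαS0 p hp) (hw0 p hp)) e,
    bdry_mul hab hcd hαS hwc.continuousOn hαS0 hw0,
    bdry_mul hab hcd continuousOn_const hSc (fun _ _ => hα) hS0, bdry_const hα hab hcd,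
    bdry_eq_zero_of_log (l := fun p => Complex.log (S p)) hab hcd (hSc.clog hSs)
      (fun p hp => Complex.exp_log (hS0 p hp)), bdry_id hz]
  ring

theorem clm_prod_apply (L : ℝ × ℝ →L[ℝ] ℂ) (p : ℝ × ℝ) :
    L p = p.1 * L (1, 0) + p.2 * L (0, 1) := by
  have : p = p.1 • ((1, 0) : ℝ × ℝ) + p.2 • ((0, 1) : ℝ × ℝ) := by ext <;> simp
  conv_lhs => rw [this]
  simp only [map_add, map_smul, Complex.real_smul]

/-- A real linear map of the plane is w ↦ α w + β w̄, with Jacobian ‖α‖² - ‖β‖². For a positive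
Jacobian `bdry_add_conj` applies; a negative one is made positive by complex conjugation, which
reverses the winding number. -/
theorem bdry_linear {z : ℝ × ℝ} (hz : z ∈ Ioo a b ×ˢ Ioo c d) {L : ℝ × ℝ →L[ℝ] ℂ}
    (hL : jac L ≠ 0) :
    bdry (fun p => L (p - z)) a b c d =
      2 * Real.pi * Complex.I * ((SignType.sign (jac L) : ℤ) : ℂ) := by
  have hab : a ≤ b := (hz.1.1.trans hz.1.2).le
  have hcd : c ≤ d := (hz.2.1.trans hz.2.2).le
  set A := L (1, 0) with hA
  set B := L (0, 1) with hB
  set α := (A - Complex.I * B) / 2 with hα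
  set β := (A + Complex.I * B) / 2 with hβ
  have hjac : jac L = ‖α‖ ^ 2 - ‖β‖ ^ 2 := by
    rw [← Complex.normSq_eq_norm_sq, ← Complex.normSq_eq_norm_sq, Complex.normSq_apply,
      Complex.normSq_apply, jac, ← hA, ← hB]
    simp [hα, hβ]
    ring
  have e : (fun p : ℝ × ℝ => L (p - z)) = fun p => α * ⟨p.1 - z.1, p.2 - z.2⟩ +
      β * (starRingEnd ℂ) ⟨p.1 - z.1, p.2 - z.2⟩ := by
    funext p
    rw [clm_prod_apply L, ← hA, ← hB]
    apply Complex.ext <;> simp [hα, hβ] <;> ring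
  rw [e]
  rcases lt_or_gt_of_ne hL with h | h
  · have hlt : ‖α‖ < ‖β‖ := by
      rw [← sq_lt_sq₀ (norm_nonneg _) (norm_nonneg _)]; linarith
    have h2 := bdry_add_conj hz (α := (starRingEnd ℂ) β) (β := (starRingEnd ℂ) α)
      (by simpa using hlt)
    have hne : ∀ p ∈ rectBdry a b c d, (starRingEnd ℂ) β * ⟨p.1 - z.1, p.2 - z.2⟩ +
        (starRingEnd ℂ) α * (starRingEnd ℂ) ⟨p.1 - z.1, p.2 - z.2⟩ ≠ 0 := by
      intro p hp h0
      have hw := complex_mk_sub_ne_zero (ne_of_mem_rectBdry hz hp)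
      have h4 := congrArg norm (eq_neg_of_add_eq_zero_left h0)
      rw [norm_neg, norm_mul, norm_mul, Complex.norm_conj, Complex.norm_conj, Complex.norm_conj] at h4
      have := mul_right_cancel₀ (norm_ne_zero_iff.mpr hw) h4
      linarith
    have h3 := bdry_conj (F := fun p => (starRingEnd ℂ) β * ⟨p.1 - z.1, p.2 - z.2⟩ +
        (starRingEnd ℂ) α * (starRingEnd ℂ) ⟨p.1 - z.1, p.2 - z.2⟩) hab hcd
      (by
        have := continuous_complex_mk_sub z
        have h5 := Complex.continuous_conj.comp this
        exact ((continuous_const.mul this).add (continuous_const.mul h5)).continuousOn) hne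
    rw [h2] at h3
    have e2 : (fun p : ℝ × ℝ => (starRingEnd ℂ) ((starRingEnd ℂ) β * ⟨p.1 - z.1, p.2 - z.2⟩ +
        (starRingEnd ℂ) α * (starRingEnd ℂ) ⟨p.1 - z.1, p.2 - z.2⟩)) = fun p =>
        α * ⟨p.1 - z.1, p.2 - z.2⟩ + β * (starRingEnd ℂ) ⟨p.1 - z.1, p.2 - z.2⟩ := by
      funext p; simp; ring
    rw [e2] at h3
    rw [h3, sign_neg h]
    simp [Complex.conj_ofNat]
  · have hlt : ‖β‖ < ‖α‖ := by
      rw [← sq_lt_sq₀ (norm_nonneg _) (norm_nonneg _)]; linarith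
    rw [bdry_add_conj hz hlt, sign_pos h]
    simp

theorem jac_ne_zero_injective {L : ℝ × ℝ →L[ℝ] ℂ} (hL : jac L ≠ 0) (p : ℝ × ℝ) (hp : L p = 0) :
    p = 0 := by
  rw [clm_prod_apply] at hp
  have h1 := congrArg Complex.re hp
  have h2 := congrArg Complex.im hp
  simp at h1 h2
  have e1 : p.1 * jac L = 0 := by unfold jac; linear_combination (L (0, 1)).im * h1 - (L (0, 1)).re * h2
  have e2 : p.2 * jac L = 0 := by unfold jac; linear_combination (L (1, 0)).re * h2 - (L (1, 0)).im * h1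
  ext
  · simpa [hL] using e1
  · simpa [hL] using e2

theorem exists_antilipschitz_of_jac {L : ℝ × ℝ →L[ℝ] ℂ} (hL : jac L ≠ 0) :
    ∃ C, AntilipschitzWith C L := by
  obtain ⟨K, -, hK⟩ := (L : ℝ × ℝ →ₗ[ℝ] ℂ).exists_antilipschitzWith
    (LinearMap.ker_eq_bot'.mpr (fun p hp => jac_ne_zero_injective hL p hp))
  exact ⟨K, hK⟩

/-- Dividing a function by its derivative at a nondegenerate zero. -/
theorem HasFDerivAt.tendsto_div {z : ℝ × ℝ} {L : ℝ × ℝ →L[ℝ] ℂ} (hF : HasFDerivAt F L z)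
    (h0 : F z = 0) (hL : jac L ≠ 0) :
    Tendsto (fun p => F p / L (p - z)) (𝓝[≠] z) (𝓝 1) := by
  obtain ⟨K, hK⟩ := exists_antilipschitz_of_jac hL
  have h1 : (fun p => F p - L (p - z)) =o[𝓝 z] fun p => L (p - z) := by
    have := hF.isLittleO
    simp only [h0, sub_zero] at this
    refine this.trans_isBigO (Asymptotics.IsBigO.of_bound K (Eventually.of_forall fun p => ?_))
    simpa using hK.le_mul_dist (p - z) 0
  have h2 := (h1.mono nhdsWithin_le_nhds).tendsto_div_nhds_zero (l := 𝓝[≠] z)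
  have h3 : Tendsto (fun p => (F p - L (p - z)) / L (p - z) + 1) (𝓝[≠] z) (𝓝 1) := by
    simpa using h2.add_const 1
  refine h3.congr' ?_
  filter_upwards [self_mem_nhdsWithin] with p hp
  have : L (p - z) ≠ 0 := fun h => hp (sub_eq_zero.mp (jac_ne_zero_injective hL _ h))
  field_simp
  ring

theorem jac_complex_smul (w : ℂ) (L : ℝ × ℝ →L[ℝ] ℂ) :
    jac (w • L) = Complex.normSq w * jac L := by
  simp [jac, Complex.normSq_apply]
  ring

/-- The winding number along the boundary of a rectangle of a function with nondegenerate zeros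
is the number of zeros, counted with the signs of the Jacobians. -/
theorem bdry_eq_sum_sign (hab : a < b) (hcd : c < d) (Z : Finset (ℝ × ℝ))
    (hF : ContinuousOn F (Icc a b ×ˢ Icc c d))
    (hZ : ∀ z ∈ Z, z ∈ Ioo a b ×ˢ Ioo c d) (hne : ∀ p ∈ Icc a b ×ˢ Icc c d, F p = 0 → p ∈ Z)
    (L : ℝ × ℝ → (ℝ × ℝ →L[ℝ] ℂ)) (hL : ∀ z ∈ Z, HasFDerivAt F (L z) z) (h0 : ∀ z ∈ Z, F z = 0)
    (hdet : ∀ z ∈ Z, jac (L z) ≠ 0) :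
    bdry F a b c d = 2 * Real.pi * Complex.I *
      ((∑ z ∈ Z, (SignType.sign (jac (L z)) : ℤ) : ℤ) : ℂ) := by
  classical
  induction Z using Finset.induction_on generalizing F L with
  | empty => simpa using bdry_eq_zero hab.le hcd.le hF (fun p hp h => by simpa using hne p hp h)
  | insert z Z hzZ ih =>
    have hzm := Finset.mem_insert_self z Z
    have hjz := hdet z hzm
    have hLne : ∀ p, p ≠ z → L z (p - z) ≠ 0 := fun p hp h =>
      hp (sub_eq_zero.mp (jac_ne_zero_injective hjz _ h))
    -- Division by the linear part at z removes this zero: the quotient extends continuously by 1.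
    -- At the other zeros the derivative is multiplied by a nonzero complex number, which preserves
    -- the sign of the Jacobian.
    set G : ℝ × ℝ → ℂ := fun p => if p = z then 1 else F p / L z (p - z) with hG
    have hGne : ∀ p, p ≠ z → G p = F p / L z (p - z) := fun p hp => by simp [hG, hp]
    have hGev : ∀ w, w ≠ z → G =ᶠ[𝓝 w] fun p => (L z (p - z))⁻¹ * F p := by
      intro w hw
      filter_upwards [isOpen_ne.mem_nhds hw] with p hp
      rw [hGne p hp, div_eq_inv_mul]
    have hGc : ContinuousOn G (Icc a b ×ˢ Icc c d) := by
      intro p hp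
      by_cases hpz : p = z
      · subst hpz
        apply ContinuousAt.continuousWithinAt
        rw [continuousAt_iff_punctured_nhds]
        have h1 : G p = 1 := by simp [hG]
        rw [h1]
        refine ((hL p hzm).tendsto_div (h0 p hzm) hjz).congr' ?_
        filter_upwards [self_mem_nhdsWithin] with x hx
        rw [hGne x hx]
      · have h1 : ContinuousWithinAt (fun p => (L z (p - z))⁻¹ * F p) (Icc a b ×ˢ Icc c d) p := by
          refine ContinuousWithinAt.mul (ContinuousWithinAt.inv₀ ?_ (hLne p hpz)) (hF p hp)
          exact Continuous.continuousWithinAt (by fun_prop)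
        exact h1.congr_of_eventuallyEq ((hGev p hpz).filter_mono nhdsWithin_le_nhds)
          (hGev p hpz).eq_of_nhds
    have hzw : ∀ w ∈ Z, w ≠ z := fun w hw h => hzZ (h ▸ hw)
    have key := ih (F := G) hGc (fun w hw => hZ w (Finset.mem_insert_of_mem hw))
      (fun p hp h => by
        have hpz : p ≠ z := by rintro rfl; simp [hG] at h
        rw [hGne p hpz, div_eq_zero_iff] at h
        have := hne p hp (h.resolve_right (hLne p hpz))
        exact (Finset.mem_insert.mp this).resolve_left hpz)
      (fun w => (L z (w - z))⁻¹ • L w)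
      (fun w hw => by
        refine HasFDerivAt.congr_of_eventuallyEq ?_ (hGev w (hzw w hw))
        have hw0 := h0 w (Finset.mem_insert_of_mem hw)
        have h1 : HasFDerivAt (fun p => L z (p - z)) (L z) w :=
          (L z).hasFDerivAt.comp w ((hasFDerivAt_id w).sub_const z)
        have h2 : DifferentiableAt ℝ (fun p => (L z (p - z))⁻¹) w :=
          h1.differentiableAt.inv (hLne w (hzw w hw))
        have h3 := h2.hasFDerivAt.mul (hL w (Finset.mem_insert_of_mem hw))
        exact h3.congr_fderiv (ContinuousLinearMap.ext fun v => by simp [hw0]))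
      (fun w hw => by simp [hGne w (hzw w hw), h0 w (Finset.mem_insert_of_mem hw)])
      (fun w hw => by
        rw [jac_complex_smul]
        exact mul_ne_zero (by simpa using hLne w (hzw w hw)) (hdet w (Finset.mem_insert_of_mem hw)))
    have hsum : ∑ w ∈ Z, (SignType.sign (jac ((L z (w - z))⁻¹ • L w)) : ℤ) =
        ∑ w ∈ Z, (SignType.sign (jac (L w)) : ℤ) := by
      refine Finset.sum_congr rfl fun w hw => ?_
      rw [jac_complex_smul, sign_mul, sign_pos (Complex.normSq_pos.mpr
        (inv_ne_zero (hLne w (hzw w hw)))), one_mul]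
    rw [hsum] at key
    have hz := hZ z hzm
    have hbn : ∀ p ∈ rectBdry a b c d, p ≠ z := fun p hp => ne_of_mem_rectBdry hz hp
    have hGb0 : ∀ p ∈ rectBdry a b c d, G p ≠ 0 := by
      intro p hp h
      rw [hGne p (hbn p hp), div_eq_zero_iff] at h
      have := hne p (rectBdry_subset hp) (h.resolve_right (hLne p (hbn p hp)))
      exact hp.2 (hZ p this)
    have hLc : ContinuousOn (fun p => L z (p - z)) (rectBdry a b c d) :=
      Continuous.continuousOn (by fun_prop)
    have hLb0 : ∀ p ∈ rectBdry a b c d, L z (p - z) ≠ 0 := fun p hp => hLne p (hbn p hp)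
    have e := bdry_mul hab.le hcd.le (hGc.mono rectBdry_subset) hLc hGb0 hLb0
    rw [key, bdry_linear hz hjz] at e
    rw [Finset.sum_insert hzZ, ← bdry_congr (F := fun p => G p * L z (p - z)) hab.le hcd.le ((hGc.mono rectBdry_subset).mul hLc)
      (fun p hp => mul_ne_zero (hGb0 p hp) (hLb0 p hp))
      (fun p hp => by rw [hGne p (hbn p hp), div_mul_cancel₀ _ (hLb0 p hp)]), e]
    push_cast
    ring

end

/-! ### Positively oriented orthonormal frames -/

theorem det3_eq (a b c : E3) : det3 a b c =
    a 0 * (b 1 * c 2 - b 2 * c 1) - a 1 * (b 0 * c 2 - b 2 * c 0) +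
      a 2 * (b 0 * c 1 - b 1 * c 0) := by
  simp [det3, Matrix.det_fin_three]
  ring

theorem inner3_eq (a b : E3) : inner ℝ a b = a 0 * b 0 + a 1 * b 1 + a 2 * b 2 := by
  simp [PiLp.inner_apply, Fin.sum_univ_three]
  ring

/-- A positively oriented orthonormal frame of space. -/
structure PosFrame where
  e₁ : E3
  e₂ : E3
  q : E3
  h11 : inner ℝ e₁ e₁ = 1
  h22 : inner ℝ e₂ e₂ = 1
  h33 : inner ℝ q q = 1
  h12 : inner ℝ e₁ e₂ = 0
  h13 : inner ℝ e₁ q = 0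
  h23 : inner ℝ e₂ q = 0
  hdet : det3 e₁ e₂ q = 1

namespace PosFrame

variable (f : PosFrame)

theorem norm_q : ‖f.q‖ = 1 := by
  have := real_inner_self_eq_norm_sq f.q
  rw [f.h33] at this
  nlinarith [norm_nonneg f.q]

theorem det3_coord (a b c : E3) : det3 a b c =
    inner ℝ f.e₁ a * (inner ℝ f.e₂ b * inner ℝ f.q c - inner ℝ f.q b * inner ℝ f.e₂ c) -
    inner ℝ f.e₂ a * (inner ℝ f.e₁ b * inner ℝ f.q c - inner ℝ f.q b * inner ℝ f.e₁ c) +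
    inner ℝ f.q a * (inner ℝ f.e₁ b * inner ℝ f.e₂ c - inner ℝ f.e₂ b * inner ℝ f.e₁ c) := by
  have h := f.hdet
  simp only [det3_eq, inner3_eq] at *
  linear_combination (-(a 0 * (b 1 * c 2 - b 2 * c 1) - a 1 * (b 0 * c 2 - b 2 * c 0) +
      a 2 * (b 0 * c 1 - b 1 * c 0))) * h

theorem inner_coord (a b : E3) : inner ℝ a b = inner ℝ f.e₁ a * inner ℝ f.e₁ b +
    inner ℝ f.e₂ a * inner ℝ f.e₂ b + inner ℝ f.q a * inner ℝ f.q b := by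
  have h11 := f.h11
  have h22 := f.h22
  have h33 := f.h33
  have h12 := f.h12
  have h13 := f.h13
  have h23 := f.h23
  simp only [inner3_eq] at *
  have h : (!![f.e₁ 0, f.e₁ 1, f.e₁ 2; f.e₂ 0, f.e₂ 1, f.e₂ 2; f.q 0, f.q 1, f.q 2] :
      Matrix (Fin 3) (Fin 3) ℝ) *
      !![f.e₁ 0, f.e₂ 0, f.q 0; f.e₁ 1, f.e₂ 1, f.q 1; f.e₁ 2, f.e₂ 2, f.q 2] = 1 := by
    ext i j
    fin_cases i <;> fin_cases j <;> simp [Matrix.mul_apply, Fin.sum_univ_three] <;> linarith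
  -- Orthonormal rows make the columns orthonormal too; the column relations express the inner
  -- product in the coordinates of the frame.
  rw [mul_eq_one_comm] at h
  have e := fun i j => congrFun (congrFun h i) j
  have e00 := e 0 0
  have e01 := e 0 1
  have e02 := e 0 2
  have e11 := e 1 1
  have e12 := e 1 2
  have e22 := e 2 2
  simp [Matrix.mul_apply, Fin.sum_univ_three] at e00 e01 e02 e11 e12 e22
  linear_combination (-(a 0 * b 0)) * e00 - (a 0 * b 1 + a 1 * b 0) * e01 -
    (a 0 * b 2 + a 2 * b 0) * e02 - (a 1 * b 1) * e11 - (a 1 * b 2 + a 2 * b 1) * e12 -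
    (a 2 * b 2) * e22

theorem ext_coord {a b : E3} (h1 : inner ℝ f.e₁ a = inner ℝ f.e₁ b)
    (h2 : inner ℝ f.e₂ a = inner ℝ f.e₂ b) (h3 : inner ℝ f.q a = inner ℝ f.q b) : a = b := by
  have := f.inner_coord (a - b) (a - b)
  simp only [inner_sub_right f.e₁, inner_sub_right f.e₂, inner_sub_right f.q, h1, h2, h3] at this
  simpa [sub_eq_zero] using this

theorem norm_sq_coord (a : E3) : ‖a‖ ^ 2 = inner ℝ f.e₁ a ^ 2 + inner ℝ f.e₂ a ^ 2 +
    inner ℝ f.q a ^ 2 := by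
  rw [← real_inner_self_eq_norm_sq, f.inner_coord]; ring

/-- The frame at the antipodal pole. -/
def neg : PosFrame where
  e₁ := -f.e₁
  e₂ := f.e₂
  q := -f.q
  h11 := by simpa using f.h11
  h22 := f.h22
  h33 := by simpa using f.h33
  h12 := by simpa using f.h12
  h13 := by simpa using f.h13
  h23 := by simpa using f.h23
  hdet := by
    have := f.hdet
    simp only [det3_eq, PiLp.neg_apply] at *
    linear_combination this

theorem exists_frame {q : E3} (hq : ‖q‖ = 1) : ∃ f : PosFrame, f.q = q := by
  have hq2 : q 0 * q 0 + q 1 * q 1 + q 2 * q 2 = 1 := by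
    rw [← inner3_eq, real_inner_self_eq_norm_sq, hq]; norm_num
  obtain ⟨u, hu, huq⟩ : ∃ u : E3, ‖u‖ = 1 ∧ inner ℝ u q = 0 := by
    obtain ⟨w, hw, hwq⟩ : ∃ w : E3, w ≠ 0 ∧ inner ℝ w q = 0 := by
      by_cases h : q 0 = 0
      · refine ⟨!₂[1, 0, 0], fun h0 => ?_, by simp [inner3_eq, h]⟩
        have := congrArg (fun v : E3 => v 0) h0
        simp at this
      · refine ⟨!₂[-q 1, q 0, 0], fun h0 => ?_, by simp [inner3_eq]; ring⟩
        have := congrArg (fun v : E3 => v 1) h0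
        simp at this
        exact h this
    exact ⟨‖w‖⁻¹ • w, by rw [norm_smul, norm_inv, norm_norm, inv_mul_cancel₀ (norm_ne_zero_iff.mpr hw)],
      by rw [inner_smul_left, hwq, mul_zero]⟩
  have hu2 : u 0 * u 0 + u 1 * u 1 + u 2 * u 2 = 1 := by
    rw [← inner3_eq, real_inner_self_eq_norm_sq, hu]; norm_num
  rw [inner3_eq] at huq
  -- The second vector is the cross product q × u, which makes (u, q × u, q) positively oriented.
  refine ⟨⟨u, !₂[q 1 * u 2 - q 2 * u 1, q 2 * u 0 - q 0 * u 2, q 0 * u 1 - q 1 * u 0], q,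
    ?_, ?_, ?_, ?_, ?_, ?_, ?_⟩, rfl⟩
  · rw [inner3_eq]; exact hu2
  · rw [inner3_eq]
    simp
    linear_combination (q 0 * q 0 + q 1 * q 1 + q 2 * q 2) * hu2 + hq2 -
      (u 0 * q 0 + u 1 * q 1 + u 2 * q 2) * huq
  · rw [inner3_eq]; exact hq2
  · simp [inner3_eq]; ring
  · rw [inner3_eq]; exact huq
  · simp [inner3_eq]; ring
  · simp [det3_eq]
    linear_combination (q 0 * q 0 + q 1 * q 1 + q 2 * q 2) * hu2 + hq2 -
      (u 0 * q 0 + u 1 * q 1 + u 2 * q 2) * huq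

/-! ### A function vanishing on two rays -/

/-- The projection to the plane of the first two vectors. -/
def planar : E3 →L[ℝ] ℂ :=
  Complex.ofRealCLM.comp (innerSL ℝ f.e₁) + Complex.I • Complex.ofRealCLM.comp (innerSL ℝ f.e₂)

theorem planar_apply (v : E3) :
    f.planar v = (inner ℝ f.e₁ v : ℂ) + Complex.I * (inner ℝ f.e₂ v : ℂ) := by
  simp [planar]

@[simp] theorem planar_re (v : E3) : (f.planar v).re = inner ℝ f.e₁ v := by simp [planar_apply]

@[simp] theorem planar_im (v : E3) : (f.planar v).im = inner ℝ f.e₂ v := by simp [planar_apply]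

/-- The function `‖v‖ - ⟨q, v⟩`, which vanishes on the ray of the pole. -/
def height (v : E3) : ℝ := ‖v‖ - inner ℝ f.q v

/-- The stereographic projection from the pole, homogeneous of degree zero. -/
def stereo (v : E3) : ℂ := f.planar v / (f.height v : ℂ)

/-- A function vanishing precisely on the ray of the pole and on the ray of the vectors with
stereographic projection `z`. -/
def twoRay (z : ℂ) (v : E3) : ℂ := f.planar v - z * (f.height v : ℂ)

theorem height_continuous : Continuous f.height := by
  unfold height; fun_prop

theorem height_ne_zero {ξ : E3} (hξ : ‖ξ‖ = 1) (hne : ξ ≠ f.q) : f.height ξ ≠ 0 := by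
  intro h
  have h3 : inner ℝ f.q ξ = 1 := by unfold height at h; linarith
  apply hne
  have h4 := f.norm_sq_coord ξ
  rw [hξ, h3] at h4
  refine f.ext_coord ?_ ?_ ?_
  · rw [f.h13]; nlinarith
  · rw [f.h23]; nlinarith
  · rw [f.h33, h3]

theorem stereo_coord {ξ : E3} (hξ : ‖ξ‖ = 1) (hne : ξ ≠ f.q) :
    inner ℝ f.e₁ ξ = (f.stereo ξ).re * f.height ξ ∧ inner ℝ f.e₂ ξ = (f.stereo ξ).im * f.height ξ ∧
      f.height ξ * ((f.stereo ξ).re ^ 2 + (f.stereo ξ).im ^ 2 + 1) = 2 := by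
  have h0 := f.height_ne_zero hξ hne
  have h1 : (f.stereo ξ).re = inner ℝ f.e₁ ξ / f.height ξ := by simp [stereo]
  have h2 : (f.stereo ξ).im = inner ℝ f.e₂ ξ / f.height ξ := by simp [stereo]
  have h3 := f.norm_sq_coord ξ
  rw [hξ] at h3
  rw [h1, h2]
  refine ⟨by field_simp, by field_simp, ?_⟩
  field_simp
  have h5 : inner ℝ f.q ξ = 1 - f.height ξ := by rw [height, hξ]; ring
  rw [h5] at h3
  linear_combination -h3

/-- Write h for the height of v. Inserting planar v = z h into the formula for ‖v‖² leaves h (h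
(|z|² + 1) - 2 ‖v‖) = 0. The root h = 0 is the ray of the pole, the other root the ray of ξ. -/
theorem twoRay_eq_zero {ξ v : E3} (hξ : ‖ξ‖ = 1) (hne : ξ ≠ f.q)
    (h : f.twoRay (f.stereo ξ) v = 0) : v = ‖v‖ • f.q ∨ v = ‖v‖ • ξ := by
  obtain ⟨c1, c2, c3⟩ := f.stereo_coord hξ hne
  set p := (f.stereo ξ).re with hp
  set r := (f.stereo ξ).im with hr
  have hre := congrArg Complex.re h
  have him := congrArg Complex.im h
  simp [twoRay, ← hp, ← hr] at hre him
  have hv := f.norm_sq_coord v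
  have hv3 : inner ℝ f.q v = ‖v‖ - f.height v := by rw [height]; ring
  have hξ3 : inner ℝ f.q ξ = 1 - f.height ξ := by rw [height, hξ]; ring
  have e1 : inner ℝ f.e₁ v = p * f.height v := by linarith
  have e2 : inner ℝ f.e₂ v = r * f.height v := by linarith
  rw [e1, e2, hv3] at hv
  have hprod : f.height v * (f.height v * (p ^ 2 + r ^ 2 + 1) - 2 * ‖v‖) = 0 := by
    linear_combination -hv
  rcases mul_eq_zero.mp hprod with h0 | h0
  · left
    refine f.ext_coord ?_ ?_ ?_ <;> rw [inner_smul_right]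
    · rw [e1, h0, f.h13]; ring
    · rw [e2, h0, f.h23]; ring
    · rw [hv3, h0, f.h33]; ring
  · right
    have hN : p ^ 2 + r ^ 2 + 1 ≠ 0 := by positivity
    have hd : f.height v = ‖v‖ * f.height ξ := by
      apply mul_right_cancel₀ hN
      linear_combination h0 - ‖v‖ * c3
    refine f.ext_coord ?_ ?_ ?_ <;> rw [inner_smul_right]
    · rw [e1, c1, hd]; ring
    · rw [e2, c2, hd]; ring
    · rw [hv3, hξ3, hd]; ring

theorem height_smul {r : ℝ} (hr : 0 ≤ r) (v : E3) : f.height (r • v) = r * f.height v := by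
  rw [height, height, norm_smul, inner_smul_right, Real.norm_of_nonneg hr]; ring

theorem twoRay_smul {r : ℝ} (hr : 0 ≤ r) (z : ℂ) (v : E3) :
    f.twoRay z (r • v) = r * f.twoRay z v := by
  rw [twoRay, twoRay, height_smul f hr, map_smul, Complex.real_smul]; push_cast; ring

theorem twoRay_stereo {ξ : E3} (hξ : ‖ξ‖ = 1) (hne : ξ ≠ f.q) : f.twoRay (f.stereo ξ) ξ = 0 := by
  have h0 := f.height_ne_zero hξ hne
  rw [twoRay, stereo, div_mul_cancel₀ _ (by exact_mod_cast h0), sub_self]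

theorem twoRay_q (z : ℂ) : f.twoRay z f.q = 0 := by
  simp [twoRay, planar_apply, height, f.h13, f.h23, f.norm_q]

/-- The antipodal frame reverses two axes, so that passing to -v becomes complex conjugation. This
transfers results on Γ to -Γ. -/
theorem twoRay_neg (z : ℂ) (v : E3) :
    f.neg.twoRay ((starRingEnd ℂ) z) v = (starRingEnd ℂ) (f.twoRay z (-v)) := by
  apply Complex.ext <;> simp [twoRay, planar_apply, height, neg]

theorem stereo_neg (v : E3) : f.neg.stereo (-v) = (starRingEnd ℂ) (f.stereo v) := by
  have h1 : f.neg.planar (-v) = (starRingEnd ℂ) (f.planar v) := by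
    apply Complex.ext <;> simp [planar_apply, neg]
  have h2 : f.neg.height (-v) = f.height v := by simp [height, neg]
  rw [stereo, stereo, h1, h2, map_div₀, Complex.conj_ofReal]

/-- The derivative of `height` at the positive multiples of `ξ`. -/
def heightDeriv (ξ : E3) : E3 →L[ℝ] ℝ := innerSL ℝ ξ - innerSL ℝ f.q

theorem hasFDerivAt_height {ξ : E3} (hξ : ‖ξ‖ = 1) {r : ℝ} (hr : 0 < r) :
    HasFDerivAt f.height (f.heightDeriv ξ) (r • ξ) := by
  have hn : ‖r • ξ‖ = r := by rw [norm_smul, hξ, Real.norm_of_nonneg hr.le, mul_one]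
  have h1 : HasFDerivAt (fun v : E3 => ‖v‖ ^ 2) (2 • innerSL ℝ (r • ξ)) (r • ξ) :=
    (hasStrictFDerivAt_norm_sq (r • ξ)).hasFDerivAt
  have h2 := h1.sqrt (by rw [hn]; positivity)
  simp only [Real.sqrt_sq (norm_nonneg _)] at h2
  have h3 := h2.sub (innerSL ℝ f.q).hasFDerivAt
  refine h3.congr_fderiv (ContinuousLinearMap.ext fun w => ?_)
  rw [hn]
  simp [heightDeriv]
  field_simp

/-- The derivative of `twoRay z` at the positive multiples of `ξ`. -/
def twoRayDeriv (z : ℂ) (ξ : E3) : E3 →L[ℝ] ℂ :=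
  f.planar - z • Complex.ofRealCLM.comp (f.heightDeriv ξ)

theorem twoRayDeriv_apply (z : ℂ) (ξ v : E3) :
    f.twoRayDeriv z ξ v = f.planar v - z * (f.heightDeriv ξ v : ℂ) := by simp [twoRayDeriv]

theorem hasFDerivAt_twoRay (z : ℂ) {ξ : E3} (hξ : ‖ξ‖ = 1) {r : ℝ} (hr : 0 < r) :
    HasFDerivAt (f.twoRay z) (f.twoRayDeriv z ξ) (r • ξ) := by
  have h1 := Complex.ofRealCLM.hasFDerivAt.comp (r • ξ) (f.hasFDerivAt_height hξ hr)
  exact f.planar.hasFDerivAt.sub (h1.const_mul z)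

/-- Stereographic projection from the pole reverses the orientation of the sphere, hence the minus
sign. At the pole the sign is plus (`twoRayDeriv_pole_det`), and this contrast turns the winding
number into a difference of two Tait numbers. -/
theorem twoRayDeriv_det {ξ : E3} (hξ : ‖ξ‖ = 1) (hne : ξ ≠ f.q) (a b : E3) :
    (f.twoRayDeriv (f.stereo ξ) ξ a).re * (f.twoRayDeriv (f.stereo ξ) ξ b).im -
      (f.twoRayDeriv (f.stereo ξ) ξ a).im * (f.twoRayDeriv (f.stereo ξ) ξ b).re =
      -det3 a b ξ := by
  obtain ⟨c1, c2, c3⟩ := f.stereo_coord hξ hne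
  have hξ3 : inner ℝ f.q ξ = 1 - f.height ξ := by rw [height, hξ]; ring
  rw [f.det3_coord]
  simp only [twoRayDeriv_apply, heightDeriv, sub_apply, innerSL_apply_apply,
    f.inner_coord ξ, Complex.sub_re, Complex.sub_im, planar_re, planar_im, Complex.re_mul_ofReal,
    Complex.im_mul_ofReal]
  rw [hξ3]
  set p := (f.stereo ξ).re
  set r := (f.stereo ξ).im
  set h := f.height ξ
  rw [c1, c2]
  have hN : p ^ 2 + r ^ 2 + 1 ≠ 0 := by positivity
  have hh : h = 2 / (p ^ 2 + r ^ 2 + 1) := by rw [← c3]; field_simp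
  rw [hh]
  field_simp
  ring

theorem twoRayDeriv_pole_det (z : ℂ) (a b : E3) :
    (f.twoRayDeriv z f.q a).re * (f.twoRayDeriv z f.q b).im -
      (f.twoRayDeriv z f.q a).im * (f.twoRayDeriv z f.q b).re = det3 a b f.q := by
  rw [f.det3_coord, f.h13, f.h23, f.h33]
  simp [twoRayDeriv_apply, heightDeriv]

end PosFrame

/-! ### Great arcs -/

theorem zero_notMem_segment {p q : E3} (hp : ‖p‖ = 1) (hq : ‖q‖ = 1) (hpq : q ≠ -p) :
    (0 : E3) ∉ segment ℝ p q := by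
  rintro ⟨a, b, ha, hb, hab, h⟩
  have h1 : a • p = -(b • q) := eq_neg_of_add_eq_zero_left h
  have h2 := congrArg norm h1
  rw [norm_neg, norm_smul, norm_smul, hp, hq, Real.norm_of_nonneg ha, Real.norm_of_nonneg hb] at h2
  have hb2 : b = 2⁻¹ := by linarith
  have ha2 : a = 2⁻¹ := by linarith
  rw [ha2, hb2, ← smul_add, smul_eq_zero] at h
  exact hpq (eq_neg_of_add_eq_zero_right (h.resolve_left (by norm_num)))

/-- The arc is the radial projection of a chord missing the origin; corners can therefore be treated
on a straight segment, where the derivative is constant. -/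
theorem greatArc_eq_image {p q : E3} (hp : ‖p‖ = 1) (hq : ‖q‖ = 1) (hpq : q ≠ -p) :
    greatArc p q = (fun v => ‖v‖⁻¹ • v) '' segment ℝ p q := by
  ext x
  constructor
  · rintro ⟨hx, a, b, ha, hb, rfl⟩
    have hab : 0 < a + b := by
      rcases ha.eq_or_lt with rfl | ha'
      · rcases hb.eq_or_lt with rfl | hb'
        · simp at hx
        · linarith
      · linarith
    refine ⟨(a + b)⁻¹ • (a • p + b • q), ⟨a / (a + b), b / (a + b), by positivity, by positivity,
      by field_simp, ?_⟩, ?_⟩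
    · rw [smul_add, smul_smul, smul_smul, div_eq_inv_mul, div_eq_inv_mul]
    · simp only [norm_smul, hx, norm_inv, Real.norm_of_nonneg hab.le, mul_one, inv_inv, smul_smul]
      rw [mul_inv_cancel₀ hab.ne', one_smul]
  · rintro ⟨v, hv, rfl⟩
    have hv0 : v ≠ 0 := fun h => zero_notMem_segment hp hq hpq (h ▸ hv)
    obtain ⟨a, b, ha, hb, hab, rfl⟩ := hv
    refine ⟨?_, ‖a • p + b • q‖⁻¹ * a, ‖a • p + b • q‖⁻¹ * b, by positivity, by positivity, ?_⟩
    · simp only [norm_smul, norm_inv, norm_norm]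
      exact inv_mul_cancel₀ (norm_ne_zero_iff.mpr hv0)
    · simp only [smul_add, smul_smul]

theorem left_mem_greatArc {p : E3} (hp : ‖p‖ = 1) (q : E3) : p ∈ greatArc p q :=
  ⟨hp, 1, 0, zero_le_one, le_rfl, by simp⟩

theorem right_mem_greatArc (p : E3) {q : E3} (hq : ‖q‖ = 1) : q ∈ greatArc p q :=
  ⟨hq, 0, 1, le_rfl, zero_le_one, by simp⟩

theorem greatArc_self {p : E3} (hp : ‖p‖ = 1) : greatArc p p = {p} := by
  rw [greatArc_eq_image hp hp (fun h => by
    have h2 : (2 : ℝ) • p = 0 := by rw [two_smul]; nth_rewrite 1 [h]; exact neg_add_cancel p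
    have h3 : p = 0 := by simpa using h2
    rw [h3] at hp; simp at hp), segment_same]
  simp [hp]

theorem isCompact_greatArc {p q : E3} (hp : ‖p‖ = 1) (hq : ‖q‖ = 1) (hpq : q ≠ -p) :
    IsCompact (greatArc p q) := by
  rw [greatArc_eq_image hp hq hpq]
  refine IsCompact.image_of_continuousOn ?_ fun v hv => ?_
  · rw [segment_eq_image]
    exact isCompact_Icc.image (by fun_prop)
  · have hv0 : v ≠ 0 := fun h => zero_notMem_segment hp hq hpq (h ▸ hv)
    exact (continuousAt_id.norm.inv₀ (norm_ne_zero_iff.mpr hv0)).smul continuousAt_id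
      |>.continuousWithinAt

theorem inv_smul_mem_thickening_segment {l r x : E3} {a b η : ℝ} (ha : 0 ≤ a) (hb : 0 ≤ b)
    (hab : 0 < a + b) (h : ‖x - (a • l + b • r)‖ < η * (a + b)) :
    (a + b)⁻¹ • x ∈ Metric.thickening η (segment ℝ l r) := by
  rw [Metric.mem_thickening_iff]
  refine ⟨(a + b)⁻¹ • (a • l + b • r), ⟨a / (a + b), b / (a + b), by positivity, by positivity,
    by field_simp, ?_⟩, ?_⟩
  · rw [smul_add, smul_smul, smul_smul, div_eq_inv_mul, div_eq_inv_mul]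
  · rw [dist_eq_norm, ← smul_sub, norm_smul, Real.norm_of_nonneg (by positivity), inv_mul_lt_iff₀ hab]
    linarith

namespace SimpleClosedCurve

variable (K : SimpleClosedCurve)

/-! ### Periodicity -/

/-- The parameters of the corners, for the curve as a periodic map. -/
def IsCorner (t : ℝ) : Prop := Int.fract t ∈ K.corners

theorem isCorner_iff {t : ℝ} (ht : t ∈ Ico (0 : ℝ) 1) : K.IsCorner t ↔ t ∈ K.corners := by
  rw [IsCorner, Int.fract_eq_self.mpr ht]

theorem finite_isCorner (a b : ℝ) : {t ∈ Icc a b | K.IsCorner t}.Finite := by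
  have h : {t ∈ Icc a b | K.IsCorner t} ⊆
      (fun p : ℝ × ℤ => p.1 + p.2) '' ((K.corners : Set ℝ) ×ˢ Icc ⌊a⌋ ⌊b⌋) := by
    rintro t ⟨⟨h1, h2⟩, h3⟩
    exact ⟨(Int.fract t, ⌊t⌋), ⟨h3, Int.floor_le_floor h1, Int.floor_le_floor h2⟩,
      Int.fract_add_floor t⟩
  exact ((K.corners.finite_toSet.prod (finite_Icc _ _)).image _).subset h

theorem eventually_not_isCorner (t : ℝ) : ∀ᶠ s in 𝓝[≠] t, ¬ K.IsCorner s := by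
  have h1 : ({s ∈ Icc (t - 1) (t + 1) | K.IsCorner s} \ {t})ᶜ ∈ 𝓝 t :=
    ((K.finite_isCorner (t - 1) (t + 1)).subset sdiff_subset).isClosed.isOpen_compl.mem_nhds
      (by simp)
  have h2 : Icc (t - 1) (t + 1) ∈ 𝓝 t := Icc_mem_nhds (by linarith) (by linarith)
  filter_upwards [nhdsWithin_le_nhds h1, nhdsWithin_le_nhds h2, self_mem_nhdsWithin] with s h3 h4 h5 h6
  exact h3 ⟨⟨h4, h6⟩, h5⟩

theorem eventually_not_isCorner_nhds {t : ℝ} (ht : ¬ K.IsCorner t) :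
    ∀ᶠ s in 𝓝 t, ¬ K.IsCorner s := by
  have := K.eventually_not_isCorner t
  rw [eventually_nhdsWithin_iff] at this
  filter_upwards [this] with s hs
  by_cases h : s = t
  · rwa [h]
  · exact hs h

theorem toFun_sub_int (t : ℝ) (n : ℤ) : K.toFun (t - n) = K.toFun t := by
  simpa using K.periodic.sub_int_mul_eq n (x := t)

theorem toFun_fract (t : ℝ) : K.toFun (Int.fract t) = K.toFun t := K.toFun_sub_int t ⌊t⌋

theorem deriv_sub_int (t : ℝ) (n : ℤ) : deriv K.toFun (t - n) = deriv K.toFun t := by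
  rw [← deriv_comp_sub_const]
  congr 1
  funext x
  exact K.toFun_sub_int x n

theorem deriv_fract (t : ℝ) : deriv K.toFun (Int.fract t) = deriv K.toFun t :=
  K.deriv_sub_int t ⌊t⌋

theorem unitTangent_sub_int (t : ℝ) (n : ℤ) : K.unitTangent (t - n) = K.unitTangent t := by
  rw [unitTangent, unitTangent, deriv_sub_int]

theorem tendsto_sub_int_left (t : ℝ) (n : ℤ) :
    Tendsto (fun s : ℝ => s - n) (𝓝[<] t) (𝓝[<] (t - n)) :=
  tendsto_nhdsWithin_of_tendsto_nhds_of_eventually_within _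
    ((continuous_id.sub continuous_const).tendsto' _ _ rfl |>.mono_left nhdsWithin_le_nhds)
    (by filter_upwards [self_mem_nhdsWithin] with s hs; simpa using hs)

theorem tendsto_sub_int_right (t : ℝ) (n : ℤ) :
    Tendsto (fun s : ℝ => s - n) (𝓝[>] t) (𝓝[>] (t - n)) :=
  tendsto_nhdsWithin_of_tendsto_nhds_of_eventually_within _
    ((continuous_id.sub continuous_const).tendsto' _ _ rfl |>.mono_left nhdsWithin_le_nhds)
    (by filter_upwards [self_mem_nhdsWithin] with s hs; simpa using hs)

theorem toFun_eq_iff {s t : ℝ} : K.toFun s = K.toFun t ↔ Int.fract s = Int.fract t := by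
  rw [← K.toFun_fract s, ← K.toFun_fract t]
  exact K.injective.eq_iff ⟨Int.fract_nonneg s, Int.fract_lt_one s⟩
    ⟨Int.fract_nonneg t, Int.fract_lt_one t⟩

theorem toFun_ne {s t : ℝ} (h1 : s < t) (h2 : t < s + 1) : K.toFun t - K.toFun s ≠ 0 := by
  intro h
  obtain ⟨n, hn⟩ := Int.fract_eq_fract.mp (K.toFun_eq_iff.mp (sub_eq_zero.mp h))
  have h3 : (0 : ℝ) < n := by linarith
  have h4 : (n : ℝ) < 1 := by linarith
  have h5 : 0 < n := by exact_mod_cast h3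
  have h6 : n < 1 := by exact_mod_cast h4
  omega

variable {K} (hK : K.IsPiecewiseC2Knot)

include hK

theorem contDiffAt {t : ℝ} (ht : ¬ K.IsCorner t) : ContDiffAt ℝ 2 K.toFun t := by
  have h := hK.1 (Int.fract t) ⟨Int.fract_nonneg t, Int.fract_lt_one t⟩ ht
  have e : K.toFun = K.toFun ∘ fun s : ℝ => s - ⌊t⌋ := by
    funext s; exact (K.toFun_sub_int s _).symm
  rw [e]
  exact ContDiffAt.comp t h (by fun_prop)

theorem exists_tangents (t : ℝ) : ∃ l r : E3, l ≠ 0 ∧ r ≠ 0 ∧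
    Tendsto (deriv K.toFun) (𝓝[<] t) (𝓝 l) ∧ Tendsto (deriv K.toFun) (𝓝[>] t) (𝓝 r) ∧
    ‖r‖⁻¹ • r ≠ -(‖l‖⁻¹ • l) := by
  obtain ⟨l, r, hl, hr, h1, h2, h3⟩ := hK.2 (Int.fract t) ⟨Int.fract_nonneg t, Int.fract_lt_one t⟩
  have e : deriv K.toFun = deriv K.toFun ∘ fun s : ℝ => s - ⌊t⌋ := by
    funext s; exact (K.deriv_sub_int s _).symm
  refine ⟨l, r, hl, hr, ?_, ?_, h3⟩
  · rw [e]; exact h1.comp (tendsto_sub_int_left t ⌊t⌋)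
  · rw [e]; exact h2.comp (tendsto_sub_int_right t ⌊t⌋)

theorem tangent_spec (t : ℝ) : ‖K.leftTangent t‖ = 1 ∧ ‖K.rightTangent t‖ = 1 ∧
    K.rightTangent t ≠ -K.leftTangent t ∧
    Tendsto K.unitTangent (𝓝[<] t) (𝓝 (K.leftTangent t)) ∧
    Tendsto K.unitTangent (𝓝[>] t) (𝓝 (K.rightTangent t)) ∧
    (∃ c : ℝ, 0 < c ∧ Tendsto (deriv K.toFun) (𝓝[<] t) (𝓝 (c • K.leftTangent t))) ∧
    ∃ c : ℝ, 0 < c ∧ Tendsto (deriv K.toFun) (𝓝[>] t) (𝓝 (c • K.rightTangent t)) := by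
  obtain ⟨l, r, hl, hr, h1, h2, h3⟩ := exists_tangents hK t
  have hl' := norm_ne_zero_iff.mpr hl
  have hr' := norm_ne_zero_iff.mpr hr
  have t1 : Tendsto K.unitTangent (𝓝[<] t) (𝓝 (‖l‖⁻¹ • l)) := (h1.norm.inv₀ hl').smul h1
  have t2 : Tendsto K.unitTangent (𝓝[>] t) (𝓝 (‖r‖⁻¹ • r)) := (h2.norm.inv₀ hr').smul h2
  have e1 : K.leftTangent t = ‖l‖⁻¹ • l := t1.limUnder_eq
  have e2 : K.rightTangent t = ‖r‖⁻¹ • r := t2.limUnder_eq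
  rw [e1, e2]
  refine ⟨?_, ?_, h3, t1, t2, ⟨‖l‖, by positivity, ?_⟩, ‖r‖, by positivity, ?_⟩
  · rw [norm_smul, norm_inv, norm_norm, inv_mul_cancel₀ hl']
  · rw [norm_smul, norm_inv, norm_norm, inv_mul_cancel₀ hr']
  · rwa [smul_smul, mul_inv_cancel₀ hl', one_smul]
  · rwa [smul_smul, mul_inv_cancel₀ hr', one_smul]

theorem norm_leftTangent (t : ℝ) : ‖K.leftTangent t‖ = 1 := (tangent_spec hK t).1

theorem norm_rightTangent (t : ℝ) : ‖K.rightTangent t‖ = 1 := (tangent_spec hK t).2.1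

theorem rightTangent_ne (t : ℝ) : K.rightTangent t ≠ -K.leftTangent t := (tangent_spec hK t).2.2.1

theorem tendsto_leftTangent (t : ℝ) : Tendsto K.unitTangent (𝓝[<] t) (𝓝 (K.leftTangent t)) :=
  (tangent_spec hK t).2.2.2.1

theorem tendsto_rightTangent (t : ℝ) : Tendsto K.unitTangent (𝓝[>] t) (𝓝 (K.rightTangent t)) :=
  (tangent_spec hK t).2.2.2.2.1

theorem hasDerivAt {t : ℝ} (ht : ¬ K.IsCorner t) : HasDerivAt K.toFun (deriv K.toFun t) t :=
  ((contDiffAt hK ht).differentiableAt (by norm_num)).hasDerivAt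

theorem differentiableAt_deriv {t : ℝ} (ht : ¬ K.IsCorner t) :
    DifferentiableAt ℝ (deriv K.toFun) t := by
  have h : ContDiffAt ℝ 1 (deriv K.toFun) t := by
    have h2 : ContDiffAt ℝ (1 + 1) K.toFun t := by
      have : (1 + 1 : WithTop ℕ∞) = 2 := by norm_num
      rw [this]; exact contDiffAt hK ht
    exact ((h2.fderiv_right (m := 1) le_rfl).clm_apply contDiffAt_const)
  exact h.differentiableAt (by norm_num)

theorem deriv_ne_zero {t : ℝ} (ht : ¬ K.IsCorner t) : deriv K.toFun t ≠ 0 := by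
  obtain ⟨l, r, hl, hr, h1, h2, h3⟩ := exists_tangents hK t
  have h4 := (differentiableAt_deriv hK ht).continuousAt.tendsto.mono_left
    (nhdsWithin_le_nhds (s := Iio t))
  rw [tendsto_nhds_unique h4 h1]
  exact hl

theorem norm_unitTangent {t : ℝ} (ht : ¬ K.IsCorner t) : ‖K.unitTangent t‖ = 1 := by
  rw [unitTangent, norm_smul, norm_inv, norm_norm,
    inv_mul_cancel₀ (norm_ne_zero_iff.mpr (deriv_ne_zero hK ht))]

theorem differentiableAt_unitTangent {t : ℝ} (ht : ¬ K.IsCorner t) :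
    DifferentiableAt ℝ K.unitTangent t := by
  have h := differentiableAt_deriv hK ht
  have h0 := deriv_ne_zero hK ht
  exact ((h.norm ℝ h0).inv (norm_ne_zero_iff.mpr h0)).smul h

theorem continuousAt_unitTangent {t : ℝ} (ht : ¬ K.IsCorner t) :
    ContinuousAt K.unitTangent t := (differentiableAt_unitTangent hK ht).continuousAt

theorem leftTangent_eq {t : ℝ} (ht : ¬ K.IsCorner t) : K.leftTangent t = K.unitTangent t :=
  tendsto_nhds_unique (tendsto_leftTangent hK t)
    ((continuousAt_unitTangent hK ht).tendsto.mono_left nhdsWithin_le_nhds)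

theorem rightTangent_eq {t : ℝ} (ht : ¬ K.IsCorner t) : K.rightTangent t = K.unitTangent t :=
  tendsto_nhds_unique (tendsto_rightTangent hK t)
    ((continuousAt_unitTangent hK ht).tendsto.mono_left nhdsWithin_le_nhds)

theorem leftTangent_sub_int (t : ℝ) (n : ℤ) : K.leftTangent (t - n) = K.leftTangent t := by
  have h := (tendsto_leftTangent hK (t - n)).comp (tendsto_sub_int_left t n)
  have e : K.unitTangent ∘ (fun s : ℝ => s - n) = K.unitTangent := by
    funext s; exact K.unitTangent_sub_int s n
  rw [e] at h
  exact tendsto_nhds_unique h (tendsto_leftTangent hK t)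

theorem rightTangent_sub_int (t : ℝ) (n : ℤ) : K.rightTangent (t - n) = K.rightTangent t := by
  have h := (tendsto_rightTangent hK (t - n)).comp (tendsto_sub_int_right t n)
  have e : K.unitTangent ∘ (fun s : ℝ => s - n) = K.unitTangent := by
    funext s; exact K.unitTangent_sub_int s n
  rw [e] at h
  exact tendsto_nhds_unique h (tendsto_rightTangent hK t)

/-! ### The pieces of the indicatrix -/

/-- Off the corners the one-sided tangents agree and the arc shrinks to a point, so one formula
describes all pieces, and it makes sense for every real parameter. -/
theorem tangentPiece_fract (t : ℝ) :
    K.tangentPiece (Int.fract t) = greatArc (K.leftTangent t) (K.rightTangent t) := by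
  by_cases h : K.IsCorner t
  · have h' : Int.fract t ∈ K.corners := h
    rw [tangentPiece, if_pos h', Int.fract, leftTangent_sub_int hK, rightTangent_sub_int hK]
  · have h' : Int.fract t ∉ K.corners := h
    rw [tangentPiece, if_neg h', leftTangent_eq hK h, rightTangent_eq hK h,
      greatArc_self (norm_unitTangent hK h), Int.fract, unitTangent_sub_int]

theorem mem_tangentIndicatrix {x : E3} : x ∈ K.tangentIndicatrix ↔
    ∃ t, x ∈ greatArc (K.leftTangent t) (K.rightTangent t) := by
  simp only [tangentIndicatrix, mem_iUnion, exists_prop]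
  constructor
  · rintro ⟨t, ht, hx⟩
    refine ⟨t, ?_⟩
    rwa [← tangentPiece_fract hK, Int.fract_eq_self.mpr ht]
  · rintro ⟨t, hx⟩
    exact ⟨Int.fract t, ⟨Int.fract_nonneg t, Int.fract_lt_one t⟩, by rwa [tangentPiece_fract hK]⟩

theorem unitTangent_mem_indicatrix {t : ℝ} (ht : ¬ K.IsCorner t) :
    K.unitTangent t ∈ K.tangentIndicatrix := by
  rw [mem_tangentIndicatrix hK]
  refine ⟨t, ?_⟩
  rw [← leftTangent_eq hK ht]
  exact left_mem_greatArc (norm_leftTangent hK t) _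

theorem exists_unitTangent_mem (t₀ : ℝ) {V : Set E3} (hV : IsOpen V)
    (hl : K.leftTangent t₀ ∈ V) (hr : K.rightTangent t₀ ∈ V) :
    ∃ δ > 0, ∀ s ∈ Ioo (t₀ - δ) (t₀ + δ), ¬ K.IsCorner s → K.unitTangent s ∈ V := by
  have h1 := (tendsto_leftTangent hK t₀).eventually (hV.mem_nhds hl)
  have h2 := (tendsto_rightTangent hK t₀).eventually (hV.mem_nhds hr)
  have h3 : ∀ᶠ s in 𝓝[≠] t₀, K.unitTangent s ∈ V := by
    rw [← Iio_union_Ioi, nhdsWithin_union]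
    exact eventually_sup.mpr ⟨h1, h2⟩
  rw [eventually_nhdsWithin_iff, Metric.eventually_nhds_iff] at h3
  obtain ⟨δ, hδ, h⟩ := h3
  refine ⟨δ, hδ, fun s hs hc => ?_⟩
  by_cases hst : s = t₀
  · subst hst
    rwa [← leftTangent_eq hK hc]
  · exact h (by rw [Real.dist_eq, abs_lt]; constructor <;> linarith [hs.1, hs.2]) hst

/-- Over parameters near t₀, other than t₀ itself, the pieces are single unit tangents close to an
end point of the compact arc over t₀. So a point off this arc has a neighbourhood that misses all
nearby pieces, and one period is compact. -/
theorem isClosed_tangentIndicatrix : IsClosed K.tangentIndicatrix := by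
  rw [← isOpen_compl_iff, isOpen_iff_mem_nhds]
  intro x hx
  have key : ∃ W ∈ 𝓝 x, ∀ t ∈ Icc (0 : ℝ) 1,
      Disjoint (greatArc (K.leftTangent t) (K.rightTangent t)) W := by
    refine isCompact_Icc.induction_on (p := fun s => ∃ W ∈ 𝓝 x, ∀ t ∈ s,
      Disjoint (greatArc (K.leftTangent t) (K.rightTangent t)) W) ⟨univ, univ_mem, by simp⟩ ?_ ?_ ?_
    · rintro s s' hss ⟨W, hW, h⟩
      exact ⟨W, hW, fun t ht => h t (hss ht)⟩
    · rintro s s' ⟨W, hW, h⟩ ⟨W', hW', h'⟩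
      refine ⟨W ∩ W', inter_mem hW hW', fun t ht => ?_⟩
      rcases ht with ht | ht
      · exact (h t ht).mono_right inter_subset_left
      · exact (h' t ht).mono_right inter_subset_right
    · intro t₀ _
      have hl := norm_leftTangent hK t₀
      have hr := norm_rightTangent hK t₀
      have hx' : x ∉ greatArc (K.leftTangent t₀) (K.rightTangent t₀) := fun h =>
        hx ((mem_tangentIndicatrix hK).mpr ⟨t₀, h⟩)
      obtain ⟨V, W, hV, hW, hVs, hWx, hdis⟩ := SeparatedNhds.of_isCompact_isCompact
        (isCompact_greatArc hl hr (rightTangent_ne hK t₀)) isCompact_singleton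
        (disjoint_singleton_right.mpr hx')
      obtain ⟨δ, hδ, h⟩ := exists_unitTangent_mem hK t₀ hV (hVs (left_mem_greatArc hl _))
        (hVs (right_mem_greatArc _ hr))
      have h2 := K.eventually_not_isCorner t₀
      rw [eventually_nhdsWithin_iff] at h2
      refine ⟨{t | t ≠ t₀ → ¬ K.IsCorner t} ∩ Ioo (t₀ - δ) (t₀ + δ), mem_nhdsWithin_of_mem_nhds
        (inter_mem h2 (Ioo_mem_nhds (by linarith) (by linarith))),
        W, hW.mem_nhds (hWx rfl), fun t ht => ?_⟩
      refine hdis.mono_left ?_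
      by_cases htt : t = t₀
      · rwa [htt]
      · have hc := ht.1 htt
        rw [leftTangent_eq hK hc, rightTangent_eq hK hc, greatArc_self (norm_unitTangent hK hc),
          singleton_subset_iff]
        exact h t ht.2 hc
  obtain ⟨W, hW, h⟩ := key
  filter_upwards [hW] with y hy hyI
  rw [mem_tangentIndicatrix hK] at hyI
  obtain ⟨t, ht⟩ := hyI
  refine disjoint_left.mp (h (Int.fract t) ⟨Int.fract_nonneg t, (Int.fract_lt_one t).le⟩) ?_ hy
  rwa [Int.fract, leftTangent_sub_int hK, rightTangent_sub_int hK]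

theorem isClosed_indicatrix : IsClosed K.indicatrix := by
  have h := isClosed_tangentIndicatrix hK
  exact (h.preimage continuous_subtype_val).union (h.preimage continuous_subtype_val.neg)

/-! ### Chords between nearby points -/

theorem hasDerivWithinAt_right (t : ℝ) : ∃ c : ℝ, 0 < c ∧
    HasDerivWithinAt K.toFun (c • K.rightTangent t) (Ici t) t ∧
    Tendsto (deriv K.toFun) (𝓝[>] t) (𝓝 (c • K.rightTangent t)) := by
  obtain ⟨c, hc, h⟩ := (tangent_spec hK t).2.2.2.2.2.2
  refine ⟨c, hc, ?_, h⟩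
  have h1 : ∀ᶠ s in 𝓝[>] t, ¬ K.IsCorner s :=
    (K.eventually_not_isCorner t).filter_mono (nhdsWithin_mono t (fun s hs => ne_of_gt hs))
  exact hasDerivWithinAt_Ici_of_tendsto_deriv (s := {s | ¬ K.IsCorner s})
    (fun s hs => (hasDerivAt hK hs).differentiableAt.differentiableWithinAt)
    K.continuous.continuousWithinAt h1 h

/-- Mean value inequality for x ↦ γ(x) - x • w, where w is the limit of the velocity from the right.
At t₀ only a right derivative exists, which is all the inequality needs. -/
theorem exists_right_bound (t₀ : ℝ) : ∃ c : ℝ, 0 < c ∧ ∀ η : ℝ, 0 < η → ∃ δ > 0, ∀ s t, t₀ ≤ s → s ≤ t →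
    t < t₀ + δ → ‖K.toFun t - K.toFun s - (t - s) • (c • K.rightTangent t₀)‖ ≤ η * (t - s) := by
  obtain ⟨c, hc, h0, h⟩ := hasDerivWithinAt_right hK t₀
  refine ⟨c, hc, fun η hη => ?_⟩
  have h1 : ∀ᶠ s in 𝓝[>] t₀, ¬ K.IsCorner s :=
    (K.eventually_not_isCorner t₀).filter_mono (nhdsWithin_mono t₀ (fun s hs => ne_of_gt hs))
  have h2 := (h.eventually (Metric.closedBall_mem_nhds _ hη)).and h1
  obtain ⟨u, hu, h3⟩ := mem_nhdsGT_iff_exists_Ioo_subset.mp h2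
  refine ⟨u - t₀, sub_pos.mpr hu, fun s t hs hst ht => ?_⟩
  set w := c • K.rightTangent t₀
  have hd : ∀ x ∈ Ico s t, HasDerivWithinAt (fun x => K.toFun x - x • w)
      ((if x = t₀ then w else deriv K.toFun x) - w) (Ici x) x := by
    intro x hx
    have hid : HasDerivWithinAt (fun x : ℝ => x • w) w (Ici x) x := by
      simpa using (hasDerivAt_id x).smul_const w |>.hasDerivWithinAt
    refine HasDerivWithinAt.sub ?_ hid
    split_ifs with hxt
    · rw [hxt]; exact h0
    · have hx' : x ∈ Ioo t₀ u :=
        ⟨lt_of_le_of_ne (hs.trans hx.1) (Ne.symm hxt), by linarith [hx.2]⟩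
      exact (hasDerivAt hK (h3 hx').2).hasDerivWithinAt
  have hb := norm_image_sub_le_of_norm_deriv_right_le_segment (C := η)
    (f := fun x => K.toFun x - x • w) (a := s) (b := t)
    (by have := K.continuous; fun_prop) hd (by
      intro x hx
      split_ifs with hxt
      · simpa using hη.le
      · have hx' : x ∈ Ioo t₀ u :=
          ⟨lt_of_le_of_ne (hs.trans hx.1) (Ne.symm hxt), by linarith [hx.2]⟩
        simpa [dist_eq_norm] using (h3 hx').1) t (right_mem_Icc.mpr hst)
  have e : K.toFun t - K.toFun s - (t - s) • w =
      K.toFun t - t • w - (K.toFun s - s • w) := by rw [sub_smul]; abel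
  rw [e]
  exact hb

theorem exists_left_bound (t₀ : ℝ) : ∃ c : ℝ, 0 < c ∧ ∀ η : ℝ, 0 < η → ∃ δ > 0, ∀ s t, t ≤ t₀ → s ≤ t →
    t₀ - δ < s → ‖K.toFun t - K.toFun s - (t - s) • (c • K.leftTangent t₀)‖ ≤ η * (t - s) := by
  obtain ⟨c, hc, h⟩ := (tangent_spec hK t₀).2.2.2.2.2.1
  refine ⟨c, hc, fun η hη => ?_⟩
  have h1 : ∀ᶠ s in 𝓝[<] t₀, ¬ K.IsCorner s :=
    (K.eventually_not_isCorner t₀).filter_mono (nhdsWithin_mono t₀ (fun s hs => ne_of_lt hs))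
  have h2 := (h.eventually (Metric.closedBall_mem_nhds _ hη)).and h1
  obtain ⟨u, hu, h3⟩ := mem_nhdsLT_iff_exists_Ioo_subset.mp h2
  refine ⟨t₀ - u, sub_pos.mpr hu, fun s t ht hst hs => ?_⟩
  set w := c • K.leftTangent t₀
  have hmem : ∀ x ∈ Ico s t, x ∈ Ioo u t₀ := fun x hx =>
    ⟨by linarith [hx.1], by linarith [hx.2]⟩
  have hb := norm_image_sub_le_of_norm_deriv_right_le_segment (C := η)
    (f := fun x => K.toFun x - x • w) (f' := fun x => deriv K.toFun x - w) (a := s) (b := t)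
    (by have := K.continuous; fun_prop) (fun x hx => by
      have hid : HasDerivWithinAt (fun x : ℝ => x • w) w (Ici x) x := by
        simpa using (hasDerivAt_id x).smul_const w |>.hasDerivWithinAt
      exact (hasDerivAt hK (h3 (hmem x hx)).2).hasDerivWithinAt.sub hid)
    (fun x hx => by simpa [dist_eq_norm] using (h3 (hmem x hx)).1) t (right_mem_Icc.mpr hst)
  have e : K.toFun t - K.toFun s - (t - s) • w =
      K.toFun t - t • w - (K.toFun s - s • w) := by rw [sub_smul]; abel
  rw [e]
  exact hb

/-- A chord straddling t₀ splits at t₀ into a left and a right part and is close to a • l + b • r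
with a, b ≥ 0, with an error small compared with a + b. Divided by a + b it is close to the segment
from l to r. This is where the corner arcs of the indicatrix come from. -/
theorem exists_chord_mem (t₀ : ℝ) {V : Set E3} (hV : IsOpen V)
    (hseg : segment ℝ (K.leftTangent t₀) (K.rightTangent t₀) ⊆ V) :
    ∃ δ > 0, ∀ s t, t₀ - δ < s → s < t → t < t₀ + δ →
      ∃ c : ℝ, 0 < c ∧ c • (K.toFun t - K.toFun s) ∈ V := by
  set l := K.leftTangent t₀
  set r := K.rightTangent t₀
  have hcomp : IsCompact (segment ℝ l r) := by
    rw [segment_eq_image]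
    exact isCompact_Icc.image (by fun_prop)
  obtain ⟨η, hη, hth⟩ := hcomp.exists_thickening_subset_open hV hseg
  obtain ⟨cr, hcr, hr⟩ := exists_right_bound hK t₀
  obtain ⟨cl, hcl, hl⟩ := exists_left_bound hK t₀
  obtain ⟨δr, hδr, hr⟩ := hr (η / 2 * cr) (by positivity)
  obtain ⟨δl, hδl, hl⟩ := hl (η / 2 * cl) (by positivity)
  refine ⟨min δr δl, lt_min hδr hδl, fun s t hs hst ht => ?_⟩
  have hs' : t₀ - δl < s := by linarith [min_le_right δr δl]
  have ht' : t < t₀ + δr := by linarith [min_le_left δr δl]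
  obtain ⟨a, b, ha, hb, hab, h⟩ : ∃ a b : ℝ, 0 ≤ a ∧ 0 ≤ b ∧ 0 < a + b ∧
      ‖K.toFun t - K.toFun s - (a • l + b • r)‖ ≤ η / 2 * (a + b) := by
    rcases le_or_gt t t₀ with h1 | h1
    · refine ⟨(t - s) * cl, 0, by nlinarith, le_rfl, by nlinarith, ?_⟩
      have := hl s t h1 hst.le hs'
      rw [smul_smul] at this
      rw [zero_smul, add_zero]
      linarith
    · rcases le_or_gt t₀ s with h2 | h2
      · refine ⟨0, (t - s) * cr, le_rfl, by nlinarith, by nlinarith, ?_⟩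
        have := hr s t h2 hst.le ht'
        rw [smul_smul] at this
        rw [zero_smul, zero_add]
        linarith
      · refine ⟨(t₀ - s) * cl, (t - t₀) * cr, by nlinarith, by nlinarith, by nlinarith, ?_⟩
        have e1 := hl s t₀ le_rfl h2.le hs'
        have e2 := hr t₀ t le_rfl h1.le ht'
        rw [smul_smul] at e1 e2
        have e3 := norm_add_le_of_le e1 e2
        have e4 : K.toFun t₀ - K.toFun s - ((t₀ - s) * cl) • l +
            (K.toFun t - K.toFun t₀ - ((t - t₀) * cr) • r) = K.toFun t - K.toFun s -
            (((t₀ - s) * cl) • l + ((t - t₀) * cr) • r) := by abel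
        rw [e4] at e3
        linarith
  refine ⟨(a + b)⁻¹, by positivity, hth (inv_smul_mem_thickening_segment ha hb hab ?_)⟩
  have : 0 < η * (a + b) := by positivity
  linarith

end SimpleClosedCurve

/-- A transitive relation that holds locally around every parameter holds globally. -/
theorem rel_of_local {P : ℝ → ℝ → Prop} {G : Set ℝ} {A B : ℝ} (hAB : A < B) (hA : A ∈ G)
    (hB : B ∈ G) (hG : ∀ x y, A ≤ x → y ≤ B → x < y → ∃ z ∈ G, x < z ∧ z < y)
    (htrans : ∀ a b c, a < b → b < c → a ∈ G → b ∈ G → c ∈ G → A ≤ a → c ≤ B →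
      P a b → P b c → P a c)
    (hloc : ∀ t ∈ Icc A B, ∃ δ > 0, ∀ a ∈ G, ∀ b ∈ G, A ≤ a → b ≤ B → t - δ < a → a ≤ t → t ≤ b →
      b < t + δ → a < b → P a b) : P A B := by
  -- The parameters of G that can be reached from A. The local hypothesis at their supremum carries
  -- the relation past it. The point A is put in by hand since P A A need not hold.
  set S : Set ℝ := {x | x ∈ G ∧ A ≤ x ∧ x ≤ B ∧ (x = A ∨ P A x)} with hS
  have hAS : A ∈ S := ⟨hA, le_rfl, hAB.le, Or.inl rfl⟩
  have hbdd : BddAbove S := ⟨B, fun x hx => hx.2.2.1⟩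
  set σ := sSup S with hσ
  have hσA : A ≤ σ := le_csSup hbdd hAS
  have hσB : σ ≤ B := csSup_le ⟨A, hAS⟩ (fun x hx => hx.2.2.1)
  obtain ⟨δ, hδ, hl⟩ := hloc σ ⟨hσA, hσB⟩
  obtain ⟨a, haS, haσ⟩ := exists_lt_of_lt_csSup ⟨A, hAS⟩ (show σ - δ < sSup S by linarith)
  have haσ' : a ≤ σ := le_csSup hbdd haS
  have hext : ∀ b ∈ G, σ ≤ b → b < σ + δ → b ≤ B → a < b → P A b := by
    intro b hb h1 h2 h3 h4
    have hab := hl a haS.1 b hb haS.2.1 h3 haσ haσ' h1 h2 h4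
    rcases haS.2.2.2 with h | h
    · rwa [h] at hab
    · by_cases hA' : A = a
      · rwa [← hA'] at hab
      · exact htrans A a b (lt_of_le_of_ne haS.2.1 hA') h4 hA haS.1 hb le_rfl h3 h hab
  rcases hσB.eq_or_lt with h | h
  · rcases haS.2.2.1.eq_or_lt with h' | h'
    · have := haS.2.2.2
      rw [h'] at this
      exact this.resolve_left hAB.ne'
    · exact hext B hB h.le (by linarith) le_rfl h'
  · obtain ⟨b, hb, h1, h2⟩ := hG σ (min B (σ + δ)) hσA (min_le_left _ _)
      (lt_min h (by linarith))
    have h3 : b ≤ B := h2.le.trans (min_le_left _ _)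
    have h4 : b < σ + δ := h2.trans_le (min_le_right _ _)
    have hbS : b ∈ S := ⟨hb, by linarith, h3, Or.inr (hext b hb h1.le h4 h3 (by linarith))⟩
    exact absurd (le_csSup hbdd hbS) (not_le.mpr h1)

theorem exists_ball_unit_notMem {S : Set E3} (hS : IsClosed S) {l : E3} (hl : ‖l‖ = 1)
    (hlS : l ∉ S) : ∃ r > 0, ∀ v ∈ Metric.ball l r, v ≠ 0 ∧ ‖v‖⁻¹ • v ∉ S := by
  have hl0 : l ≠ 0 := by rintro rfl; simp at hl
  have h1 : ContinuousAt (fun v : E3 => ‖v‖⁻¹ • v) l :=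
    (continuousAt_id.norm.inv₀ (norm_ne_zero_iff.mpr hl0)).smul continuousAt_id
  have h2 : Sᶜ ∈ 𝓝 (‖l‖⁻¹ • l) := hS.isOpen_compl.mem_nhds (by simpa [hl] using hlS)
  have h3 := (isOpen_ne.mem_nhds hl0)
  obtain ⟨r, hr, h⟩ := Metric.mem_nhds_iff.mp (inter_mem h3 (h1 h2))
  exact ⟨r, hr, fun v hv => h hv⟩

/-! ### The two-ray function for a moving direction and a curve. -/

namespace PosFrame

variable (f : PosFrame)

theorem twoRay_ne_zero {ξ v : E3} (hξ : ‖ξ‖ = 1) (hne : ξ ≠ f.q) (h1 : v ≠ ‖v‖ • f.q)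
    (h2 : v ≠ ‖v‖ • ξ) : f.twoRay (f.stereo ξ) v ≠ 0 := fun h =>
  (f.twoRay_eq_zero hξ hne h).elim h1 h2

theorem twoRay_eq_zero_of_smul {ξ : E3} (hξ : ‖ξ‖ = 1) (hne : ξ ≠ f.q) {r : ℝ} (hr : 0 ≤ r) :
    f.twoRay (f.stereo ξ) (r • ξ) = 0 := by
  rw [f.twoRay_smul hr, f.twoRay_stereo hξ hne, mul_zero]

theorem continuousOn_twoRay {X : Type*} [TopologicalSpace X] {u : X → ℂ} {v : X → E3} {s : Set X}
    (hu : ContinuousOn u s) (hv : ContinuousOn v s) :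
    ContinuousOn (fun x => f.twoRay (u x) (v x)) s := by
  have h1 : ContinuousOn (fun x => f.planar (v x)) s := f.planar.continuous.comp_continuousOn hv
  have h2 : ContinuousOn (fun x => (f.height (v x) : ℂ)) s :=
    Complex.continuous_ofReal.comp_continuousOn (f.height_continuous.comp_continuousOn hv)
  exact h1.sub (hu.mul h2)

theorem continuousOn_stereo {X : Type*} [TopologicalSpace X] {v : X → E3} {s : Set X}
    (hv : ContinuousOn v s) (h1 : ∀ x ∈ s, ‖v x‖ = 1) (hq : ∀ x ∈ s, v x ≠ f.q) :
    ContinuousOn (fun x => f.stereo (v x)) s := by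
  have e1 : ContinuousOn (fun x => f.planar (v x)) s := f.planar.continuous.comp_continuousOn hv
  have e2 : ContinuousOn (fun x => (f.height (v x) : ℂ)) s :=
    Complex.continuous_ofReal.comp_continuousOn (f.height_continuous.comp_continuousOn hv)
  exact e1.div e2 fun x hx => by exact_mod_cast f.height_ne_zero (h1 x hx) (hq x hx)

/-- The derivative of `twoRay` along a moving direction and a curve at a common zero. -/
def pairDeriv (ξ ξ' g' : E3) (r : ℝ) : ℝ × ℝ →L[ℝ] ℂ :=
  (ContinuousLinearMap.fst ℝ ℝ ℝ).smulRight (-((r : ℂ) * f.twoRayDeriv (f.stereo ξ) ξ ξ')) +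
    (ContinuousLinearMap.snd ℝ ℝ ℝ).smulRight (f.twoRayDeriv (f.stereo ξ) ξ g')

/-- The moving direction enters with a minus sign, which cancels the one of `twoRayDeriv_det`; a
zero is thus counted with the sign of the frame (path, curve). -/
theorem jac_pairDeriv {ξ : E3} (hξ : ‖ξ‖ = 1) (hne : ξ ≠ f.q) (ξ' g' : E3) (r : ℝ) :
    jac (f.pairDeriv ξ ξ' g' r) = r * det3 ξ ξ' g' := by
  have h := f.twoRayDeriv_det hξ hne ξ' g'
  have e : det3 ξ' g' ξ = det3 ξ ξ' g' := by
    simp only [det3_eq]; ring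
  rw [e] at h
  have h1 : f.pairDeriv ξ ξ' g' r (1, 0) = -((r : ℂ) * f.twoRayDeriv (f.stereo ξ) ξ ξ') := by
    simp [pairDeriv]
  have h2 : f.pairDeriv ξ ξ' g' r (0, 1) = f.twoRayDeriv (f.stereo ξ) ξ g' := by
    simp [pairDeriv]
  rw [jac, h1, h2, Complex.neg_re, Complex.neg_im, Complex.re_ofReal_mul, Complex.im_ofReal_mul]
  linear_combination (-r) * h

theorem hasDerivAt_stereo {c : ℝ → E3} {τ : ℝ} {c' : E3} (hc : HasDerivAt c c' τ)
    (hξ : ‖c τ‖ = 1) (hne : c τ ≠ f.q) : HasDerivAt (fun s => f.stereo (c s))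
      (f.twoRayDeriv (f.stereo (c τ)) (c τ) c' / (f.height (c τ) : ℂ)) τ := by
  have hh0 : (f.height (c τ) : ℂ) ≠ 0 := by exact_mod_cast f.height_ne_zero hξ hne
  have e1 : HasDerivAt (fun s => f.planar (c s)) (f.planar c') τ :=
    f.planar.hasFDerivAt.comp_hasDerivAt τ hc
  have hH : HasFDerivAt f.height (f.heightDeriv (c τ)) (c τ) := by
    simpa using f.hasFDerivAt_height hξ one_pos
  have e2 : HasDerivAt (fun s => (f.height (c s) : ℂ)) (f.heightDeriv (c τ) c' : ℂ) τ :=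
    (hH.comp_hasDerivAt τ hc).ofReal_comp
  refine (e1.div e2 hh0).congr_deriv ?_
  rw [f.twoRayDeriv_apply, stereo]
  field_simp

theorem hasFDerivAt_pair {c g : ℝ → E3} {p : ℝ × ℝ} {c' g' : E3} (hc : HasDerivAt c c' p.1)
    (hξ : ‖c p.1‖ = 1) (hne : c p.1 ≠ f.q) (hg : HasDerivAt g g' p.2) (hg0 : 0 < ‖g p.2‖)
    (hgc : g p.2 = ‖g p.2‖ • c p.1) :
    HasFDerivAt (fun p : ℝ × ℝ => f.twoRay (f.stereo (c p.1)) (g p.2))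
      (f.pairDeriv (c p.1) c' g' ‖g p.2‖) p := by
  have hh0 : (f.height (c p.1) : ℂ) ≠ 0 := by exact_mod_cast f.height_ne_zero hξ hne
  have e4 : HasDerivAt (fun x => f.planar (g x)) (f.planar g') p.2 :=
    f.planar.hasFDerivAt.comp_hasDerivAt p.2 hg
  have hH2 : HasFDerivAt f.height (f.heightDeriv (c p.1)) (g p.2) := by
    rw [hgc]
    exact f.hasFDerivAt_height hξ hg0
  have e5 : HasDerivAt (fun x => (f.height (g x) : ℂ)) (f.heightDeriv (c p.1) g' : ℂ) p.2 :=
    (hH2.comp_hasDerivAt p.2 hg).ofReal_comp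
  have k3 := (f.hasDerivAt_stereo hc hξ hne).hasFDerivAt.comp p hasFDerivAt_fst
  have k4 := e4.hasFDerivAt.comp p hasFDerivAt_snd
  have k5 := e5.hasFDerivAt.comp p hasFDerivAt_snd
  -- At a common zero g is a positive multiple of the direction c, and its height cancels the
  -- denominator in the derivative of the stereographic projection.
  have hgh : (f.height (g p.2) : ℂ) = ‖g p.2‖ * f.height (c p.1) := by
    conv_lhs => rw [hgc]
    rw [f.height_smul (norm_nonneg _)]
    push_cast; ring
  refine (k4.sub (k3.mul k5)).congr_fderiv (ContinuousLinearMap.ext fun w => ?_)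
  simp [pairDeriv, hgh]
  rw [f.twoRayDeriv_apply _ _ g']
  field_simp
  ring

/-- The zeros of `twoRay` along a moving direction `c` and a fixed curve `g`. -/
theorem bdry_twoRay {c g g' : ℝ → E3} {α β x₀ x₁ : ℝ} (hαβ : α < β) (hx : x₀ < x₁)
    (hc : ContinuousOn c (Icc α β)) (hc1 : ∀ τ ∈ Icc α β, ‖c τ‖ = 1)
    (hcq : ∀ τ ∈ Icc α β, c τ ≠ f.q) (hg : ContinuousOn g (Icc x₀ x₁))
    (hgq : ∀ x ∈ Icc x₀ x₁, g x ≠ ‖g x‖ • f.q) (Z : Finset (ℝ × ℝ))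
    (hZ : ∀ p ∈ Z, p ∈ Ioo α β ×ˢ Ioo x₀ x₁ ∧ g p.2 = ‖g p.2‖ • c p.1)
    (hZ' : ∀ p ∈ Icc α β ×ˢ Icc x₀ x₁, g p.2 = ‖g p.2‖ • c p.1 → p ∈ Z)
    (hcd : ∀ p ∈ Z, DifferentiableAt ℝ c p.1) (hgd : ∀ p ∈ Z, HasDerivAt g (g' p.2) p.2)
    (hdet : ∀ p ∈ Z, det3 (c p.1) (deriv c p.1) (g' p.2) ≠ 0) :
    bdry (fun p => f.twoRay (f.stereo (c p.1)) (g p.2)) α β x₀ x₁ = 2 * Real.pi * Complex.I *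
      ((∑ p ∈ Z, (SignType.sign (det3 (c p.1) (deriv c p.1) (g' p.2)) : ℤ) : ℤ) : ℂ) := by
  have hrect : ∀ p ∈ Z, p ∈ Icc α β ×ˢ Icc x₀ x₁ := fun p hp =>
    ⟨Ioo_subset_Icc_self (hZ p hp).1.1, Ioo_subset_Icc_self (hZ p hp).1.2⟩
  have hg0 : ∀ x ∈ Icc x₀ x₁, 0 < ‖g x‖ := by
    intro x hx
    rw [norm_pos_iff]
    intro h
    exact hgq x hx (by rw [h]; simp)
  have hcont : ContinuousOn (fun p : ℝ × ℝ => f.twoRay (f.stereo (c p.1)) (g p.2))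
      (Icc α β ×ˢ Icc x₀ x₁) := by
    have h1 : ContinuousOn (fun p : ℝ × ℝ => c p.1) (Icc α β ×ˢ Icc x₀ x₁) :=
      hc.comp continuousOn_fst (fun p hp => hp.1)
    have h2 : ContinuousOn (fun p : ℝ × ℝ => g p.2) (Icc α β ×ˢ Icc x₀ x₁) :=
      hg.comp continuousOn_snd (fun p hp => hp.2)
    have h3 : ContinuousOn (fun p : ℝ × ℝ => f.stereo (c p.1)) (Icc α β ×ˢ Icc x₀ x₁) :=
      f.continuousOn_stereo h1 (fun p hp => hc1 _ hp.1) (fun p hp => hcq _ hp.1)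
    exact f.continuousOn_twoRay h3 h2
  have hjac : ∀ p ∈ Z, jac (f.pairDeriv (c p.1) (deriv c p.1) (g' p.2) ‖g p.2‖) =
      ‖g p.2‖ * det3 (c p.1) (deriv c p.1) (g' p.2) := fun p hp =>
    f.jac_pairDeriv (hc1 p.1 (hrect p hp).1) (hcq p.1 (hrect p hp).1) _ _ _
  have hjac0 : ∀ p ∈ Z, jac (f.pairDeriv (c p.1) (deriv c p.1) (g' p.2) ‖g p.2‖) ≠ 0 := by
    intro p hp
    rw [hjac p hp]
    exact mul_ne_zero (hg0 _ (hrect p hp).2).ne' (hdet p hp)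
  have hzero : ∀ p ∈ Z, f.twoRay (f.stereo (c p.1)) (g p.2) = 0 := fun p hp =>
    (congrArg (f.twoRay (f.stereo (c p.1))) (hZ p hp).2).trans
      (f.twoRay_eq_zero_of_smul (hc1 _ (hrect p hp).1) (hcq _ (hrect p hp).1) (norm_nonneg _))
  rw [bdry_eq_sum_sign hαβ hx Z hcont (fun p hp => (hZ p hp).1)
    (fun p hp h => (f.twoRay_eq_zero (hc1 _ hp.1) (hcq _ hp.1) h).elim
      (fun h => absurd h (hgq _ hp.2)) (hZ' p hp))
    (fun p => f.pairDeriv (c p.1) (deriv c p.1) (g' p.2) ‖g p.2‖)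
    (fun p hp => f.hasFDerivAt_pair (hcd p hp).hasDerivAt (hc1 _ (hrect p hp).1)
      (hcq _ (hrect p hp).1) (hgd p hp) (hg0 _ (hrect p hp).2) (hZ p hp).2)
    hzero hjac0]
  rw [Finset.sum_congr rfl fun p hp => ?_]
  rw [hjac p hp, sign_mul, sign_pos (hg0 _ (hrect p hp).2), one_mul]

end PosFrame

namespace SimpleClosedCurve

variable {K : SimpleClosedCurve} (hK : K.IsPiecewiseC2Knot)

include hK

theorem segment_ne_ray {ξ : E3} (hξ : ξ ∉ K.tangentIndicatrix) {t : ℝ} {v : E3}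
    (hv : v ∈ segment ℝ (K.leftTangent t) (K.rightTangent t)) : v ≠ ‖v‖ • ξ := by
  intro h
  have hl := norm_leftTangent hK t
  have hr := norm_rightTangent hK t
  have hne := rightTangent_ne hK t
  have hv0 : v ≠ 0 := fun h0 => zero_notMem_segment hl hr hne (h0 ▸ hv)
  apply hξ
  rw [mem_tangentIndicatrix hK]
  refine ⟨t, ?_⟩
  rw [greatArc_eq_image hl hr hne]
  refine ⟨v, hv, ?_⟩
  simp only
  nth_rewrite 2 [h]
  rw [smul_smul, inv_mul_cancel₀ (norm_ne_zero_iff.mpr hv0), one_smul]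

/-- Near a single parameter `exists_chord_mem` applies to the open complement of the ray; a Lebesgue
number for a period makes the length of the chords uniform. -/
theorem exists_chord_ne_ray {ξ : E3} (hξ : ξ ∉ K.tangentIndicatrix) : ∃ ε > 0, ∀ s t, s < t →
    t < s + ε → K.toFun t - K.toFun s ≠ ‖K.toFun t - K.toFun s‖ • ξ := by
  have hV : IsOpen {v : E3 | v ≠ ‖v‖ • ξ} := by
    apply isOpen_ne_fun <;> fun_prop
  choose δ hδ h using fun t₀ => exists_chord_mem hK t₀ hV (fun v hv => segment_ne_ray hK hξ hv)
  obtain ⟨ε, hε, hL⟩ := lebesgue_number_lemma_of_metric (s := Icc (0 : ℝ) 1) isCompact_Icc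
    (c := fun t₀ : ℝ => Ioo (t₀ - δ t₀) (t₀ + δ t₀)) (fun _ => isOpen_Ioo)
    (fun t _ => mem_iUnion.mpr ⟨t, by linarith [hδ t], by linarith [hδ t]⟩)
  refine ⟨ε, hε, fun s t hst hts hbad => ?_⟩
  obtain ⟨t₀, ht₀⟩ := hL (Int.fract s) ⟨Int.fract_nonneg s, (Int.fract_lt_one s).le⟩
  have hs : Int.fract s = s - ⌊s⌋ := rfl
  have h1 := ht₀ (Metric.mem_ball_self hε)
  have h2 : t - ⌊s⌋ ∈ Ioo (t₀ - δ t₀) (t₀ + δ t₀) := ht₀ (by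
    rw [Metric.mem_ball, Real.dist_eq, hs, abs_lt]; constructor <;> linarith)
  rw [hs] at h1
  obtain ⟨a, ha, hm⟩ := h t₀ (s - ⌊s⌋) (t - ⌊s⌋) h1.1 (by linarith) h2.2
  rw [K.toFun_sub_int, K.toFun_sub_int] at hm
  apply hm
  rw [norm_smul, Real.norm_of_nonneg ha.le, mul_smul, ← hbad]

end SimpleClosedCurve

/-! ### Short chords, transverse curves of directions and their meetings with Γ. -/

namespace SimpleClosedCurve

variable (K : SimpleClosedCurve)

/-- The direction of the chord from the parameter `s` to the parameter `s + ε`. -/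
def unitChord (ε s : ℝ) : E3 :=
  ‖K.toFun (s + ε) - K.toFun s‖⁻¹ • (K.toFun (s + ε) - K.toFun s)

/-- The change of the logarithm of `twoRay z` along the directions of short chords. -/
def chordLog (f : PosFrame) (z : ℂ) (ε a b : ℝ) : ℂ :=
  dlog (fun s => f.twoRay z (K.unitChord ε s)) a b

/-- The meetings of a curve of directions with the curve `Γ` over the parameters in `[0, 1)`. -/
def curveMeets (c : ℝ → E3) (α β : ℝ) : Set (ℝ × ℝ) :=
  {p | p.1 ∈ Icc α β ∧ p.2 ∈ Ico (0 : ℝ) 1 ∧ c p.1 ∈ K.tangentPiece p.2}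

/-- The meetings of a curve of directions with the curve `Γ` over the parameters in `(a, b)`. -/
def realMeets (c : ℝ → E3) (α β a b : ℝ) : Set (ℝ × ℝ) :=
  {p | p.1 ∈ Icc α β ∧ p.2 ∈ Ioo a b ∧ c p.1 ∈ greatArc (K.leftTangent p.2) (K.rightTangent p.2)}

/-- The determinant of (curve, `Γ`) at a meeting. -/
def meetDet (c : ℝ → E3) (p : ℝ × ℝ) : ℝ := det3 (c p.1) (deriv c p.1) (K.tangentDir p.2)

/-- The signed number of meetings of a curve of directions with `Γ`. -/
def curveCount (c : ℝ → E3) (α β : ℝ) : ℤ :=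
  ∑ᶠ p ∈ K.curveMeets c α β, (SignType.sign (K.meetDet c p) : ℤ)

/-- The signed number of meetings over the parameters in `(a, b)`. -/
def realCount (c : ℝ → E3) (α β a b : ℝ) : ℤ :=
  ∑ᶠ p ∈ K.realMeets c α β a b, (SignType.sign (K.meetDet c (p.1, Int.fract p.2)) : ℤ)

/-- A curve of directions which is transverse to `Γ`. -/
structure TransverseCurve (c : ℝ → E3) (α β : ℝ) : Prop where
  lt : α < β
  cont : ContinuousOn c (Icc α β)
  norm_one : ∀ τ ∈ Icc α β, ‖c τ‖ = 1
  left_notMem : c α ∉ K.tangentIndicatrix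
  right_notMem : c β ∉ K.tangentIndicatrix
  finite : (K.curveMeets c α β).Finite
  transverse : ∀ p ∈ K.curveMeets c α β, DifferentiableAt ℝ c p.1 ∧ K.meetDet c p ≠ 0 ∧
    (p.2 ∈ K.corners → c p.1 ≠ K.leftTangent p.2 ∧ c p.1 ≠ K.rightTangent p.2)

variable {K}

theorem norm_unitChord {ε : ℝ} (h0 : 0 < ε) (h1 : ε < 1) (s : ℝ) : ‖K.unitChord ε s‖ = 1 := by
  have := K.toFun_ne (s := s) (t := s + ε) (by linarith) (by linarith)
  rw [unitChord, norm_smul, norm_inv, norm_norm, inv_mul_cancel₀ (norm_ne_zero_iff.mpr this)]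

theorem continuous_unitChord {ε : ℝ} (h0 : 0 < ε) (h1 : ε < 1) : Continuous (K.unitChord ε) := by
  have hc := K.continuous
  have h : Continuous fun s => K.toFun (s + ε) - K.toFun s := by fun_prop
  exact (h.norm.inv₀ fun s => norm_ne_zero_iff.mpr
    (K.toFun_ne (s := s) (t := s + ε) (by linarith) (by linarith))).smul h

variable (hK : K.IsPiecewiseC2Knot)

include hK

theorem tendsto_unitChord {b : ℝ} (hb : ¬ K.IsCorner b) :
    Tendsto (fun ε => K.unitChord ε b) (𝓝[>] 0) (𝓝 (K.unitTangent b)) := by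
  have h := (hasDerivAt hK hb).tendsto_slope_zero_right
  have h2 := (h.norm.inv₀ (norm_ne_zero_iff.mpr (deriv_ne_zero hK hb))).smul h
  refine h2.congr' ?_
  filter_upwards [self_mem_nhdsWithin] with ε hε
  have hε : (0 : ℝ) < ε := hε
  rw [norm_smul, norm_inv, Real.norm_of_nonneg hε.le, unitChord, smul_smul]
  congr 1
  field_simp

theorem exists_twoRay_unitChord_ne (f : PosFrame) (hq : f.q ∉ K.tangentIndicatrix) {ξ : E3}
    (hξ1 : ‖ξ‖ = 1) (hξq : ξ ≠ f.q) (hξ : ξ ∉ K.tangentIndicatrix) :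
    ∀ᶠ ε in 𝓝[>] (0 : ℝ), 0 < ε ∧ ε < 1 ∧ ∀ s, f.twoRay (f.stereo ξ) (K.unitChord ε s) ≠ 0 := by
  obtain ⟨ε₁, hε₁, h1⟩ := exists_chord_ne_ray hK hq
  obtain ⟨ε₂, hε₂, h2⟩ := exists_chord_ne_ray hK hξ
  have hm : Ioo (0 : ℝ) (min 1 (min ε₁ ε₂)) ∈ 𝓝[>] (0 : ℝ) :=
    Ioo_mem_nhdsGT (lt_min one_pos (lt_min hε₁ hε₂))
  filter_upwards [hm] with ε hε
  obtain ⟨h0, hlt⟩ := hε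
  rw [lt_min_iff, lt_min_iff] at hlt
  refine ⟨h0, hlt.1, fun s => ?_⟩
  have hne := K.toFun_ne (s := s) (t := s + ε) (by linarith) (by linarith)
  have hray : ∀ η : E3, K.toFun (s + ε) - K.toFun s ≠ ‖K.toFun (s + ε) - K.toFun s‖ • η →
      K.unitChord ε s ≠ ‖K.unitChord ε s‖ • η := by
    intro η h h'
    rw [norm_unitChord h0 hlt.1, one_smul, unitChord, inv_smul_eq_iff₀ (norm_ne_zero_iff.mpr hne)] at h'
    exact h h'
  exact f.twoRay_ne_zero hξ1 hξq (hray _ (h1 s _ (by linarith) (by linarith)))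
    (hray _ (h2 s _ (by linarith) (by linarith)))

/-- On the cone the logarithm is a function of the vector, so the change along the chords depends
only on the two extreme chords, and these tend to unit tangents. Uniform convergence of the chord
directions, which fails at a corner, is avoided in this way. -/
theorem tendsto_chordLog (f : PosFrame) {C : Set E3} (hsm : ∀ v ∈ C, ∀ r : ℝ, 0 < r → r • v ∈ C)
    {z : ℂ} {l : E3 → ℂ} (hl : ContinuousOn l C) (he : ∀ v ∈ C, Complex.exp (l v) = f.twoRay z v)
    {δ t₀ a b : ℝ} (hch : ∀ s t, t₀ - δ < s → s < t → t < t₀ + δ → K.toFun t - K.toFun s ∈ C)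
    (hab : a ≤ b) (ha : t₀ - δ < a) (hb : b < t₀ + δ) (hca : ¬ K.IsCorner a)
    (hcb : ¬ K.IsCorner b) (hUa : K.unitTangent a ∈ C) (hUb : K.unitTangent b ∈ C) :
    Tendsto (fun ε => K.chordLog f z ε a b) (𝓝[>] 0)
      (𝓝 (l (K.unitTangent b) - l (K.unitTangent a))) := by
  have hm : Ioo (0 : ℝ) (min 1 (t₀ + δ - b)) ∈ 𝓝[>] (0 : ℝ) :=
    Ioo_mem_nhdsGT (lt_min one_pos (by linarith))
  have hmem : ∀ ε ∈ Ioo (0 : ℝ) (min 1 (t₀ + δ - b)), ∀ s ∈ Icc a b, K.unitChord ε s ∈ C := by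
    intro ε hε s hs
    obtain ⟨h0, hlt⟩ := hε
    rw [lt_min_iff] at hlt
    have hne := K.toFun_ne (s := s) (t := s + ε) (by linarith) (by linarith)
    exact hsm _ (hch s (s + ε) (by linarith [hs.1]) (by linarith) (by linarith [hs.2])) _
      (by positivity)
  have hlim : ∀ t ∈ Icc a b, ¬ K.IsCorner t → K.unitTangent t ∈ C →
      Tendsto (fun ε => l (K.unitChord ε t)) (𝓝[>] 0) (𝓝 (l (K.unitTangent t))) := by
    intro t ht hct hUt
    refine (hl _ hUt).tendsto.comp (tendsto_nhdsWithin_iff.mpr ⟨tendsto_unitChord hK hct, ?_⟩)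
    filter_upwards [hm] with ε hε using hmem ε hε t ht
  refine ((hlim b (right_mem_Icc.mpr hab) hcb hUb).sub
    (hlim a (left_mem_Icc.mpr hab) hca hUa)).congr' ?_
  filter_upwards [hm] with ε hε
  have h1 : ε < 1 := (lt_min_iff.mp hε.2).1
  exact (dlog_eq (l := fun s => l (K.unitChord ε s)) hab
    (hl.comp (continuous_unitChord hε.1 h1).continuousOn (hmem ε hε))
    (fun s hs => he _ (hmem ε hε s hs))).symm

omit hK

/-- On the sides over α and β of the rectangle the logarithm is l₀ or l₁ composed with g.
Consequently the left side depends only on the end points of g, and any curve in the cone with these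
ends computes it. -/
theorem bdry_eq_of_logs (f : PosFrame) {C : Set E3} {z : ℝ → ℂ} {l₀ l₁ : E3 → ℂ} {α β : ℝ}
    (hl₀ : ContinuousOn l₀ C) (he₀ : ∀ v ∈ C, Complex.exp (l₀ v) = f.twoRay (z α) v)
    (hl₁ : ContinuousOn l₁ C) (he₁ : ∀ v ∈ C, Complex.exp (l₁ v) = f.twoRay (z β) v)
    {g : ℝ → E3} {x₀ x₁ : ℝ} (hx : x₀ ≤ x₁) (hg : ContinuousOn g (Icc x₀ x₁))
    (hgC : MapsTo g (Icc x₀ x₁) C) :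
    l₀ (g x₁) - l₀ (g x₀) - (l₁ (g x₁) - l₁ (g x₀)) =
      dlog (fun τ => f.twoRay (z τ) (g x₀)) α β - dlog (fun τ => f.twoRay (z τ) (g x₁)) α β -
        bdry (fun p => f.twoRay (z p.1) (g p.2)) α β x₀ x₁ := by
  rw [bdry, dlog_eq (g := fun y => f.twoRay (z (β, y).1) (g (β, y).2)) (l := fun x => l₁ (g x)) hx
    (hl₁.comp hg hgC) (fun x hxx => he₁ _ (hgC hxx)),
    dlog_eq (g := fun y => f.twoRay (z (α, y).1) (g (α, y).2)) (l := fun x => l₀ (g x)) hx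
    (hl₀.comp hg hgC) (fun x hxx => he₀ _ (hgC hxx))]
  ring

theorem mem_greatArc_fract {c : ℝ → E3} {α β : ℝ} (hK : K.IsPiecewiseC2Knot) {p : ℝ × ℝ} :
    (p.1 ∈ Icc α β ∧ c p.1 ∈ greatArc (K.leftTangent p.2) (K.rightTangent p.2)) ↔
      (p.1, Int.fract p.2) ∈ K.curveMeets c α β := by
  rw [← tangentPiece_fract hK]
  exact ⟨fun h => ⟨h.1, ⟨Int.fract_nonneg _, Int.fract_lt_one _⟩, h.2⟩, fun h => ⟨h.1, h.2.2⟩⟩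

variable {c : ℝ → E3} {α β : ℝ} (hc : K.TransverseCurve c α β)

include hK hc

theorem finite_realMeets (a b : ℝ) : (K.realMeets c α β a b).Finite := by
  have h : K.realMeets c α β a b ⊆ (fun p : (ℝ × ℝ) × ℤ => (p.1.1, p.1.2 + p.2)) ''
      (K.curveMeets c α β ×ˢ Icc ⌊a⌋ ⌊b⌋) := by
    rintro p ⟨h1, h2, h3⟩
    exact ⟨((p.1, Int.fract p.2), ⌊p.2⌋), ⟨(mem_greatArc_fract hK).mp ⟨h1, h3⟩,
      Int.floor_le_floor h2.1.le, Int.floor_le_floor h2.2.le⟩,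
      Prod.ext rfl (Int.fract_add_floor _)⟩
  exact ((hc.finite.prod (finite_Icc _ _)).image _).subset h

/-- The parameters over which nothing happens. -/
def _root_.SimpleClosedCurve.freeParams (K : SimpleClosedCurve) (c : ℝ → E3) (α β : ℝ) : Set ℝ :=
  {t | ¬ K.IsCorner t ∧ ∀ τ ∈ Icc α β, c τ ≠ K.unitTangent t}

omit hc in
theorem notMem_greatArc_of_free {t : ℝ} (ht : t ∈ K.freeParams c α β) {τ : ℝ} (hτ : τ ∈ Icc α β) :
    c τ ∉ greatArc (K.leftTangent t) (K.rightTangent t) := by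
  rw [leftTangent_eq hK ht.1, rightTangent_eq hK ht.1, greatArc_self (norm_unitTangent hK ht.1)]
  exact ht.2 τ hτ

theorem finite_not_free (a b : ℝ) : (Ioo a b \ K.freeParams c α β).Finite := by
  refine ((K.finite_isCorner a b).union ((finite_realMeets hK hc a b).image Prod.snd)).subset ?_
  rintro t ⟨ht, hf⟩
  by_cases hcor : K.IsCorner t
  · exact Or.inl ⟨Ioo_subset_Icc_self ht, hcor⟩
  · right
    simp only [freeParams, mem_ofPred_eq, not_and, not_forall, ne_eq, not_not] at hf
    obtain ⟨τ, hτ, h⟩ := hf hcor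
    refine ⟨(τ, t), ⟨hτ, ht, ?_⟩, rfl⟩
    rw [h, ← leftTangent_eq hK hcor]
    exact left_mem_greatArc (norm_leftTangent hK t) _

theorem exists_free {x y : ℝ} (h : x < y) : ∃ z ∈ K.freeParams c α β, x < z ∧ z < y := by
  have h1 : (Ioo x y \ (Ioo x y \ K.freeParams c α β)).Infinite :=
    (Ioo_infinite h).sdiff (finite_not_free hK hc x y)
  obtain ⟨z, hz, hz'⟩ := h1.nonempty
  exact ⟨z, by_contra fun hh => hz' ⟨hz, hh⟩, hz⟩

theorem realCount_add {a b d : ℝ} (hab : a < b) (hbd : b < d) (hb : b ∈ K.freeParams c α β) :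
    K.realCount c α β a b + K.realCount c α β b d = K.realCount c α β a d := by
  have e : K.realMeets c α β a d = K.realMeets c α β a b ∪ K.realMeets c α β b d := by
    ext p
    constructor
    · rintro ⟨h1, h2, h3⟩
      rcases lt_trichotomy p.2 b with h | h | h
      · exact Or.inl ⟨h1, ⟨h2.1, h⟩, h3⟩
      · rw [h] at h3
        exact absurd h3 (notMem_greatArc_of_free hK hb h1)
      · exact Or.inr ⟨h1, ⟨h, h2.2⟩, h3⟩
    · rintro (⟨h1, h2, h3⟩ | ⟨h1, h2, h3⟩)
      · exact ⟨h1, ⟨h2.1, h2.2.trans hbd⟩, h3⟩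
      · exact ⟨h1, ⟨hab.trans h2.1, h2.2⟩, h3⟩
  rw [realCount, realCount, realCount, e, finsum_mem_union ?_ (finite_realMeets hK hc _ _)
    (finite_realMeets hK hc _ _)]
  rw [Set.disjoint_left]
  rintro p ⟨-, h2, -⟩ ⟨-, h2', -⟩
  exact absurd h2.2 (not_lt.mpr h2'.1.le)

omit hc in
-- Reduction modulo 1 is a bijection of the meetings: the open interval (a, a + 1) omits only the
-- class of a, over which there is no meeting.
theorem realCount_period {a : ℝ} (ha : a ∈ K.freeParams c α β) :
    K.realCount c α β a (a + 1) = K.curveCount c α β := by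
  refine finsum_mem_eq_of_bijOn (fun p : ℝ × ℝ => (p.1, Int.fract p.2)) ⟨?_, ?_, ?_⟩ (fun _ _ => rfl)
  · rintro p ⟨h1, h2, h3⟩
    exact (mem_greatArc_fract hK).mp ⟨h1, h3⟩
  · rintro p ⟨-, h2, -⟩ p' ⟨-, h2', -⟩ h
    rw [Prod.mk.injEq] at h
    obtain ⟨n, hn⟩ := Int.fract_eq_fract.mp h.2
    have h3 : (n : ℝ) < 1 := by linarith [h2.1, h2.2, h2'.1, h2'.2]
    have h4 : (-1 : ℝ) < n := by linarith [h2.1, h2.2, h2'.1, h2'.2]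
    have h5 : n < 1 := by exact_mod_cast h3
    have h6 : -1 < n := by exact_mod_cast h4
    have h7 : n = 0 := by omega
    rw [h7] at hn
    exact Prod.ext h.1 (by push_cast at hn; linarith)
  · rintro ⟨τ, t⟩ ht
    have hft : Int.fract t = t := Int.fract_eq_self.mpr ht.2.1
    have hfr : Int.fract (a + Int.fract (t - a)) = t := by
      have : a + Int.fract (t - a) = t - ⌊t - a⌋ := by rw [Int.fract]; ring
      rw [this, Int.fract_sub_intCast, hft]
    have hm := (mem_greatArc_fract (c := c) (α := α) (β := β) hK (p := (τ, a + Int.fract (t - a)))).mpr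
      (by simpa only [hfr] using ht)
    have h0 : Int.fract (t - a) ≠ 0 := by
      intro h0
      rw [h0, add_zero] at hm
      exact notMem_greatArc_of_free hK ha hm.1 hm.2
    have h1 := Int.fract_nonneg (t - a)
    have h2 := Int.fract_lt_one (t - a)
    exact ⟨(τ, a + Int.fract (t - a)), ⟨hm.1, ⟨by
      have := lt_of_le_of_ne h1 (Ne.symm h0); linarith, by linarith⟩, hm.2⟩, Prod.ext rfl hfr⟩

end SimpleClosedCurve

theorem PosFrame.continuous_twoRay (f : PosFrame) (z : ℂ) : Continuous (f.twoRay z) := by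
  rw [← continuousOn_univ]
  exact f.continuousOn_twoRay continuousOn_const continuousOn_id

/-! ### Winding of the short chords about two directions. -/

namespace SimpleClosedCurve

variable {K : SimpleClosedCurve} (hK : K.IsPiecewiseC2Knot)

include hK

theorem leftTangent_fract (t : ℝ) : K.leftTangent (Int.fract t) = K.leftTangent t :=
  leftTangent_sub_int hK t ⌊t⌋

theorem rightTangent_fract (t : ℝ) : K.rightTangent (Int.fract t) = K.rightTangent t :=
  rightTangent_sub_int hK t ⌊t⌋

theorem tangentDir_fract_of_corner {t : ℝ} (ht : K.IsCorner t) :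
    K.tangentDir (Int.fract t) = K.rightTangent t - K.leftTangent t := by
  have h : Int.fract t ∈ K.corners := ht
  rw [tangentDir, if_pos h, leftTangent_fract hK, rightTangent_fract hK]

omit hK in
theorem tangentDir_fract_of_not_corner {t : ℝ} (ht : ¬ K.IsCorner t) :
    K.tangentDir (Int.fract t) = deriv K.unitTangent t := by
  have h : Int.fract t ∉ K.corners := ht
  rw [tangentDir, if_neg h, Int.fract, ← deriv_comp_sub_const]
  congr 1
  funext x
  exact K.unitTangent_sub_int x _

/-- The two-ray functions have no zero on the segment between the one-sided tangents, hence none on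
a convex neighbourhood of it, nor, by homogeneity, on the cone over this neighbourhood. Convexity of
the cone provides logarithms, and nearby chords lie in it by `exists_chord_mem`. -/
theorem exists_cone (f : PosFrame) (hq : f.q ∉ K.tangentIndicatrix) {ξ₀ ξ₁ : E3}
    (h₀ : ‖ξ₀‖ = 1) (h₁ : ‖ξ₁‖ = 1) (hq₀ : ξ₀ ≠ f.q) (hq₁ : ξ₁ ≠ f.q)
    (hI₀ : ξ₀ ∉ K.tangentIndicatrix) (hI₁ : ξ₁ ∉ K.tangentIndicatrix) (t₀ : ℝ) :
    ∃ (C : Set E3) (l₀ l₁ : E3 → ℂ) (δ : ℝ), 0 < δ ∧ Convex ℝ C ∧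
      (∀ v ∈ C, ∀ r : ℝ, 0 < r → r • v ∈ C) ∧
      ContinuousOn l₀ C ∧ (∀ v ∈ C, Complex.exp (l₀ v) = f.twoRay (f.stereo ξ₀) v) ∧
      ContinuousOn l₁ C ∧ (∀ v ∈ C, Complex.exp (l₁ v) = f.twoRay (f.stereo ξ₁) v) ∧
      segment ℝ (K.leftTangent t₀) (K.rightTangent t₀) ⊆ C ∧
      (∀ s t, t₀ - δ < s → s < t → t < t₀ + δ → K.toFun t - K.toFun s ∈ C) ∧
      ∀ s ∈ Ioo (t₀ - δ) (t₀ + δ), ¬ K.IsCorner s → K.unitTangent s ∈ C := by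
  set S := segment ℝ (K.leftTangent t₀) (K.rightTangent t₀) with hS
  set V : Set E3 := {v | f.twoRay (f.stereo ξ₀) v ≠ 0} ∩ {v | f.twoRay (f.stereo ξ₁) v ≠ 0} with hV
  have hcont := f.continuous_twoRay
  have hVo : IsOpen V := (isOpen_ne_fun (hcont _) continuous_const).inter
    (isOpen_ne_fun (hcont _) continuous_const)
  have hSV : S ⊆ V := fun v hv =>
    ⟨f.twoRay_ne_zero h₀ hq₀ (segment_ne_ray hK hq hv) (segment_ne_ray hK hI₀ hv),
      f.twoRay_ne_zero h₁ hq₁ (segment_ne_ray hK hq hv) (segment_ne_ray hK hI₁ hv)⟩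
  have hcomp : IsCompact S := by
    rw [hS, segment_eq_image]
    exact isCompact_Icc.image (by fun_prop)
  obtain ⟨η, hη, hth⟩ := hcomp.exists_thickening_subset_open hVo hSV
  have hTc : Convex ℝ (Metric.thickening η S) := (convex_segment _ _).thickening η
  have hTo : IsOpen (Metric.thickening η S) := Metric.isOpen_thickening
  have hST : S ⊆ Metric.thickening η S := Metric.self_subset_thickening hη S
  obtain ⟨δ₁, hδ₁, hch⟩ := exists_chord_mem hK t₀ hTo hST
  obtain ⟨δ₂, hδ₂, hU⟩ := exists_unitTangent_mem hK t₀ hTo (hST (left_mem_segment ℝ _ _))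
    (hST (right_mem_segment ℝ _ _))
  set C : Set E3 := (ConvexCone.hull ℝ (Metric.thickening η S) : Set E3) with hC
  have hTC : Metric.thickening η S ⊆ C := ConvexCone.subset_hull
  have hCne : ∀ v ∈ C, f.twoRay (f.stereo ξ₀) v ≠ 0 ∧ f.twoRay (f.stereo ξ₁) v ≠ 0 := by
    intro v hv
    obtain ⟨r, hr, w, hw, rfl⟩ := (ConvexCone.mem_hull_of_convex hTc).mp hv
    change f.twoRay (f.stereo ξ₀) (r • w) ≠ 0 ∧ f.twoRay (f.stereo ξ₁) (r • w) ≠ 0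
    have hr' : (r : ℂ) ≠ 0 := by exact_mod_cast hr.ne'
    rw [f.twoRay_smul hr.le, f.twoRay_smul hr.le]
    exact ⟨mul_ne_zero hr' (hth hw).1, mul_ne_zero hr' (hth hw).2⟩
  have hCc : Convex ℝ C := ConvexCone.convex _
  obtain ⟨l₀, hl₀, he₀⟩ := hCc.exists_continuousOn_log (hcont (f.stereo ξ₀)).continuousOn
    (fun v hv => (hCne v hv).1)
  obtain ⟨l₁, hl₁, he₁⟩ := hCc.exists_continuousOn_log (hcont (f.stereo ξ₁)).continuousOn
    (fun v hv => (hCne v hv).2)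
  refine ⟨C, l₀, l₁, min δ₁ δ₂, lt_min hδ₁ hδ₂, hCc, fun v hv r hr => ConvexCone.smul_mem _ hr hv,
    hl₀, he₀, hl₁, he₁, hST.trans hTC, fun s t hs hst ht => ?_, fun s hs hcs => ?_⟩
  · obtain ⟨a, ha, hm⟩ := hch s t (by linarith [min_le_left δ₁ δ₂]) hst
      (by linarith [min_le_left δ₁ δ₂])
    refine (ConvexCone.mem_hull_of_convex hTc).mpr ⟨a⁻¹, inv_pos.mpr ha, _, hm, ?_⟩
    simp only [smul_smul, inv_mul_cancel₀ ha.ne', one_smul]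
  · exact hTC (hU s ⟨by linarith [min_le_right δ₁ δ₂, hs.1], by linarith [min_le_right δ₁ δ₂, hs.2]⟩
      hcs)

variable {c : ℝ → E3} {α β : ℝ} (hc : K.TransverseCurve c α β) (f : PosFrame)
  (hq : f.q ∉ K.tangentIndicatrix) (hcq : ∀ τ ∈ Icc α β, c τ ≠ f.q)

include hc hq hcq

omit hq hcq in
theorem mem_Ioo_of_meets {τ : ℝ} (hτ : τ ∈ Icc α β) {t : ℝ}
    (h : c τ ∈ greatArc (K.leftTangent t) (K.rightTangent t)) : τ ∈ Ioo α β := by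
  have hI := (mem_tangentIndicatrix hK).mpr ⟨t, h⟩
  refine ⟨lt_of_le_of_ne hτ.1 ?_, lt_of_le_of_ne hτ.2 ?_⟩
  · rintro rfl; exact hc.left_notMem hI
  · rintro rfl; exact hc.right_notMem hI

/-- Argument principle on [α, β] × [a, b] for the moving direction and the unit tangent. Its zeros
are the meetings; none lies on the boundary, because a and b are free and the ends of the path are
off Γ. -/
theorem logs_eq_of_not_corner {C : Set E3} {l₀ l₁ : E3 → ℂ} (hl₀ : ContinuousOn l₀ C)
    (he₀ : ∀ v ∈ C, Complex.exp (l₀ v) = f.twoRay (f.stereo (c α)) v) (hl₁ : ContinuousOn l₁ C)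
    (he₁ : ∀ v ∈ C, Complex.exp (l₁ v) = f.twoRay (f.stereo (c β)) v) {a b : ℝ} (hab : a < b)
    (ha : a ∈ K.freeParams c α β) (hb : b ∈ K.freeParams c α β)
    (hcor : ∀ t ∈ Icc a b, ¬ K.IsCorner t) (hU : ∀ t ∈ Icc a b, K.unitTangent t ∈ C) :
    l₀ (K.unitTangent b) - l₀ (K.unitTangent a) - (l₁ (K.unitTangent b) - l₁ (K.unitTangent a)) =
      dlog (fun τ => f.twoRay (f.stereo (c τ)) (K.unitTangent a)) α β -
      dlog (fun τ => f.twoRay (f.stereo (c τ)) (K.unitTangent b)) α β -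
      2 * Real.pi * Complex.I * (K.realCount c α β a b : ℂ) := by
  have hUc : ContinuousOn K.unitTangent (Icc a b) := fun t ht =>
    (continuousAt_unitTangent hK (hcor t ht)).continuousWithinAt
  have hfin := finite_realMeets hK hc a b
  have hmeet : ∀ p ∈ K.realMeets c α β a b, c p.1 = K.unitTangent p.2 := by
    rintro p ⟨-, h2, h3⟩
    have hn := hcor p.2 (Ioo_subset_Icc_self h2)
    rwa [leftTangent_eq hK hn, rightTangent_eq hK hn, greatArc_self (norm_unitTangent hK hn)] at h3
  have htr : ∀ p ∈ K.realMeets c α β a b, DifferentiableAt ℝ c p.1 ∧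
      det3 (c p.1) (deriv c p.1) (deriv K.unitTangent p.2) ≠ 0 := by
    intro p hp
    have h := hc.transverse _ ((mem_greatArc_fract hK).mp ⟨hp.1, hp.2.2⟩)
    have hn := hcor p.2 (Ioo_subset_Icc_self hp.2.1)
    rw [meetDet, tangentDir_fract_of_not_corner hn] at h
    exact ⟨h.1, h.2.1⟩
  rw [bdry_eq_of_logs f (z := fun τ => f.stereo (c τ)) hl₀ he₀ hl₁ he₁ hab.le hUc hU]
  congr 1
  rw [f.bdry_twoRay (g' := deriv K.unitTangent) hc.lt hab hc.cont hc.norm_one hcq hUc ?_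
    hfin.toFinset ?_ ?_ ?_ ?_ ?_]
  · congr 2
    rw [realCount, finsum_mem_eq_finite_toFinset_sum _ hfin]
    refine Finset.sum_congr rfl fun p hp => ?_
    have hp' := hfin.mem_toFinset.mp hp
    rw [meetDet, tangentDir_fract_of_not_corner (hcor p.2 (Ioo_subset_Icc_self hp'.2.1))]
  · intro x hx h
    rw [norm_unitTangent hK (hcor x hx), one_smul] at h
    exact hq (h ▸ unitTangent_mem_indicatrix hK (hcor x hx))
  · intro p hp
    have hp' := hfin.mem_toFinset.mp hp
    refine ⟨⟨mem_Ioo_of_meets hK hc hp'.1 hp'.2.2, hp'.2.1⟩, ?_⟩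
    rw [norm_unitTangent hK (hcor p.2 (Ioo_subset_Icc_self hp'.2.1)), one_smul, hmeet p hp']
  · rintro p ⟨h1, h2⟩ h
    rw [norm_unitTangent hK (hcor p.2 h2), one_smul] at h
    rw [hfin.mem_toFinset]
    refine ⟨h1, ⟨lt_of_le_of_ne h2.1 ?_, lt_of_le_of_ne h2.2 ?_⟩, ?_⟩
    · intro h3
      exact ha.2 p.1 h1 (by rw [h3, h])
    · intro h3
      exact hb.2 p.1 h1 (by rw [← h3, h])
    · rw [← h, ← leftTangent_eq hK (hcor p.2 h2)]
      exact left_mem_greatArc (norm_leftTangent hK _) _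
  · exact fun p hp => (htr p (hfin.mem_toFinset.mp hp)).1
  · exact fun p hp => (differentiableAt_unitTangent hK
      (hcor p.2 (Ioo_subset_Icc_self (hfin.mem_toFinset.mp hp).2.1))).hasDerivAt
  · exact fun p hp => (htr p (hfin.mem_toFinset.mp hp)).2

omit hq hK in
-- Neither the path nor the pole passes through a direction of the ball, so the two-ray function has
-- no zero on the rectangle.
theorem bdry_lineMap_eq_zero {l : E3} {r : ℝ} (hr : ∀ v ∈ Metric.ball l r, v ≠ 0 ∧
    ‖v‖⁻¹ • v ∉ c '' Icc α β ∪ {f.q}) {v w : E3} (hv : v ∈ Metric.ball l r)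
    (hw : w ∈ Metric.ball l r) :
    bdry (fun p : ℝ × ℝ => f.twoRay (f.stereo (c p.1)) (AffineMap.lineMap (k := ℝ) v w p.2)) α β 0 1 = 0 := by
  have hmem : ∀ x ∈ Icc (0 : ℝ) 1, AffineMap.lineMap (k := ℝ) v w x ∈ Metric.ball l r := fun x hx =>
    (convex_ball l r).segment_subset hv hw (by
      rw [segment_eq_image_lineMap]; exact mem_image_of_mem _ hx)
  have hne : ∀ u ∈ Metric.ball l r, ∀ ξ ∈ c '' Icc α β ∪ {f.q}, u ≠ ‖u‖ • ξ := by
    intro u hu ξ hξ h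
    obtain ⟨h0, h1⟩ := hr u hu
    apply h1
    nth_rewrite 2 [h]
    rwa [smul_smul, inv_mul_cancel₀ (norm_ne_zero_iff.mpr h0), one_smul]
  have := f.bdry_twoRay (g := AffineMap.lineMap (k := ℝ) v w) (g' := fun _ => 0) hc.lt one_pos hc.cont
    hc.norm_one hcq (AffineMap.lineMap_continuous.continuousOn)
    (fun x hx => hne _ (hmem x hx) _ (Or.inr rfl)) ∅ (by simp)
    (fun p hp h => absurd h (hne _ (hmem _ hp.2) _ (Or.inl (mem_image_of_mem _ hp.1))))
    (by simp) (by simp) (by simp)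
  simpa using this

/-- The arc over the corner is replaced by the straight segment below it. The derivative of the
segment is the constant r - l, the value of `tangentDir` at the corner, and its points on the ray of
c τ are in bijection with the meetings. -/
theorem bdry_corner {a b t₀ : ℝ} (ht₀ : K.IsCorner t₀) (hat : a < t₀) (htb : t₀ < b)
    (hother : ∀ p ∈ K.realMeets c α β a b, p.2 = t₀) :
    bdry (fun p : ℝ × ℝ => f.twoRay (f.stereo (c p.1))
      (AffineMap.lineMap (K.leftTangent t₀) (K.rightTangent t₀) p.2)) α β 0 1 =
      2 * Real.pi * Complex.I * (K.realCount c α β a b : ℂ) := by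
  have hnl := norm_leftTangent hK t₀
  have hnr := norm_rightTangent hK t₀
  have hnlr := rightTangent_ne hK t₀
  set l := K.leftTangent t₀ with hl
  set r := K.rightTangent t₀ with hr
  set g : ℝ → E3 := fun x => AffineMap.lineMap (k := ℝ) l r x with hg
  have hgs : ∀ x ∈ Icc (0 : ℝ) 1, g x ∈ segment ℝ l r := fun x hx => by
    rw [segment_eq_image_lineMap]; exact mem_image_of_mem _ hx
  have hg0 : ∀ x ∈ Icc (0 : ℝ) 1, g x ≠ 0 := fun x hx h =>
    zero_notMem_segment hnl hnr hnlr (h ▸ hgs x hx)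
  set Z : Set (ℝ × ℝ) := {p | p.1 ∈ Icc α β ∧ p.2 ∈ Icc (0 : ℝ) 1 ∧ g p.2 = ‖g p.2‖ • c p.1} with hZ
  have hmaps : ∀ p ∈ Z, (p.1, t₀) ∈ K.realMeets c α β a b := by
    rintro p ⟨h1, h2, h3⟩
    refine ⟨h1, ⟨hat, htb⟩, ?_⟩
    rw [← hl, ← hr, greatArc_eq_image hnl hnr hnlr]
    refine ⟨g p.2, hgs _ h2, ?_⟩
    simp only
    nth_rewrite 2 [h3]
    rw [smul_smul, inv_mul_cancel₀ (norm_ne_zero_iff.mpr (hg0 _ h2)), one_smul]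
  have htr : ∀ p ∈ Z, DifferentiableAt ℝ c p.1 ∧ det3 (c p.1) (deriv c p.1) (r - l) ≠ 0 ∧
      c p.1 ≠ l ∧ c p.1 ≠ r := by
    intro p hp
    have hm := hmaps p hp
    have h := hc.transverse _ ((mem_greatArc_fract hK (p := (p.1, t₀))).mp ⟨hm.1, hm.2.2⟩)
    have ht₀' : Int.fract t₀ ∈ K.corners := ht₀
    rw [meetDet, tangentDir_fract_of_corner hK ht₀] at h
    refine ⟨h.1, h.2.1, ?_⟩
    have := h.2.2 ht₀'
    simp only [leftTangent_fract hK, rightTangent_fract hK] at this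
    exact this
  -- Two points of the segment on the same ray would make r - l parallel to c τ, against the
  -- nonvanishing of the determinant.
  have hinj : InjOn (fun p : ℝ × ℝ => (p.1, t₀)) Z := by
    rintro ⟨τ, x⟩ hp ⟨τ', x'⟩ hp' h
    rw [Prod.mk.injEq] at h
    obtain rfl : τ = τ' := h.1
    have h3 : g x = ‖g x‖ • c τ := hp.2.2
    have h3' : g x' = ‖g x'‖ • c τ := hp'.2.2
    have hdiff : g x - g x' = (x - x') • (r - l) := by
      simp only [hg, AffineMap.lineMap_apply, vsub_eq_sub, vadd_eq_add, sub_smul]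
      abel
    have hd2 : (x - x') • (r - l) = (‖g x‖ - ‖g x'‖) • c τ := by
      rw [← hdiff, sub_smul, ← h3, ← h3']
    have hdet := (htr _ hp).2.1
    have h5 : (x - x') * det3 (c τ) (deriv c τ) (r - l) = 0 := by
      have e0 := congrArg (fun v : E3 => v 0) hd2
      have e1 := congrArg (fun v : E3 => v 1) hd2
      have e2 := congrArg (fun v : E3 => v 2) hd2
      simp only [PiLp.smul_apply, smul_eq_mul] at e0 e1 e2
      rw [det3_eq]
      linear_combination (c τ 1 * deriv c τ 2 - c τ 2 * deriv c τ 1) * e0 -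
        (c τ 0 * deriv c τ 2 - c τ 2 * deriv c τ 0) * e1 +
        (c τ 0 * deriv c τ 1 - c τ 1 * deriv c τ 0) * e2
    have h6 : x - x' = 0 := (mul_eq_zero.mp h5).resolve_right hdet
    rw [sub_eq_zero.mp h6]
  have hbij : BijOn (fun p : ℝ × ℝ => (p.1, t₀)) Z (K.realMeets c α β a b) := by
    refine ⟨hmaps, hinj, ?_⟩
    intro p hp
    have hpt := hother p hp
    obtain ⟨h1, -, h3⟩ := hp
    rw [hpt, ← hl, ← hr, greatArc_eq_image hnl hnr hnlr, segment_eq_image_lineMap] at h3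
    obtain ⟨_, ⟨x, hx, rfl⟩, hv⟩ := h3
    refine ⟨(p.1, x), ⟨h1, hx, ?_⟩, Prod.ext rfl hpt.symm⟩
    rw [← hv, smul_smul, mul_inv_cancel₀ (norm_ne_zero_iff.mpr (hg0 x hx)), one_smul]
  have hfin : Z.Finite := Finite.of_injOn hbij.mapsTo hbij.injOn (finite_realMeets hK hc a b)
  have key := f.bdry_twoRay (g := g) (g' := fun _ => r - l) hc.lt one_pos hc.cont hc.norm_one hcq
    AffineMap.lineMap_continuous.continuousOn
    (fun x hx => segment_ne_ray hK hq (hgs x hx)) hfin.toFinset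
    (fun p hp => by
      have hp' := hfin.mem_toFinset.mp hp
      have hm := hmaps p hp'
      have hlr := (htr p hp').2.2
      refine ⟨⟨mem_Ioo_of_meets hK hc hm.1 hm.2.2, lt_of_le_of_ne hp'.2.1.1 ?_,
        lt_of_le_of_ne hp'.2.1.2 ?_⟩, hp'.2.2⟩
      · intro h0
        have := hp'.2.2
        rw [← h0] at this
        simp only [hg, AffineMap.lineMap_apply_zero, hnl, one_smul] at this
        exact hlr.1 this.symm
      · intro h0
        have := hp'.2.2
        rw [h0] at this
        simp only [hg, AffineMap.lineMap_apply_one, hnr, one_smul] at this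
        exact hlr.2 this.symm)
    (fun p hp h => hfin.mem_toFinset.mpr ⟨hp.1, hp.2, h⟩)
    (fun p hp => (htr p (hfin.mem_toFinset.mp hp)).1)
    (fun p hp => AffineMap.hasDerivAt_lineMap)
    (fun p hp => (htr p (hfin.mem_toFinset.mp hp)).2.1)
  rw [key]
  congr 2
  rw [realCount, ← finsum_mem_eq_of_bijOn (fun p : ℝ × ℝ => (p.1, t₀)) hbij (f := fun p =>
    (SignType.sign (det3 (c p.1) (deriv c p.1) (r - l)) : ℤ)) ?_,
    finsum_mem_eq_finite_toFinset_sum _ hfin]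
  intro p hp
  simp only [meetDet, tangentDir_fract_of_corner hK ht₀]
  rfl

end SimpleClosedCurve

namespace SimpleClosedCurve

variable {K : SimpleClosedCurve} (hK : K.IsPiecewiseC2Knot)

include hK

variable {c : ℝ → E3} {α β : ℝ} (hc : K.TransverseCurve c α β) (f : PosFrame)
  (hq : f.q ∉ K.tangentIndicatrix) (hcq : ∀ τ ∈ Icc α β, c τ ≠ f.q)

include hc hq hcq

/-- The logarithms see only the end tangents, so the tangent curve may be replaced by the broken
line from the tangent at a through the incoming and the outgoing tangent at t₀ to the tangent at b.
The outer segments stay in balls that path and pole avoid; the middle one carries all meetings. -/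
theorem logs_eq_of_corner {C : Set E3} {l₀ l₁ : E3 → ℂ} (hl₀ : ContinuousOn l₀ C)
    (he₀ : ∀ v ∈ C, Complex.exp (l₀ v) = f.twoRay (f.stereo (c α)) v) (hl₁ : ContinuousOn l₁ C)
    (he₁ : ∀ v ∈ C, Complex.exp (l₁ v) = f.twoRay (f.stereo (c β)) v) (hC : Convex ℝ C) {t₀ : ℝ}
    (ht₀ : K.IsCorner t₀) (hseg : segment ℝ (K.leftTangent t₀) (K.rightTangent t₀) ⊆ C) {rl rr : ℝ}
    (hrl0 : 0 < rl) (hrr0 : 0 < rr)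
    (hrl : ∀ v ∈ Metric.ball (K.leftTangent t₀) rl, v ≠ 0 ∧ ‖v‖⁻¹ • v ∉ c '' Icc α β ∪ {f.q})
    (hrr : ∀ v ∈ Metric.ball (K.rightTangent t₀) rr, v ≠ 0 ∧ ‖v‖⁻¹ • v ∉ c '' Icc α β ∪ {f.q})
    {a b : ℝ} (hat : a < t₀) (htb : t₀ < b)
    (hcor : ∀ t ∈ Icc a b, t ≠ t₀ → ¬ K.IsCorner t)
    (hUl : ∀ t ∈ Ico a t₀, K.unitTangent t ∈ Metric.ball (K.leftTangent t₀) rl)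
    (hUr : ∀ t ∈ Ioc t₀ b, K.unitTangent t ∈ Metric.ball (K.rightTangent t₀) rr)
    (hUa : K.unitTangent a ∈ C) (hUb : K.unitTangent b ∈ C) :
    l₀ (K.unitTangent b) - l₀ (K.unitTangent a) - (l₁ (K.unitTangent b) - l₁ (K.unitTangent a)) =
      dlog (fun τ => f.twoRay (f.stereo (c τ)) (K.unitTangent a)) α β -
      dlog (fun τ => f.twoRay (f.stereo (c τ)) (K.unitTangent b)) α β -
      2 * Real.pi * Complex.I * (K.realCount c α β a b : ℂ) := by
  have hother : ∀ p ∈ K.realMeets c α β a b, p.2 = t₀ := by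
    rintro p ⟨h1, h2, h3⟩
    by_contra hne
    have hn := hcor p.2 (Ioo_subset_Icc_self h2) hne
    have hn1 := norm_unitTangent hK hn
    rw [leftTangent_eq hK hn, rightTangent_eq hK hn, greatArc_self hn1, mem_singleton_iff] at h3
    have key : ‖K.unitTangent p.2‖⁻¹ • K.unitTangent p.2 ∈ c '' Icc α β ∪ {f.q} := by
      rw [hn1, inv_one, one_smul, ← h3]
      exact Or.inl (mem_image_of_mem _ h1)
    rcases lt_or_gt_of_ne hne with h | h
    · exact (hrl _ (hUl _ ⟨h2.1.le, h⟩)).2 key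
    · exact (hrr _ (hUr _ ⟨h, h2.2.le⟩)).2 key
  have hl := hseg (left_mem_segment ℝ _ _)
  have hr := hseg (right_mem_segment ℝ _ _)
  have hpath : ∀ v ∈ C, ∀ w ∈ C, MapsTo (fun x => AffineMap.lineMap (k := ℝ) v w x) (Icc (0 : ℝ) 1) C :=
    fun v hv w hw x hx => hC.segment_subset hv hw (by
      rw [segment_eq_image_lineMap]; exact mem_image_of_mem _ hx)
  have step : ∀ v ∈ C, ∀ w ∈ C, _ := fun v hv w hw =>
    bdry_eq_of_logs f (z := fun τ => f.stereo (c τ)) (α := α) (β := β) hl₀ he₀ hl₁ he₁ zero_le_one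
      (g := fun x => AffineMap.lineMap (k := ℝ) v w x) AffineMap.lineMap_continuous.continuousOn
      (hpath v hv w hw)
  have s1 := step _ hUa _ hl
  have s2 := step _ hl _ hr
  have s3 := step _ hr _ hUb
  simp only [AffineMap.lineMap_apply_zero, AffineMap.lineMap_apply_one] at s1 s2 s3
  rw [bdry_lineMap_eq_zero hc f hcq hrl (hUl a ⟨le_rfl, hat⟩) (Metric.mem_ball_self hrl0)] at s1
  rw [bdry_lineMap_eq_zero hc f hcq hrr (Metric.mem_ball_self hrr0) (hUr b ⟨htb, le_rfl⟩)] at s3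
  rw [bdry_corner hK hc f hq hcq ht₀ hat htb hother] at s2
  linear_combination s1 + s2 + s3

omit hq hcq in
theorem tangents_ne_of_corner {t : ℝ} (ht : K.IsCorner t) :
    K.leftTangent t ∉ c '' Icc α β ∧ K.rightTangent t ∉ c '' Icc α β := by
  have h : ∀ τ ∈ Icc α β, c τ ∈ greatArc (K.leftTangent t) (K.rightTangent t) →
      c τ ≠ K.leftTangent t ∧ c τ ≠ K.rightTangent t := by
    intro τ hτ hm
    have := (hc.transverse _ ((mem_greatArc_fract hK (p := (τ, t))).mp ⟨hτ, hm⟩)).2.2 ht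
    simpa only [leftTangent_fract hK, rightTangent_fract hK] using this
  constructor
  · rintro ⟨τ, hτ, he⟩
    refine (h τ hτ ?_).1 he
    rw [he]; exact left_mem_greatArc (norm_leftTangent hK t) _
  · rintro ⟨τ, hτ, he⟩
    refine (h τ hτ ?_).2 he
    rw [he]; exact right_mem_greatArc _ (norm_rightTangent hK t)

/-- The limit has the form A(a) - A(b) - 2πi n(a, b) with n additive. It therefore telescopes under
concatenation of intervals, as `rel_of_local` requires. -/
theorem chordLog_local (t₀ : ℝ) : ∃ δ > 0, ∀ a ∈ K.freeParams c α β, ∀ b ∈ K.freeParams c α β,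
    t₀ - δ < a → a ≤ t₀ → t₀ ≤ b → b < t₀ + δ → a < b →
    Tendsto (fun ε => K.chordLog f (f.stereo (c α)) ε a b - K.chordLog f (f.stereo (c β)) ε a b)
      (𝓝[>] 0) (𝓝 (dlog (fun τ => f.twoRay (f.stereo (c τ)) (K.unitTangent a)) α β -
      dlog (fun τ => f.twoRay (f.stereo (c τ)) (K.unitTangent b)) α β -
      2 * Real.pi * Complex.I * (K.realCount c α β a b : ℂ))) := by
  have hα : α ∈ Icc α β := left_mem_Icc.mpr hc.lt.le
  have hβ : β ∈ Icc α β := right_mem_Icc.mpr hc.lt.le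
  obtain ⟨C, l₀, l₁, δ, hδ, hC, hsm, hl₀, he₀, hl₁, he₁, hseg, hch, hU⟩ := exists_cone hK f hq
    (hc.norm_one α hα) (hc.norm_one β hβ) (hcq α hα) (hcq β hβ) hc.left_notMem hc.right_notMem t₀
  have hcorner := K.eventually_not_isCorner t₀
  rw [eventually_nhdsWithin_iff, Metric.eventually_nhds_iff] at hcorner
  obtain ⟨δ₂, hδ₂, hcor⟩ := hcorner
  have hcor' : ∀ t, t₀ - δ₂ < t → t < t₀ + δ₂ → t ≠ t₀ → ¬ K.IsCorner t := fun t h1 h2 h3 =>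
    hcor (by rw [Real.dist_eq, abs_lt]; constructor <;> linarith) h3
  have hlim : ∀ a b, a ∈ K.freeParams c α β → b ∈ K.freeParams c α β → t₀ - δ < a → b < t₀ + δ →
      a ≤ b → Tendsto
      (fun ε => K.chordLog f (f.stereo (c α)) ε a b - K.chordLog f (f.stereo (c β)) ε a b) (𝓝[>] 0)
      (𝓝 (l₀ (K.unitTangent b) - l₀ (K.unitTangent a) -
        (l₁ (K.unitTangent b) - l₁ (K.unitTangent a)))) := by
    intro a b ha hb h1 h2 hab
    have hUa := hU a ⟨h1, by linarith⟩ ha.1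
    have hUb := hU b ⟨by linarith, h2⟩ hb.1
    exact (tendsto_chordLog hK f hsm hl₀ he₀ hch hab h1 h2 ha.1 hb.1 hUa hUb).sub
      (tendsto_chordLog hK f hsm hl₁ he₁ hch hab h1 h2 ha.1 hb.1 hUa hUb)
  by_cases ht₀ : K.IsCorner t₀
  · have hS : IsClosed (c '' Icc α β ∪ {f.q}) :=
      (isCompact_Icc.image_of_continuousOn hc.cont).isClosed.union isClosed_singleton
    obtain ⟨hnl, hnr⟩ := tangents_ne_of_corner hK hc ht₀
    have hql : K.leftTangent t₀ ≠ f.q := fun h => hq ((mem_tangentIndicatrix hK).mpr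
      ⟨t₀, h ▸ left_mem_greatArc (norm_leftTangent hK t₀) _⟩)
    have hqr : K.rightTangent t₀ ≠ f.q := fun h => hq ((mem_tangentIndicatrix hK).mpr
      ⟨t₀, h ▸ right_mem_greatArc _ (norm_rightTangent hK t₀)⟩)
    obtain ⟨rl, hrl0, hrl⟩ := exists_ball_unit_notMem hS (norm_leftTangent hK t₀)
      (fun h => h.elim hnl hql)
    obtain ⟨rr, hrr0, hrr⟩ := exists_ball_unit_notMem hS (norm_rightTangent hK t₀)
      (fun h => h.elim hnr hqr)
    obtain ⟨u, hu, hul⟩ := mem_nhdsLT_iff_exists_Ioo_subset.mp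
      ((tendsto_leftTangent hK t₀) (Metric.ball_mem_nhds _ hrl0))
    obtain ⟨w, hw, hwr⟩ := mem_nhdsGT_iff_exists_Ioo_subset.mp
      ((tendsto_rightTangent hK t₀) (Metric.ball_mem_nhds _ hrr0))
    have hu' : u < t₀ := hu
    have hw' : t₀ < w := hw
    refine ⟨min (min δ δ₂) (min (t₀ - u) (w - t₀)), lt_min (lt_min hδ hδ₂)
      (lt_min (by linarith) (by linarith)), fun a ha b hb h1 h2 h3 h4 h5 => ?_⟩
    have hat : a < t₀ := lt_of_le_of_ne h2 (fun h => ha.1 (h ▸ ht₀))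
    have htb : t₀ < b := lt_of_le_of_ne h3 (fun h => hb.1 (h ▸ ht₀))
    have m1 : min (min δ δ₂) (min (t₀ - u) (w - t₀)) ≤ δ := (min_le_left _ _).trans (min_le_left _ _)
    have m2 : min (min δ δ₂) (min (t₀ - u) (w - t₀)) ≤ δ₂ :=
      (min_le_left _ _).trans (min_le_right _ _)
    have m3 : min (min δ δ₂) (min (t₀ - u) (w - t₀)) ≤ t₀ - u :=
      (min_le_right _ _).trans (min_le_left _ _)
    have m4 : min (min δ δ₂) (min (t₀ - u) (w - t₀)) ≤ w - t₀ :=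
      (min_le_right _ _).trans (min_le_right _ _)
    rw [← logs_eq_of_corner hK hc f hq hcq hl₀ he₀ hl₁ he₁ hC ht₀ hseg hrl0 hrr0 hrl hrr hat htb
      (fun t ht hne => hcor' t (by linarith [ht.1]) (by linarith [ht.2]) hne)
      (fun t ht => hul ⟨by linarith [ht.1], ht.2⟩) (fun t ht => hwr ⟨ht.1, by linarith [ht.2]⟩)
      (hU a ⟨by linarith, by linarith⟩ ha.1) (hU b ⟨by linarith, by linarith⟩ hb.1)]
    exact hlim a b ha hb (by linarith) (by linarith) h5.le
  · refine ⟨min δ δ₂, lt_min hδ hδ₂, fun a ha b hb h1 h2 h3 h4 h5 => ?_⟩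
    have m1 := min_le_left δ δ₂
    have m2 := min_le_right δ δ₂
    have hncor : ∀ t ∈ Icc a b, ¬ K.IsCorner t := by
      intro t ht
      by_cases h : t = t₀
      · rwa [h]
      · exact hcor' t (by linarith [ht.1]) (by linarith [ht.2]) h
    rw [← logs_eq_of_not_corner hK hc f hq hcq hl₀ he₀ hl₁ he₁ h5 ha hb hncor
      (fun t ht => hU t ⟨by linarith [ht.1], by linarith [ht.2]⟩ (hncor t ht))]
    exact hlim a b ha hb (by linarith) (by linarith) h5.le

/-- The winding numbers of the directions of short chords of the curve about two directions
differ by the signed number of meetings of `Γ` with a path joining them. -/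
theorem tendsto_chordLog_sub :
    Tendsto (fun ε => K.chordLog f (f.stereo (c α)) ε 0 1 - K.chordLog f (f.stereo (c β)) ε 0 1)
      (𝓝[>] 0) (𝓝 (-(2 * Real.pi * Complex.I * (K.curveCount c α β : ℂ)))) := by
  have hα : α ∈ Icc α β := left_mem_Icc.mpr hc.lt.le
  have hβ : β ∈ Icc α β := right_mem_Icc.mpr hc.lt.le
  have hnα := exists_twoRay_unitChord_ne hK f hq (hc.norm_one α hα) (hcq α hα) hc.left_notMem
  have hnβ := exists_twoRay_unitChord_ne hK f hq (hc.norm_one β hβ) (hcq β hβ) hc.right_notMem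
  have hcont : ∀ z ε, 0 < ε → ε < 1 → Continuous (fun s => f.twoRay z (K.unitChord ε s)) :=
    fun z ε h0 h1 => (f.continuous_twoRay z).comp (continuous_unitChord h0 h1)
  -- Telescoping starts at a free parameter a. Over [a, a + 1] the end terms cancel because the unit
  -- tangent is periodic, and `dlog_periodic` moves the base point back to 0.
  obtain ⟨a, ha, -⟩ := exists_free hK hc (zero_lt_one (α := ℝ))
  have hU1 : K.unitTangent (a + 1) = K.unitTangent a := by
    have := K.unitTangent_sub_int (a + 1) 1
    simpa using this.symm
  have ha1 : a + 1 ∈ K.freeParams c α β := by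
    refine ⟨?_, fun τ hτ => hU1 ▸ ha.2 τ hτ⟩
    have := ha.1
    rwa [IsCorner, ← Int.fract_add_one] at this
  have key := rel_of_local (G := K.freeParams c α β) (A := a) (B := a + 1)
    (P := fun a b => Tendsto
      (fun ε => K.chordLog f (f.stereo (c α)) ε a b - K.chordLog f (f.stereo (c β)) ε a b)
      (𝓝[>] 0) (𝓝 (dlog (fun τ => f.twoRay (f.stereo (c τ)) (K.unitTangent a)) α β -
      dlog (fun τ => f.twoRay (f.stereo (c τ)) (K.unitTangent b)) α β -
      2 * Real.pi * Complex.I * (K.realCount c α β a b : ℂ)))) (by linarith) ha ha1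
    (fun x y _ _ hxy => exists_free hK hc hxy)
    (by
      intro a b d hab hbd hfa hfb hfd _ _ h1 h2
      have h := h1.add h2
      rw [← realCount_add hK hc hab hbd hfb]
      have e : ∀ A B D R₁ R₂ : ℂ, ∀ k : ℂ, A - B - k * R₁ + (B - D - k * R₂) =
        A - D - k * (R₁ + R₂) := by intros; ring
      rw [e] at h
      push_cast
      refine h.congr' ?_
      filter_upwards [hnα, hnβ] with ε hε hε'
      have t1 := dlog_trans hab.le hbd.le (hcont (f.stereo (c α)) ε hε.1 hε.2.1).continuousOn
        (fun x _ => hε.2.2 x)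
      have t2 := dlog_trans hab.le hbd.le (hcont (f.stereo (c β)) ε hε.1 hε.2.1).continuousOn
        (fun x _ => hε'.2.2 x)
      rw [chordLog, chordLog, chordLog, chordLog, chordLog, chordLog, ← t1, ← t2]
      ring)
    (fun t _ => by
      obtain ⟨δ, hδ, h⟩ := chordLog_local hK hc f hq hcq t
      exact ⟨δ, hδ, fun a ha b hb _ _ h1 h2 h3 h4 h5 => h a ha b hb h1 h2 h3 h4 h5⟩)
  rw [hU1, realCount_period hK ha, sub_self, zero_sub] at key
  refine key.congr' ?_
  have hper : ∀ z ε, Function.Periodic (fun s => f.twoRay z (K.unitChord ε s)) 1 := by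
    intro z ε s
    have h1 : s + 1 + ε = s + ε + 1 := by ring
    simp only [unitChord, h1, K.periodic s, K.periodic (s + ε)]
  filter_upwards [hnα, hnβ] with ε hε hε'
  have t1 := dlog_periodic (hcont (f.stereo (c α)) ε hε.1 hε.2.1) hε.2.2 (hper _ ε) a 0
  have t2 := dlog_periodic (hcont (f.stereo (c β)) ε hε.1 hε.2.1) hε'.2.2 (hper _ ε) a 0
  rw [zero_add] at t1 t2
  rw [chordLog, chordLog, chordLog, chordLog, t1, t2]

end SimpleClosedCurve

/-! ### The boundary term: short chords against their opposites. -/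

namespace SimpleClosedCurve

variable (K : SimpleClosedCurve)

/-- The change of the logarithm of `twoRay z` along the short chords, minus the one along their
opposites. -/
def boundaryLog (f : PosFrame) (z : ℂ) (ε : ℝ) : ℂ :=
  K.chordLog f z ε 0 1 - dlog (fun s => f.twoRay z (-K.unitChord ε s)) 0 1

variable {K} (hK : K.IsPiecewiseC2Knot)

include hK

theorem dlog_neg_unitChord (f : PosFrame) (hq : -f.q ∉ K.tangentIndicatrix) {ξ : E3}
    (hξ1 : ‖ξ‖ = 1) (hξq : ξ ≠ f.q) (hξ : -ξ ∉ K.tangentIndicatrix) :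
    ∀ᶠ ε in 𝓝[>] (0 : ℝ), dlog (fun s => f.twoRay (f.stereo ξ) (-K.unitChord ε s)) 0 1 =
      (starRingEnd ℂ) (K.chordLog f.neg (f.neg.stereo (-ξ)) ε 0 1) := by
  have h1 : -ξ ≠ f.neg.q := fun h => hξq (neg_injective h)
  filter_upwards [exists_twoRay_unitChord_ne hK f.neg hq (by rwa [norm_neg]) h1 hξ] with ε hε
  have hcont : Continuous (fun s => f.neg.twoRay (f.neg.stereo (-ξ)) (K.unitChord ε s)) :=
    (f.neg.continuous_twoRay _).comp (continuous_unitChord hε.1 hε.2.1)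
  rw [chordLog, ← dlog_conj zero_le_one hcont.continuousOn (fun s _ => hε.2.2 s)]
  congr 1
  funext s
  rw [f.stereo_neg, f.twoRay_neg, Complex.conj_conj]

/-- The opposite chords are handled by the antipodal frame and the path -c, up to conjugation.
Conjugation changes the sign of 2πi, the minus sign in `boundaryLog` changes it once more, and the
two counts add. -/
theorem tendsto_boundaryLog_sub {c : ℝ → E3} {α β : ℝ} (hc : K.TransverseCurve c α β)
    (hc' : K.TransverseCurve (fun τ => -c τ) α β) (f : PosFrame) (hq : f.q ∉ K.tangentIndicatrix)
    (hq' : -f.q ∉ K.tangentIndicatrix) (hcq : ∀ τ ∈ Icc α β, c τ ≠ f.q) :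
    Tendsto (fun ε => K.boundaryLog f (f.stereo (c α)) ε - K.boundaryLog f (f.stereo (c β)) ε)
      (𝓝[>] 0) (𝓝 (-(2 * Real.pi * Complex.I *
        ((K.curveCount c α β + K.curveCount (fun τ => -c τ) α β : ℤ) : ℂ)))) := by
  have hα : α ∈ Icc α β := left_mem_Icc.mpr hc.lt.le
  have hβ : β ∈ Icc α β := right_mem_Icc.mpr hc.lt.le
  have h1 := tendsto_chordLog_sub hK hc f hq hcq
  have h2 := tendsto_chordLog_sub hK hc' f.neg hq' (fun τ hτ h => hcq τ hτ (neg_injective h))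
  have h3 := h1.sub ((Complex.continuous_conj.tendsto _).comp h2)
  have e : -(2 * Real.pi * Complex.I * (K.curveCount c α β : ℂ)) - (starRingEnd ℂ)
      (-(2 * Real.pi * Complex.I * (K.curveCount (fun τ => -c τ) α β : ℂ))) =
      -(2 * Real.pi * Complex.I *
        ((K.curveCount c α β + K.curveCount (fun τ => -c τ) α β : ℤ) : ℂ)) := by
    simp only [map_neg, map_mul, Complex.conj_I, Complex.conj_ofReal, map_ofNat, map_intCast]
    push_cast; ring
  rw [e] at h3
  refine h3.congr' ?_
  filter_upwards [dlog_neg_unitChord hK f hq' (hc.norm_one α hα) (hcq α hα) hc'.left_notMem,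
    dlog_neg_unitChord hK f hq' (hc.norm_one β hβ) (hcq β hβ) hc'.right_notMem] with ε hε hε'
  simp only [boundaryLog, Function.comp_apply, map_sub, hε, hε']
  ring

end SimpleClosedCurve

/-- A zero with invertible derivative is isolated, whereas infinitely many zeros in a compact set
would accumulate at one of them. -/
theorem finite_zeros_of_jac {F : ℝ × ℝ → ℂ} {S : Set (ℝ × ℝ)} (hS : IsCompact S)
    {L : ℝ × ℝ → (ℝ × ℝ →L[ℝ] ℂ)} {Z : Set (ℝ × ℝ)} (hZc : IsClosed Z) (hZS : Z ⊆ S)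
    (hZ : ∀ z ∈ Z, F z = 0) (hL : ∀ z ∈ Z, HasFDerivAt F (L z) z)
    (hdet : ∀ z ∈ Z, jac (L z) ≠ 0) : Z.Finite := by
  by_contra hinf
  obtain ⟨x, -, hx⟩ := Set.Infinite.exists_accPt_of_subset_isCompact hinf hS hZS
  have hxZ : x ∈ Z := hZc.closure_subset (mem_closure_iff_clusterPt.mpr hx.clusterPt)
  obtain ⟨k, hk⟩ := exists_antilipschitz_of_jac (hdet x hxZ)
  have h1 := (hL x hxZ).eventually_ne (c := 0) ⟨k, hk⟩
  rw [accPt_iff_frequently_nhdsNE] at hx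
  obtain ⟨y, hy, hy'⟩ := (hx.and_eventually h1).exists
  exact hy' (hZ y hy)

/-- Equal projections make the difference a multiple of the unit vector ξ, and the height inequality
makes the multiple positive. This translates double points into chords in the direction ξ. -/
theorem projAlong_eq_iff {ξ : S2} {x y : E3} :
    (projAlong ξ x = projAlong ξ y ∧ inner ℝ (ξ : E3) y < inner ℝ (ξ : E3) x) ↔
      x - y = ‖x - y‖ • (ξ : E3) ∧ x ≠ y := by
  have hξ : ‖(ξ : E3)‖ = 1 := norm_eq_of_mem_sphere ξ
  constructor
  · rintro ⟨h1, h2⟩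
    have h3 : x - y = (inner ℝ (ξ : E3) x - inner ℝ (ξ : E3) y) • (ξ : E3) := by
      rw [projAlong, projAlong, sub_eq_sub_iff_sub_eq_sub, ← sub_smul] at h1
      exact h1
    have h4 : ‖x - y‖ = inner ℝ (ξ : E3) x - inner ℝ (ξ : E3) y := by
      rw [h3, norm_smul, hξ, mul_one, Real.norm_of_nonneg (by linarith)]
    exact ⟨by rw [h4]; exact h3, fun h => by rw [h] at h2; exact lt_irrefl _ h2⟩
  · rintro ⟨h1, h2⟩
    have h3 : inner ℝ (ξ : E3) x - inner ℝ (ξ : E3) y = ‖x - y‖ := by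
      rw [← inner_sub_right]
      nth_rewrite 1 [h1]
      rw [inner_smul_right, real_inner_self_eq_norm_sq, hξ]; ring
    have h4 : 0 < ‖x - y‖ := norm_pos_iff.mpr (sub_ne_zero.mpr h2)
    refine ⟨?_, by linarith⟩
    rw [projAlong, projAlong, sub_eq_sub_iff_sub_eq_sub, ← sub_smul, h3]
    exact h1

/-! ### Double points as zeros of the chord map. -/

namespace SimpleClosedCurve

variable {K : SimpleClosedCurve}

theorem mem_doublePoints {ξ : S2} {p : ℝ × ℝ} : p ∈ K.doublePoints ξ ↔
    p.1 ∈ Ico (0 : ℝ) 1 ∧ p.2 ∈ Ico (0 : ℝ) 1 ∧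
      K.toFun p.1 - K.toFun p.2 = ‖K.toFun p.1 - K.toFun p.2‖ • (ξ : E3) ∧
      K.toFun p.1 ≠ K.toFun p.2 := by
  rw [doublePoints, mem_ofPred_eq, projAlong_eq_iff]

theorem mem_carrier (t : ℝ) : K.toFun t ∈ K.carrier :=
  ⟨Int.fract t, ⟨Int.fract_nonneg t, Int.fract_lt_one t⟩, K.toFun_fract t⟩

theorem mem_vertices_of_isCorner {t : ℝ} (h : K.IsCorner t) : K.toFun t ∈ K.vertices :=
  ⟨Int.fract t, h, K.toFun_fract t⟩

theorem IsGood.not_isCorner {ξ : S2} (hξ : K.IsGood ξ) {s t : ℝ}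
    (h : projAlong ξ (K.toFun s) = projAlong ξ (K.toFun t)) (hne : K.toFun s ≠ K.toFun t) :
    ¬ K.IsCorner s ∧ ¬ K.IsCorner t := by
  have hs : K.toFun s ∈ K.fibre ξ (projAlong ξ (K.toFun t)) := ⟨mem_carrier s, h⟩
  have ht : K.toFun t ∈ K.fibre ξ (projAlong ξ (K.toFun t)) := ⟨mem_carrier t, rfl⟩
  rcases hξ (projAlong ξ (K.toFun t)) with h0 | ⟨x, h1⟩ | ⟨x, y, hxy, hx, hy, h2⟩
  · rw [h0] at hs; exact hs.elim
  · rw [h1] at hs ht; exact (hne (hs.trans ht.symm)).elim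
  · rw [h2] at hs ht
    constructor <;> intro hc <;> have hv := mem_vertices_of_isCorner hc
    · rcases hs with hs | hs
      · exact hx (hs ▸ hv)
      · exact hy (hs ▸ hv)
    · rcases ht with ht | ht
      · exact hx (ht ▸ hv)
      · exact hy (ht ▸ hv)

variable (K) in
/-- The pairs (`s`, `u`) such that the chord from `s` to `s + u` has the direction `ξ`. -/
def chordZeros (ξ : E3) (a ε : ℝ) : Set (ℝ × ℝ) :=
  {p | p ∈ Icc a (a + 1) ×ˢ Icc ε (1 - ε) ∧
    K.toFun (p.1 + p.2) - K.toFun p.1 = ‖K.toFun (p.1 + p.2) - K.toFun p.1‖ • ξ}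

/-- The derivative of a chord. -/
def chordDeriv (a b : E3) : ℝ × ℝ →L[ℝ] E3 :=
  (ContinuousLinearMap.fst ℝ ℝ ℝ + ContinuousLinearMap.snd ℝ ℝ ℝ).smulRight a -
    (ContinuousLinearMap.fst ℝ ℝ ℝ).smulRight b

theorem jac_comp_chordDeriv (A : E3 →L[ℝ] ℂ) (a b : E3) : jac (A.comp (chordDeriv a b)) =
    (A a).re * (A b).im - (A a).im * (A b).re := by
  have h1 : A.comp (chordDeriv a b) (1, 0) = A a - A b := by simp [chordDeriv]
  have h2 : A.comp (chordDeriv a b) (0, 1) = A a := by simp [chordDeriv]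
  rw [jac, h1, h2, Complex.sub_re, Complex.sub_im]
  ring

theorem hasFDerivAt_chord {p : ℝ × ℝ} {a b : E3} (ha : HasDerivAt K.toFun a (p.1 + p.2))
    (hb : HasDerivAt K.toFun b p.1) :
    HasFDerivAt (fun p : ℝ × ℝ => K.toFun (p.1 + p.2) - K.toFun p.1) (chordDeriv a b) p := by
  have h1 : HasFDerivAt (fun p : ℝ × ℝ => p.1 + p.2)
      (ContinuousLinearMap.fst ℝ ℝ ℝ + ContinuousLinearMap.snd ℝ ℝ ℝ) p :=
    hasFDerivAt_fst.add hasFDerivAt_snd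
  have h2 := HasFDerivAt.comp (g := K.toFun) p ha.hasFDerivAt h1
  have h3 := HasFDerivAt.comp (g := K.toFun) p hb.hasFDerivAt (hasFDerivAt_fst (p := p))
  refine (h2.sub h3).congr_fderiv (ContinuousLinearMap.ext fun w => ?_)
  simp [chordDeriv, add_smul]

theorem isClosed_chordZeros (ξ : E3) (a ε : ℝ) : IsClosed (K.chordZeros ξ a ε) := by
  have hc := K.continuous
  refine (isClosed_Icc.prod isClosed_Icc).inter ?_
  apply isClosed_eq <;> fun_prop

variable (hK : K.IsPiecewiseC2Knot)

theorem chord_regular {ξ : S2} (hξ : ξ ∈ K.regularDirections) {s u : ℝ} (h0 : 0 < u) (h1 : u < 1)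
    (h : K.toFun (s + u) - K.toFun s = ‖K.toFun (s + u) - K.toFun s‖ • (ξ : E3)) :
    (Int.fract (s + u), Int.fract s) ∈ K.doublePoints ξ ∧ ¬ K.IsCorner (s + u) ∧ ¬ K.IsCorner s ∧
      det3 (deriv K.toFun (s + u)) (deriv K.toFun s) (ξ : E3) ≠ 0 := by
  have hne := sub_ne_zero.mp (K.toFun_ne (s := s) (t := s + u) (by linarith) (by linarith))
  have hm : (Int.fract (s + u), Int.fract s) ∈ K.doublePoints ξ := by
    refine mem_doublePoints.mpr ⟨⟨Int.fract_nonneg _, Int.fract_lt_one _⟩,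
      ⟨Int.fract_nonneg _, Int.fract_lt_one _⟩, ?_⟩
    simp only [K.toFun_fract]
    exact ⟨h, hne⟩
  have hc := hξ.1.not_isCorner (projAlong_eq_iff.mpr ⟨h, hne⟩).1 hne
  have ht := hξ.2 _ hm
  simp only [K.deriv_fract] at ht
  exact ⟨hm, hc.1, hc.2, ht⟩

include hK

/-- In a frame with pole ξ these chords are zeros of the planar projection of the chord map. Its
Jacobian there is the determinant that transversality of the diagram makes nonzero. -/
theorem finite_chordZeros {ξ : S2} (hξ : ξ ∈ K.regularDirections) (a : ℝ) {ε : ℝ} (hε : 0 < ε) :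
    (K.chordZeros ξ a ε).Finite := by
  obtain ⟨f, hf⟩ := PosFrame.exists_frame (norm_eq_of_mem_sphere ξ)
  refine finite_zeros_of_jac (F := fun p => f.planar (K.toFun (p.1 + p.2) - K.toFun p.1))
    (L := fun p => f.planar.comp (chordDeriv (deriv K.toFun (p.1 + p.2)) (deriv K.toFun p.1)))
    (isCompact_Icc.prod isCompact_Icc) (isClosed_chordZeros _ a ε) (fun p hp => hp.1) ?_ ?_ ?_
  all_goals
    intro p hp
    obtain ⟨⟨-, hu⟩, h⟩ := hp
    obtain ⟨-, hc1, hc2, hd⟩ := chord_regular hξ (by linarith [hu.1]) (by linarith [hu.2]) h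
  · have e : f.planar (ξ : E3) = 0 := by
      have := f.twoRay_q 0
      rwa [PosFrame.twoRay, zero_mul, sub_zero, hf] at this
    rw [h, map_smul, e, smul_zero]
  · exact f.planar.hasFDerivAt.comp p (hasFDerivAt_chord (hasDerivAt hK hc1) (hasDerivAt hK hc2))
  · rw [jac_comp_chordDeriv]
    have e := f.det3_coord (deriv K.toFun (p.1 + p.2)) (deriv K.toFun p.1) ξ
    have := f.twoRayDeriv_pole_det 0 (deriv K.toFun (p.1 + p.2)) (deriv K.toFun p.1)
    simp only [f.twoRayDeriv_apply, zero_mul, sub_zero, hf] at this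
    rw [this]
    exact hd

/-- A chord with u close to 1 is the opposite of the short chord from s + u to s + 1. So the short
chords must avoid both the ray of ξ and that of -ξ, which holds off Γ and off -Γ. -/
theorem exists_chord_exclusion {ξ : S2} (hξ : ξ ∉ K.indicatrix) : ∃ ε > 0, ∀ s u,
    0 < u → u < 1 → K.toFun (s + u) - K.toFun s = ‖K.toFun (s + u) - K.toFun s‖ • (ξ : E3) →
      ε < u ∧ u < 1 - ε := by
  rw [indicatrix, mem_ofPred_eq, not_or] at hξ
  obtain ⟨ε₁, h₁, H₁⟩ := exists_chord_ne_ray hK hξ.1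
  obtain ⟨ε₂, h₂, H₂⟩ := exists_chord_ne_ray hK hξ.2
  refine ⟨min ε₁ ε₂ / 2, by positivity, fun s u h0 h1 h => ⟨?_, ?_⟩⟩
  · by_contra hu
    exact H₁ s (s + u) (by linarith) (by linarith [min_le_left ε₁ ε₂]) h
  · by_contra hu
    refine H₂ (s + u) (s + 1) (by linarith) (by linarith [min_le_right ε₁ ε₂]) ?_
    rw [K.periodic s, ← neg_sub, norm_neg, smul_neg, ← h]

omit hK in
-- The chord (s, u) gives the double point with upper parameter s + u and lower parameter s, modulo
-- 1. With no zero on s = a or s = a + 1, each double point is counted once.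
theorem bijOn_chordZeros {ξ : S2} {a ε : ℝ} (hε : 0 < ε)
    (hex : ∀ s u, 0 < u → u < 1 →
      K.toFun (s + u) - K.toFun s = ‖K.toFun (s + u) - K.toFun s‖ • (ξ : E3) → ε < u ∧ u < 1 - ε)
    (ha : ∀ p ∈ K.chordZeros ξ a ε, p.1 ∈ Ioo a (a + 1)) :
    BijOn (fun p : ℝ × ℝ => (Int.fract (p.1 + p.2), Int.fract p.1)) (K.chordZeros ξ a ε)
      (K.doublePoints ξ) := by
  refine ⟨?_, ?_, ?_⟩
  · rintro ⟨s, u⟩ ⟨⟨-, hu⟩, h⟩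
    have hne := sub_ne_zero.mp (K.toFun_ne (s := s) (t := s + u) (by linarith [hu.1])
      (by linarith [hu.2]))
    refine mem_doublePoints.mpr ⟨⟨Int.fract_nonneg _, Int.fract_lt_one _⟩,
      ⟨Int.fract_nonneg _, Int.fract_lt_one _⟩, ?_⟩
    simp only [K.toFun_fract]
    exact ⟨h, hne⟩
  · rintro ⟨s, u⟩ hp ⟨s', u'⟩ hp' heq
    have h1 := ha _ hp
    have h1' := ha _ hp'
    have h2 := hp.1.2
    have h2' := hp'.1.2
    simp only [Prod.mk.injEq, Int.fract_eq_fract] at heq h1 h1' h2 h2'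
    obtain ⟨⟨m, hm⟩, n, hn⟩ := heq
    have hn0 : n = 0 := by
      have u1 : (n : ℝ) < 1 := by linarith [h1.2, h1'.1]
      have u2 : (-1 : ℝ) < n := by linarith [h1.1, h1'.2]
      have : n < 1 := by exact_mod_cast u1
      have : -1 < n := by exact_mod_cast u2
      omega
    subst hn0
    simp only [Int.cast_zero] at hn
    have hm0 : m = 0 := by
      have u1 : (m : ℝ) < 1 := by linarith [h2.2, h2'.1]
      have u2 : (-1 : ℝ) < m := by linarith [h2.1, h2'.2]
      have : m < 1 := by exact_mod_cast u1
      have : -1 < m := by exact_mod_cast u2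
      omega
    subst hm0
    simp only [Int.cast_zero] at hm
    exact Prod.ext (by simp only; linarith) (by simp only; linarith)
  · rintro ⟨t₁, t₂⟩ hp
    obtain ⟨ht1, ht2, h, hne⟩ := mem_doublePoints.mp hp
    simp only at ht1 ht2 h hne
    set s := a + Int.fract (t₂ - a) with hs
    set u := Int.fract (t₁ - s) with hu
    have es : Int.fract s = t₂ := by
      have : s = t₂ - ⌊t₂ - a⌋ := by rw [hs, ← Int.self_sub_floor]; ring
      rw [this, Int.fract_sub_intCast, Int.fract_eq_self.mpr ht2]
    have eu : Int.fract (s + u) = t₁ := by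
      have : s + u = t₁ - ⌊t₁ - s⌋ := by rw [hu, ← Int.self_sub_floor]; ring
      rw [this, Int.fract_sub_intCast, Int.fract_eq_self.mpr ht1]
    have g1 : K.toFun s = K.toFun t₂ := by rw [← K.toFun_fract s, es]
    have g2 : K.toFun (s + u) = K.toFun t₁ := by rw [← K.toFun_fract (s + u), eu]
    have hu1 : u < 1 := Int.fract_lt_one _
    have hu0 : 0 < u := by
      refine lt_of_le_of_ne (Int.fract_nonneg _) fun h0 => hne ?_
      rw [← g1, ← g2, ← h0, add_zero]
    have hz : K.toFun (s + u) - K.toFun s = ‖K.toFun (s + u) - K.toFun s‖ • (ξ : E3) := by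
      rw [g1, g2]; exact h
    obtain ⟨h3, h4⟩ := hex s u hu0 hu1 hz
    refine ⟨(s, u), ⟨⟨⟨?_, ?_⟩, h3.le, h4.le⟩, hz⟩, Prod.ext eu es⟩
    · simp only [hs]; linarith [Int.fract_nonneg (t₂ - a)]
    · simp only [hs]; linarith [Int.fract_lt_one (t₂ - a)]

theorem finite_doublePoints {ξ : S2} (hξ : ξ ∈ K.regularDirections) (hξI : ξ ∉ K.indicatrix) :
    (K.doublePoints ξ).Finite := by
  obtain ⟨ε, hε, hex⟩ := exists_chord_exclusion hK hξI
  refine ((finite_chordZeros hK hξ 0 hε).image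
    (fun p : ℝ × ℝ => (Int.fract (p.1 + p.2), Int.fract p.1))).subset ?_
  rintro ⟨t₁, t₂⟩ hp
  obtain ⟨ht1, ht2, h, hne⟩ := mem_doublePoints.mp hp
  simp only at ht1 ht2 h hne
  set u := Int.fract (t₁ - t₂) with hu
  have eu : Int.fract (t₂ + u) = t₁ := by
    have : t₂ + u = t₁ - ⌊t₁ - t₂⌋ := by rw [hu, ← Int.self_sub_floor]; ring
    rw [this, Int.fract_sub_intCast, Int.fract_eq_self.mpr ht1]
  have g2 : K.toFun (t₂ + u) = K.toFun t₁ := by rw [← K.toFun_fract (t₂ + u), eu]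
  have hu0 : 0 < u := by
    refine lt_of_le_of_ne (Int.fract_nonneg _) fun h0 => hne ?_
    rw [← g2, ← h0, add_zero]
  have hz : K.toFun (t₂ + u) - K.toFun t₂ = ‖K.toFun (t₂ + u) - K.toFun t₂‖ • (ξ : E3) := by
    rw [g2]; exact h
  obtain ⟨h3, h4⟩ := hex t₂ u hu0 (Int.fract_lt_one _) hz
  exact ⟨(t₂, u), ⟨⟨⟨ht2.1, by simp only; linarith [ht2.2]⟩, h3.le, h4.le⟩, hz⟩,
    Prod.ext eu (Int.fract_eq_self.mpr ht2)⟩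

end SimpleClosedCurve

/-! ### The difference of two Tait numbers as a winding number. -/

namespace SimpleClosedCurve

variable {K : SimpleClosedCurve} (hK : K.IsPiecewiseC2Knot)

theorem exists_base (S : Set ℝ) (hS : S.Finite) : ∃ a, ∀ s ∈ S, Int.fract s ≠ Int.fract a := by
  obtain ⟨a, ha, h⟩ := (Ico_infinite (zero_lt_one (α := ℝ))).exists_notMem_finite
    (hS.image Int.fract)
  exact ⟨a, fun s hs h' => h ⟨s, hs, by rw [h', Int.fract_eq_self.mpr ha]⟩⟩

theorem mem_Ioo_of_fract_ne {a s : ℝ} (hs : s ∈ Icc a (a + 1)) (h : Int.fract s ≠ Int.fract a) :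
    s ∈ Ioo a (a + 1) := by
  refine ⟨lt_of_le_of_ne hs.1 fun h' => h (h' ▸ rfl), lt_of_le_of_ne hs.2 fun h' => h ?_⟩
  rw [h', Int.fract_add_one]

theorem tait_eq_sum {ξ : S2} {a ε : ℝ} (hbij : BijOn (fun p : ℝ × ℝ =>
      (Int.fract (p.1 + p.2), Int.fract p.1)) (K.chordZeros ξ a ε) (K.doublePoints ξ))
    (hfin : (K.chordZeros ξ a ε).Finite) :
    K.tait ξ = ∑ p ∈ hfin.toFinset, (SignType.sign
      (det3 (deriv K.toFun (p.1 + p.2)) (deriv K.toFun p.1) (ξ : E3)) : ℤ) := by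
  rw [tait, ← finsum_mem_eq_of_bijOn (f := fun p : ℝ × ℝ => (SignType.sign
      (det3 (deriv K.toFun (p.1 + p.2)) (deriv K.toFun p.1) (ξ : E3)) : ℤ)) _ hbij,
    finsum_mem_eq_finite_toFinset_sum _ hfin]
  intro p _
  simp only [crossingSign, K.deriv_fract]

include hK

/-- The winding number along the boundary of the band of chords. -/
theorem bdry_chord (f : PosFrame) {ξ q : S2} (hf : f.q = q) (hξq : ξ ≠ q)
    (hξ : ξ ∈ K.regularDirections) (hq : q ∈ K.regularDirections) {ε₀ : ℝ}
    (hexξ : ∀ s u, 0 < u → u < 1 → K.toFun (s + u) - K.toFun s =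
      ‖K.toFun (s + u) - K.toFun s‖ • (ξ : E3) → ε₀ < u ∧ u < 1 - ε₀)
    (hexq : ∀ s u, 0 < u → u < 1 → K.toFun (s + u) - K.toFun s =
      ‖K.toFun (s + u) - K.toFun s‖ • (q : E3) → ε₀ < u ∧ u < 1 - ε₀) {ε : ℝ} (hε : 0 < ε)
    (hεε : ε < ε₀) (hε2 : ε < 1 / 2) : ∃ a,
    bdry (fun p => f.twoRay (f.stereo ξ) (K.toFun (p.1 + p.2) - K.toFun p.1)) a (a + 1) ε (1 - ε) =
      2 * Real.pi * Complex.I * ((K.tait q - K.tait ξ : ℤ) : ℂ) ∧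
    ∀ s, ∀ u ∈ Icc ε (1 - ε), (s = a ∨ s = a + 1 ∨ u = ε ∨ u = 1 - ε) →
      f.twoRay (f.stereo ξ) (K.toFun (s + u) - K.toFun s) ≠ 0 := by
  classical
  have hξ1 : ‖(ξ : E3)‖ = 1 := norm_eq_of_mem_sphere ξ
  have hne : (ξ : E3) ≠ f.q := by rw [hf]; exact fun h => hξq (Subtype.ext h)
  have hc := K.continuous
  -- choice of the base point
  have hD := fun (η : S2) (hη : η ∈ K.regularDirections) =>
    finite_chordZeros hK hη 0 hε
  obtain ⟨a, ha⟩ := exists_base _ (((hD ξ hξ).image Prod.fst).union ((hD q hq).image Prod.fst))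
  have hper : ∀ (η : S2) (s u : ℝ), u ∈ Icc ε (1 - ε) →
      K.toFun (s + u) - K.toFun s = ‖K.toFun (s + u) - K.toFun s‖ • (η : E3) →
      (Int.fract s, u) ∈ K.chordZeros η 0 ε := by
    intro η s u hu h
    refine ⟨⟨⟨Int.fract_nonneg _, by simpa using (Int.fract_lt_one s).le⟩, hu⟩, ?_⟩
    have e : K.toFun (Int.fract s + u) = K.toFun (s + u) := by
      rw [show Int.fract s + u = s + u - ⌊s⌋ by rw [← Int.self_sub_floor]; ring, K.toFun_sub_int]
    simp only [K.toFun_fract, e]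
    exact h
  have hfr : ∀ (η : S2), (η = ξ ∨ η = q) → ∀ (s u : ℝ), u ∈ Icc ε (1 - ε) →
      K.toFun (s + u) - K.toFun s = ‖K.toFun (s + u) - K.toFun s‖ • (η : E3) →
      Int.fract s ≠ Int.fract a := by
    intro η hη s u hu h
    have h1 := hper η s u hu h
    have := ha (Int.fract s) (by
      rcases hη with rfl | rfl
      · exact Or.inl ⟨_, h1, rfl⟩
      · exact Or.inr ⟨_, h1, rfl⟩)
    rwa [Int.fract_fract] at this
  have hIoo : ∀ η : S2, (η = ξ ∨ η = q) → ∀ p ∈ K.chordZeros η a ε, p.1 ∈ Ioo a (a + 1) :=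
    fun η hη p hp => mem_Ioo_of_fract_ne hp.1.1 (hfr η hη p.1 p.2 hp.1.2 hp.2)
  have hfinξ := finite_chordZeros hK hξ a hε
  have hfinq := finite_chordZeros hK hq a hε
  have hexξ' : ∀ s u, 0 < u → u < 1 → K.toFun (s + u) - K.toFun s =
      ‖K.toFun (s + u) - K.toFun s‖ • (ξ : E3) → ε < u ∧ u < 1 - ε := fun s u h1 h2 h3 => by
    have := hexξ s u h1 h2 h3; constructor <;> linarith [this.1, this.2]
  have hexq' : ∀ s u, 0 < u → u < 1 → K.toFun (s + u) - K.toFun s =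
      ‖K.toFun (s + u) - K.toFun s‖ • (q : E3) → ε < u ∧ u < 1 - ε := fun s u h1 h2 h3 => by
    have := hexq s u h1 h2 h3; constructor <;> linarith [this.1, this.2]
  have hTξ := tait_eq_sum (bijOn_chordZeros hε hexξ' (hIoo ξ (Or.inl rfl))) hfinξ
  have hTq := tait_eq_sum (bijOn_chordZeros hε hexq' (hIoo q (Or.inr rfl))) hfinq
  have hzero : ∀ s u, f.twoRay (f.stereo ξ) (K.toFun (s + u) - K.toFun s) = 0 →
      K.toFun (s + u) - K.toFun s = ‖K.toFun (s + u) - K.toFun s‖ • (ξ : E3) ∨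
      K.toFun (s + u) - K.toFun s = ‖K.toFun (s + u) - K.toFun s‖ • (q : E3) := by
    intro s u h
    rcases f.twoRay_eq_zero hξ1 hne h with h | h
    · right; rw [← hf]; exact h
    · left; exact h
  refine ⟨a, ?_, ?_⟩
  swap
  · intro s u hu hb h
    have hu' : 0 < u ∧ u < 1 := ⟨by linarith [hu.1], by linarith [hu.2]⟩
    have hη : ∃ η : S2, (η = ξ ∨ η = q) ∧
        K.toFun (s + u) - K.toFun s = ‖K.toFun (s + u) - K.toFun s‖ • (η : E3) := by
      rcases hzero s u h with h | h
      exacts [⟨ξ, Or.inl rfl, h⟩, ⟨q, Or.inr rfl, h⟩]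
    obtain ⟨η, hη, hz⟩ := hη
    have h1 := hfr η hη s u hu hz
    have h2 : ε < u ∧ u < 1 - ε := by
      rcases hη with rfl | rfl
      exacts [hexξ' s u hu'.1 hu'.2 hz, hexq' s u hu'.1 hu'.2 hz]
    rcases hb with rfl | rfl | rfl | rfl
    · exact h1 rfl
    · exact h1 (Int.fract_add_one a)
    · exact lt_irrefl _ h2.1
    · exact lt_irrefl _ h2.2
  · have hdisj : ∀ p ∈ K.chordZeros ξ a ε, p ∉ K.chordZeros q a ε := by
      rintro p ⟨⟨-, hu⟩, h⟩ ⟨-, h'⟩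
      have hn := K.toFun_ne (s := p.1) (t := p.1 + p.2) (by linarith [hu.1]) (by linarith [hu.2])
      rw [h] at h'
      apply hξq
      apply Subtype.ext
      rw [norm_smul, norm_norm, hξ1, mul_one] at h'
      exact smul_right_injective E3 (norm_ne_zero_iff.mpr hn) h'
    -- A chord cannot point along both rays, so the zeros split into two disjoint sets. Those on the
    -- ray of ξ have Jacobian minus the crossing determinant, those on the ray of q have it with a
    -- plus sign.
    set L : ℝ × ℝ → (ℝ × ℝ →L[ℝ] ℂ) := fun p => (f.twoRayDeriv (f.stereo ξ)
      (if p ∈ K.chordZeros ξ a ε then (ξ : E3) else q)).comp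
        (chordDeriv (deriv K.toFun (p.1 + p.2)) (deriv K.toFun p.1)) with hLdef
    have hjξ : ∀ p ∈ K.chordZeros ξ a ε, jac (L p) =
        -det3 (deriv K.toFun (p.1 + p.2)) (deriv K.toFun p.1) (ξ : E3) := by
      intro p hp
      rw [hLdef]
      simp only
      rw [if_pos hp, jac_comp_chordDeriv, f.twoRayDeriv_det hξ1 hne]
    have hjq : ∀ p ∈ K.chordZeros q a ε, jac (L p) =
        det3 (deriv K.toFun (p.1 + p.2)) (deriv K.toFun p.1) (q : E3) := by
      intro p hp
      rw [hLdef]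
      simp only
      rw [if_neg (fun h => hdisj p h hp), jac_comp_chordDeriv, ← hf, f.twoRayDeriv_pole_det]
    have hreg : ∀ η : S2, η ∈ K.regularDirections → ∀ p ∈ K.chordZeros η a ε,
        ¬ K.IsCorner (p.1 + p.2) ∧ ¬ K.IsCorner p.1 ∧
        det3 (deriv K.toFun (p.1 + p.2)) (deriv K.toFun p.1) (η : E3) ≠ 0 ∧
        0 < ‖K.toFun (p.1 + p.2) - K.toFun p.1‖ := by
      rintro η hη p ⟨⟨-, hu⟩, h⟩
      have h1 := chord_regular hη (by linarith [hu.1]) (by linarith [hu.2]) h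
      exact ⟨h1.2.1, h1.2.2.1, h1.2.2.2, norm_pos_iff.mpr
        (K.toFun_ne (s := p.1) (t := p.1 + p.2) (by linarith [hu.1]) (by linarith [hu.2]))⟩
    rw [bdry_eq_sum_sign (by linarith) (by linarith) (hfinξ.toFinset ∪ hfinq.toFinset)
      (L := L) ?_ ?_ ?_ ?_ ?_ ?_]
    · rw [Finset.sum_union (Finset.disjoint_left.mpr fun p hp hp' => hdisj p (by simpa using hp)
        (by simpa using hp')), hTξ, hTq, Finset.sum_congr (s₁ := hfinq.toFinset)
          (g := fun p => (SignType.sign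
            (det3 (deriv K.toFun (p.1 + p.2)) (deriv K.toFun p.1) (q : E3)) : ℤ)) rfl
          (fun p hp => by rw [hjq p (by simpa using hp)])]
      rw [Finset.sum_congr (s₁ := hfinξ.toFinset) (g := fun p => -(SignType.sign
        (det3 (deriv K.toFun (p.1 + p.2)) (deriv K.toFun p.1) (ξ : E3)) : ℤ)) rfl
          (fun p hp => by rw [hjξ p (by simpa using hp), Left.sign_neg]; simp)]
      rw [Finset.sum_neg_distrib]
      congr 2
      ring
    · refine Continuous.continuousOn ?_
      refine (f.continuous_twoRay _).comp ?_
      fun_prop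
    · intro p hp
      simp only [Finset.mem_union, Set.Finite.mem_toFinset] at hp
      rcases hp with hp | hp
      · exact ⟨hIoo ξ (Or.inl rfl) p hp, hexξ' p.1 p.2 (by linarith [hp.1.2.1])
          (by linarith [hp.1.2.2]) hp.2⟩
      · exact ⟨hIoo q (Or.inr rfl) p hp, hexq' p.1 p.2 (by linarith [hp.1.2.1])
          (by linarith [hp.1.2.2]) hp.2⟩
    · intro p hp h
      simp only [Finset.mem_union, Set.Finite.mem_toFinset]
      rcases hzero p.1 p.2 h with h | h
      exacts [Or.inl ⟨hp, h⟩, Or.inr ⟨hp, h⟩]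
    · intro p hp
      simp only [Finset.mem_union, Set.Finite.mem_toFinset] at hp
      rcases hp with hp | hp
      · obtain ⟨h1, h2, -, h3⟩ := hreg ξ hξ p hp
        have h4 := f.hasFDerivAt_twoRay (f.stereo ξ) hξ1 h3
        rw [← hp.2] at h4
        rw [hLdef]
        simp only
        rw [if_pos hp]
        exact HasFDerivAt.comp p h4 (hasFDerivAt_chord (hasDerivAt hK h1) (hasDerivAt hK h2))
      · obtain ⟨h1, h2, -, h3⟩ := hreg q hq p hp
        have h4 := f.hasFDerivAt_twoRay (f.stereo ξ) (norm_eq_of_mem_sphere q) h3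
        rw [← hp.2] at h4
        rw [hLdef]
        simp only
        rw [if_neg (fun h => hdisj p h hp)]
        exact HasFDerivAt.comp p h4 (hasFDerivAt_chord (hasDerivAt hK h1) (hasDerivAt hK h2))
    · intro p hp
      simp only [Finset.mem_union, Set.Finite.mem_toFinset] at hp
      rcases hp with hp | hp
      · rw [hp.2, f.twoRay_eq_zero_of_smul hξ1 hne (norm_nonneg _)]
      · rw [hp.2, f.twoRay_smul (norm_nonneg _), ← hf, f.twoRay_q, mul_zero]
    · intro p hp
      simp only [Finset.mem_union, Set.Finite.mem_toFinset] at hp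
      rcases hp with hp | hp
      · rw [hjξ p hp]; exact neg_ne_zero.mpr (hreg ξ hξ p hp).2.2.1
      · rw [hjq p hp]; exact (hreg q hq p hp).2.2.1

end SimpleClosedCurve

namespace SimpleClosedCurve

variable {K : SimpleClosedCurve}

theorem dlog_chord {f : PosFrame} {z : ℂ} {ε : ℝ} (h0 : 0 < ε) (h1 : ε < 1)
    (hne : ∀ s, f.twoRay z (K.unitChord ε s) ≠ 0) (a : ℝ) :
    dlog (fun s => f.twoRay z (K.toFun (s + ε) - K.toFun s)) a (a + 1) = K.chordLog f z ε 0 1 := by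
  have hc := K.continuous
  have hcont : Continuous (fun s => f.twoRay z (K.unitChord ε s)) :=
    (f.continuous_twoRay z).comp (continuous_unitChord h0 h1)
  have hper : Function.Periodic (fun s => f.twoRay z (K.unitChord ε s)) 1 := by
    intro s
    have h1 : s + 1 + ε = s + ε + 1 := by ring
    simp only [unitChord, h1, K.periodic s, K.periodic (s + ε)]
  have hpos : ∀ s, 0 < ‖K.toFun (s + ε) - K.toFun s‖ := fun s =>
    norm_pos_iff.mpr (K.toFun_ne (s := s) (t := s + ε) (by linarith) (by linarith))
  have e1 : (fun s => f.twoRay z (K.toFun (s + ε) - K.toFun s)) =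
      fun s => ((‖K.toFun (s + ε) - K.toFun s‖ : ℝ) : ℂ) * f.twoRay z (K.unitChord ε s) := by
    funext s
    rw [← f.twoRay_smul (hpos s).le, unitChord, smul_smul, mul_inv_cancel₀ (hpos s).ne', one_smul]
  rw [e1, dlog_pos_smul (by linarith) hcont.continuousOn (fun s _ => hne s)
    (by apply Continuous.continuousOn; fun_prop) (fun s _ => hpos s), chordLog,
    dlog_periodic hcont hne hper a 0, zero_add]
  have h1 : a + 1 + ε = a + ε + 1 := by ring
  rw [h1, K.periodic, K.periodic]

/-- By periodicity the chord from s to s + 1 - ε is the opposite of the chord from s - ε to s. The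
shift by ε and the positive norm do not affect the change of the logarithm over a period. -/
theorem dlog_neg_chord {f : PosFrame} {z : ℂ} {ε : ℝ} (h0 : 0 < ε) (h1 : ε < 1)
    (hne : ∀ s, f.twoRay z (-K.unitChord ε s) ≠ 0) (a : ℝ) :
    dlog (fun s => f.twoRay z (K.toFun (s + (1 - ε)) - K.toFun s)) a (a + 1) =
      dlog (fun s => f.twoRay z (-K.unitChord ε s)) 0 1 := by
  have hc := K.continuous
  have hcont : Continuous (fun s => f.twoRay z (-K.unitChord ε s)) :=
    (f.continuous_twoRay z).comp (continuous_unitChord h0 h1).neg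
  have hper : Function.Periodic (fun s => f.twoRay z (-K.unitChord ε s)) 1 := by
    intro s
    have h1 : s + 1 + ε = s + ε + 1 := by ring
    simp only [unitChord, h1, K.periodic s, K.periodic (s + ε)]
  have hpos : ∀ s, 0 < ‖K.toFun (s + ε) - K.toFun s‖ := fun s =>
    norm_pos_iff.mpr (K.toFun_ne (s := s) (t := s + ε) (by linarith) (by linarith))
  have e1 : (fun s => f.twoRay z (K.toFun (s + (1 - ε)) - K.toFun s)) =
      fun s => ((‖K.toFun (s + -ε + ε) - K.toFun (s + -ε)‖ : ℝ) : ℂ) *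
        f.twoRay z (-K.unitChord ε (s + -ε)) := by
    funext s
    rw [← f.twoRay_smul (hpos _).le, unitChord, smul_neg, smul_smul,
      mul_inv_cancel₀ (hpos _).ne', one_smul, neg_sub, neg_add_cancel_right]
    congr 2
    rw [show s + (1 - ε) = s + -ε + 1 by ring, K.periodic]
  rw [e1, dlog_pos_smul (g := fun s => f.twoRay z (-K.unitChord ε (s + -ε)))
    (r := fun s => ‖K.toFun (s + -ε + ε) - K.toFun (s + -ε)‖) (by linarith)
    (Continuous.continuousOn (hcont.comp (by fun_prop : Continuous fun s : ℝ => s + -ε)))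
    (fun s _ => hne _)
    (by apply Continuous.continuousOn; fun_prop) (fun s _ => hpos _),
    dlog_comp_add (g := fun s => f.twoRay z (-K.unitChord ε s)) (-ε) (by linarith)
      hcont.continuousOn (fun s _ => hne s),
    show a + 1 + -ε = a + -ε + 1 by ring, dlog_periodic hcont hne hper _ 0, zero_add]
  have h1 : a + 1 + -ε = a + -ε + 1 := by ring
  have h2 : a + -ε + 1 + ε = a + -ε + ε + 1 := by ring
  simp only [h1, h2, K.periodic _]

variable (hK : K.IsPiecewiseC2Knot)

include hK

/-- In the boundary of the band the sides s = a and s = a + 1 carry the same function by periodicity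
and cancel. The other two sides form `boundaryLog`. -/
theorem boundaryLog_eq (f : PosFrame) {ξ q : S2} (hf : f.q = q) (hξq : ξ ≠ q)
    (hξ : ξ ∈ K.regularDirections) (hq : q ∈ K.regularDirections) (hξI : ξ ∉ K.indicatrix)
    (hqI : q ∉ K.indicatrix) : ∀ᶠ ε in 𝓝[>] (0 : ℝ), K.boundaryLog f (f.stereo ξ) ε =
      2 * Real.pi * Complex.I * ((K.tait q - K.tait ξ : ℤ) : ℂ) := by
  obtain ⟨ε₁, hε₁, hex₁⟩ := exists_chord_exclusion hK hξI
  obtain ⟨ε₂, hε₂, hex₂⟩ := exists_chord_exclusion hK hqI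
  have hm : Ioo (0 : ℝ) (min (1 / 2) (min ε₁ ε₂)) ∈ 𝓝[>] (0 : ℝ) :=
    Ioo_mem_nhdsGT (lt_min (by norm_num) (lt_min hε₁ hε₂))
  have hξ1 : ‖(ξ : E3)‖ = 1 := norm_eq_of_mem_sphere ξ
  have hne : (ξ : E3) ≠ f.q := by rw [hf]; exact fun h => hξq (Subtype.ext h)
  rw [indicatrix, mem_ofPred_eq, not_or] at hξI hqI
  have hne' : -(ξ : E3) ≠ f.neg.q := fun h => hne (neg_injective h)
  filter_upwards [hm, exists_twoRay_unitChord_ne hK f (hf ▸ hqI.1) hξ1 hne hξI.1,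
    exists_twoRay_unitChord_ne hK f.neg (by rw [← hf] at hqI; exact hqI.2) (by rwa [norm_neg])
      hne' hξI.2] with ε hε hnz hnz'
  have hnz2 : ∀ s, f.twoRay (f.stereo ξ) (-K.unitChord ε s) ≠ 0 := by
    intro s h
    apply hnz'.2.2 s
    rw [f.stereo_neg, f.twoRay_neg, h, map_zero]
  obtain ⟨h0, hlt⟩ := hε
  rw [lt_min_iff, lt_min_iff] at hlt
  obtain ⟨a, hb, hbne⟩ := bdry_chord hK f hf hξq hξ hq (ε₀ := min ε₁ ε₂)
    (fun s u h1 h2 h3 => by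
      have := hex₁ s u h1 h2 h3
      have := min_le_left ε₁ ε₂
      constructor <;> linarith [(hex₁ s u h1 h2 h3).1, (hex₁ s u h1 h2 h3).2])
    (fun s u h1 h2 h3 => by
      have := min_le_right ε₁ ε₂
      constructor <;> linarith [(hex₂ s u h1 h2 h3).1, (hex₂ s u h1 h2 h3).2])
    h0 (lt_min hlt.2.1 hlt.2.2) hlt.1
  rw [← hb, bdry, boundaryLog]
  simp only
  rw [dlog_chord h0 hnz.2.1 hnz.2.2, dlog_neg_chord h0 hnz.2.1 hnz2]
  have hside : (fun y => f.twoRay (f.stereo ξ) (K.toFun (a + 1 + y) - K.toFun (a + 1))) =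
      fun y => f.twoRay (f.stereo ξ) (K.toFun (a + y) - K.toFun a) := by
    funext y
    rw [show a + 1 + y = a + y + 1 by ring, K.periodic, K.periodic]
  rw [hside]
  ring

end SimpleClosedCurve

/-! ### Null sets in space -/

/-- The coordinates of space. -/
def coord (i : Fin 3) : E3 →L[ℝ] ℝ := EuclideanSpace.proj i

@[simp] theorem coord_apply (i : Fin 3) (x : E3) : coord i x = x i := rfl

/-- The linear map with the given columns. -/
def colMap (w₀ w₁ w₂ : E3) : E3 →L[ℝ] E3 :=
  (coord 0).smulRight w₀ +
    (coord 1).smulRight w₁ +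
    (coord 2).smulRight w₂

theorem colMap_apply (w₀ w₁ w₂ x : E3) : colMap w₀ w₁ w₂ x = x 0 • w₀ + x 1 • w₁ + x 2 • w₂ := by
  simp [colMap]

theorem det_colMap (w₀ w₁ w₂ : E3) : (colMap w₀ w₁ w₂).det = det3 w₀ w₁ w₂ := by
  rw [ContinuousLinearMap.det,
    ← LinearMap.det_toMatrix (EuclideanSpace.basisFun (Fin 3) ℝ).toBasis, Matrix.det_fin_three,
    det3_eq]
  simp [LinearMap.toMatrix_apply, colMap_apply]
  ring

/-- Sard's theorem in equal dimensions: the image of a set of critical points is null. The null sets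
needed here are images of such maps, with a zero column standing for a missing parameter. -/
theorem volume_image_colMap {Φ : E3 → E3} {S : Set E3} {w₀ w₁ w₂ : E3 → E3}
    (h : ∀ x ∈ S, HasFDerivAt Φ (colMap (w₀ x) (w₁ x) (w₂ x)) x)
    (hd : ∀ x ∈ S, det3 (w₀ x) (w₁ x) (w₂ x) = 0) : MeasureTheory.volume (Φ '' S) = 0 :=
  MeasureTheory.addHaar_image_eq_zero_of_det_fderivWithin_eq_zero _
    (fun x hx => (h x hx).hasFDerivWithinAt) (fun x hx => by rw [det_colMap, hd x hx])

theorem hasFDerivAt_coord (i : Fin 3) (x : E3) :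
    HasFDerivAt (fun x : E3 => x i) (coord i) x :=
  (coord i).hasFDerivAt

theorem hasFDerivAt_comp_coord {g : ℝ → E3}
    {g' : E3} (i : Fin 3) {x : E3} (h : HasDerivAt g g' (x i)) : HasFDerivAt (fun x : E3 => g (x i))
      ((coord i).smulRight g') x := by
  refine (HasFDerivAt.comp (g := g) x h.hasFDerivAt (hasFDerivAt_coord i x)).congr_fderiv
    (ContinuousLinearMap.ext fun w => ?_)
  simp

/-- The cone over a curve is a null set. -/
theorem volume_cone {g g' : ℝ → E3} {S : Set ℝ} (h : ∀ t ∈ S, HasDerivAt g (g' t) t) :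
    MeasureTheory.volume {v : E3 | ∃ r : ℝ, ∃ t ∈ S, v = r • g t} = 0 := by
  refine MeasureTheory.measure_mono_null ?_ (volume_image_colMap (Φ := fun x => x 0 • g (x 1))
    (S := {x | x 1 ∈ S}) (w₀ := fun x => g (x 1)) (w₁ := fun x => x 0 • g' (x 1))
    (w₂ := fun _ => 0) ?_ ?_)
  · rintro v ⟨r, t, ht, rfl⟩
    exact ⟨!₂[r, t, 0], by simpa using ht, by simp⟩
  · intro x hx
    refine ((hasFDerivAt_coord 0 x).smul (hasFDerivAt_comp_coord 1 (h _ hx))).congr_fderiv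
      (ContinuousLinearMap.ext fun w => ?_)
    simp [colMap_apply, smul_smul, mul_comm, add_comm]
  · intro x _
    simp [det3_eq]

/-- A plane is a null set. -/
theorem volume_plane (a b : E3) : MeasureTheory.volume {v : E3 | ∃ r s : ℝ, v = r • a + s • b} =
    0 := by
  refine MeasureTheory.measure_mono_null ?_ (volume_image_colMap (Φ := colMap a b 0)
    (S := univ) (w₀ := fun x => a) (w₁ := fun x => b)
    (w₂ := fun _ => 0) (fun x _ => (colMap a b 0).hasFDerivAt) ?_)
  · rintro v ⟨r, s, rfl⟩
    exact ⟨!₂[r, s, 0], trivial, by simp [colMap_apply]⟩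
  · intro x _
    simp [det3_eq]

/-- The directions of the planes through `ξ` which are tangent to a curve form a null set. -/
theorem volume_tangent_planes {g g' : ℝ → E3} {S : Set ℝ} (h : ∀ t ∈ S, HasDerivAt g (g' t) t)
    (ξ : E3) : MeasureTheory.volume
      {v : E3 | ∃ a b : ℝ, ∃ t ∈ S, det3 ξ (g t) (g' t) = 0 ∧ v = a • ξ + b • g t} = 0 := by
  refine MeasureTheory.measure_mono_null ?_ (volume_image_colMap
    (Φ := fun x => x 0 • ξ + x 1 • g (x 2))
    (S := {x | x 2 ∈ S ∧ det3 ξ (g (x 2)) (g' (x 2)) = 0}) (w₀ := fun x => ξ)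
    (w₁ := fun x => g (x 2)) (w₂ := fun x => x 1 • g' (x 2)) ?_ ?_)
  · rintro v ⟨a, b, t, ht, hd, rfl⟩
    exact ⟨!₂[a, b, t], by simpa using ⟨ht, hd⟩, by simp⟩
  · intro x hx
    refine (((hasFDerivAt_coord 0 x).smul (hasFDerivAt_const ξ x)).add
      ((hasFDerivAt_coord 1 x).smul (hasFDerivAt_comp_coord 2 (h _ hx.1)))).congr_fderiv
      (ContinuousLinearMap.ext fun w => ?_)
    simp [colMap_apply, smul_smul, mul_comm]
    abel
  · intro x hx
    have := hx.2
    simp only [det3_eq, PiLp.smul_apply, smul_eq_mul] at this ⊢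
    linear_combination x 1 * this

/-- The directions of the chords at which the curve is not transverse form a null set. -/
theorem volume_tangential_chords {g g' : ℝ → E3} {S : Set ℝ} (h : ∀ t ∈ S, HasDerivAt g (g' t) t) :
    MeasureTheory.volume {v : E3 | ∃ r : ℝ, ∃ s ∈ S, ∃ t ∈ S,
      det3 (g' s) (g' t) (g s - g t) = 0 ∧ v = r • (g s - g t)} = 0 := by
  refine MeasureTheory.measure_mono_null ?_ (volume_image_colMap
    (Φ := fun x => x 0 • (g (x 1) - g (x 2)))
    (S := {x | x 1 ∈ S ∧ x 2 ∈ S ∧ det3 (g' (x 1)) (g' (x 2)) (g (x 1) - g (x 2)) = 0})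
    (w₀ := fun x => g (x 1) - g (x 2))
    (w₁ := fun x => x 0 • g' (x 1)) (w₂ := fun x => -(x 0 • g' (x 2))) ?_ ?_)
  · rintro v ⟨r, s, hs, t, ht, hd, rfl⟩
    exact ⟨!₂[r, s, t], by simpa using ⟨hs, ht, hd⟩, by simp⟩
  · intro x hx
    refine ((hasFDerivAt_coord 0 x).smul ((hasFDerivAt_comp_coord 1 (h _ hx.1)).sub
      (hasFDerivAt_comp_coord 2 (h _ hx.2.1)))).congr_fderiv (ContinuousLinearMap.ext fun w => ?_)
    simp [colMap_apply, smul_smul, mul_comm, smul_sub]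
    abel
  · intro x hx
    have := hx.2.2
    simp only [det3_eq, PiLp.smul_apply, PiLp.neg_apply, PiLp.sub_apply, smul_eq_mul] at this ⊢
    linear_combination (-(x 0) ^ 2) * this

/-- A set with a tangent plane at each of its points is a null set. -/
theorem volume_eq_zero_of_tangent {S : Set E3} (φ : E3 → E3 →L[ℝ] ℝ) (hφ : ∀ x ∈ S, φ x ≠ 0)
    (h : ∀ x ∈ S, ∀ c > 0, ∀ᶠ y in 𝓝[S] x, |φ x (y - x)| ≤ c * ‖y - x‖) :
    MeasureTheory.volume S = 0 := by
  have hw : ∀ x ∈ S, ∃ w : E3, φ x w = 1 := by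
    intro x hx
    obtain ⟨w, hw⟩ := DFunLike.ne_iff.mp (hφ x hx)
    exact ⟨(φ x w)⁻¹ • w, by rw [map_smul, smul_eq_mul, inv_mul_cancel₀ (by simpa using hw)]⟩
  choose! w hw using hw
  -- Within S the form φ x is negligible on increments, so that the identity also has the derivative
  -- id - φ x ⊗ w there. As φ x w = 1, this derivative kills w and is singular.
  have := MeasureTheory.addHaar_image_eq_zero_of_det_fderivWithin_eq_zero MeasureTheory.volume
    (f := id) (s := S) (f' := fun x => ContinuousLinearMap.id ℝ E3 - (φ x).smulRight (w x))
    (fun x hx => ?_) (fun x hx => ?_)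
  · simpa using this
  · refine .of_isLittleO (Asymptotics.isLittleO_iff.mpr fun c hc => ?_)
    filter_upwards [h x hx (c / (‖w x‖ + 1)) (by positivity)] with y hy
    have e : id y - id x - (ContinuousLinearMap.id ℝ E3 - (φ x).smulRight (w x)) (y - x) =
        φ x (y - x) • w x := by simp
    rw [e, norm_smul, Real.norm_eq_abs]
    calc |φ x (y - x)| * ‖w x‖ ≤ c / (‖w x‖ + 1) * ‖y - x‖ * (‖w x‖ + 1) := by
          gcongr; linarith
      _ = c * ‖y - x‖ := by field_simp
  · by_contra hdet
    have hinj := (LinearMap.equivOfDetNeZero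
      ((ContinuousLinearMap.id ℝ E3 - (φ x).smulRight (w x) : E3 →L[ℝ] E3) : E3 →ₗ[ℝ] E3)
        hdet).injective
    have e : LinearMap.equivOfDetNeZero
      ((ContinuousLinearMap.id ℝ E3 - (φ x).smulRight (w x) : E3 →L[ℝ] E3) : E3 →ₗ[ℝ] E3)
        hdet (w x) = 0 := by
      change (ContinuousLinearMap.id ℝ E3 - (φ x).smulRight (w x) : E3 →L[ℝ] E3) (w x) = 0
      simp [hw x hx]
    have h0 : w x = 0 := hinj (by rw [e, map_zero])
    have := hw x hx
    rw [h0, map_zero] at this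
    exact zero_ne_one this

/-- The determinant as a bilinear form in its first two columns. -/
def det3Form (w : E3) : E3 →ₗ[ℝ] E3 →ₗ[ℝ] ℝ :=
  LinearMap.mk₂ ℝ (fun a b => det3 a b w) (by intros; simp only [det3_eq, PiLp.add_apply]; ring)
    (by intros; simp only [det3_eq, PiLp.smul_apply, smul_eq_mul]; ring)
    (by intros; simp only [det3_eq, PiLp.add_apply]; ring)
    (by intros; simp only [det3_eq, PiLp.smul_apply, smul_eq_mul]; ring)

section

variable {g : ℝ → E3}

/-- The derivative of the determinant which expresses that three points of a curve are collinear. -/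
theorem exists_hasFDerivAt_det3_chords (w : E3) {x : E3} {u : ℝ} {a b c : E3}
    (ha : HasDerivAt g a (x 1)) (hb : HasDerivAt g b (x 2)) (hc : HasDerivAt g c u) :
    ∃ L : E3 × ℝ →L[ℝ] ℝ, HasFDerivAt
      (fun z : E3 × ℝ => det3 (g (z.1 2) - g (z.1 1)) (g z.2 - g (z.1 1)) w) L (x, u) ∧
      ∀ d : E3 × ℝ, L d = d.1 2 * det3 b (g u - g (x 1)) w + d.2 * det3 (g (x 2) - g (x 1)) c w +
        d.1 1 * (-det3 a (g u - g (x 1)) w - det3 (g (x 2) - g (x 1)) a w) := by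
  have h1 : HasFDerivAt (fun z : E3 × ℝ => g (z.1 1)) (((coord 1).smulRight a).comp
      (ContinuousLinearMap.fst ℝ E3 ℝ)) (x, u) :=
    HasFDerivAt.comp (g := fun x : E3 => g (x 1)) (x, u) (hasFDerivAt_comp_coord 1 ha)
      hasFDerivAt_fst
  have h2 : HasFDerivAt (fun z : E3 × ℝ => g (z.1 2)) (((coord 2).smulRight b).comp
      (ContinuousLinearMap.fst ℝ E3 ℝ)) (x, u) :=
    HasFDerivAt.comp (g := fun x : E3 => g (x 2)) (x, u) (hasFDerivAt_comp_coord 2 hb)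
      hasFDerivAt_fst
  have h3 : HasFDerivAt (fun z : E3 × ℝ => g z.2) ((ContinuousLinearMap.toSpanSingleton ℝ c).comp
      (ContinuousLinearMap.snd ℝ E3 ℝ)) (x, u) :=
    HasFDerivAt.comp (g := g) (x, u) hc.hasFDerivAt hasFDerivAt_snd
  have h4 := (LinearMap.toContinuousBilinearMap (det3Form w)).hasFDerivAt_of_bilinear (h2.sub h1)
    (h3.sub h1)
  refine ⟨_, h4, fun d => ?_⟩
  simp [det3Form, det3_eq]
  ring

/-- The triples of collinear points of a curve, the last of which lies over `[p, q]` and is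
unique. -/
def isolatedTriples (g g' : ℝ → E3) (S : Set ℝ) (p q : ℝ) : Set E3 :=
  {x | x 1 ∈ S ∧ x 2 ∈ S ∧ ∃ u ∈ Icc p q, u ∈ S ∧
    (∃ l : ℝ, l ≠ 0 ∧ g u - g (x 1) = l • (g (x 2) - g (x 1))) ∧
    det3 (g' (x 2)) (g' u) (g (x 2) - g (x 1)) ≠ 0 ∧
    ∀ u' ∈ Icc p q, (∀ w, det3 (g (x 2) - g (x 1)) (g u' - g (x 1)) w = 0) → u' = u}

/-- By uniqueness the third parameter is a continuous function U of x. Collinearity says that det3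
(g t - g s) (g u - g s) w vanishes for all w. The choice w = g' t bounds the increment of U by that
of x; the choice w = g' u then eliminates the increment of U and leaves a linear relation among the
increments of x, with nonzero coefficient at that of t. So the set has a tangent plane at each
point. -/
theorem volume_isolatedTriples {g' : ℝ → E3} {S : Set ℝ} (hg : Continuous g)
    (h : ∀ t ∈ S, HasDerivAt g (g' t) t) (p q : ℝ) :
    MeasureTheory.volume (isolatedTriples g g' S p q) = 0 := by
  have hu : ∀ x ∈ isolatedTriples g g' S p q, ∃ u ∈ Icc p q, u ∈ S ∧
    (∃ l : ℝ, l ≠ 0 ∧ g u - g (x 1) = l • (g (x 2) - g (x 1))) ∧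
    det3 (g' (x 2)) (g' u) (g (x 2) - g (x 1)) ≠ 0 ∧
    ∀ u' ∈ Icc p q, (∀ w, det3 (g (x 2) - g (x 1)) (g u' - g (x 1)) w = 0) → u' = u :=
    fun x hx => hx.2.2
  choose! U hU hUS hUl hUd hUu using hu
  have hzero : ∀ x ∈ isolatedTriples g g' S p q, ∀ w,
      det3 (g (x 2) - g (x 1)) (g (U x) - g (x 1)) w = 0 := by
    intro x hx w
    obtain ⟨l, -, hl⟩ := hUl x hx
    rw [hl]
    simp only [det3_eq, PiLp.smul_apply, smul_eq_mul]
    ring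
  have hcoord : ∀ i, Continuous fun x : E3 => x i := fun i => (coord i).continuous
  -- A cluster value of U in the compact interval again completes x to a collinear triple, so it
  -- equals U x by uniqueness.
  have hUt : ∀ x ∈ isolatedTriples g g' S p q,
      Tendsto U (𝓝[isolatedTriples g g' S p q] x) (𝓝 (U x)) := by
    intro x hx
    refine isCompact_Icc.tendsto_nhds_of_unique_mapClusterPt
      (eventually_nhdsWithin_of_forall hU) fun y hy hcl => hUu x hx y hy fun w => ?_
    by_contra hne
    have hcont : Continuous fun z : E3 × ℝ =>
        det3 (g (z.1 2) - g (z.1 1)) (g z.2 - g (z.1 1)) w := by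
      have h1 : Continuous fun z : E3 × ℝ => g (z.1 1) := hg.comp ((hcoord 1).comp continuous_fst)
      have h2 : Continuous fun z : E3 × ℝ => g (z.1 2) := hg.comp ((hcoord 2).comp continuous_fst)
      have h3 : Continuous fun z : E3 × ℝ => g z.2 := hg.comp continuous_snd
      have d1 := h2.sub h1
      have d2 := h3.sub h1
      have k1 := fun i => (hcoord i).comp d1
      have k2 := fun i => (hcoord i).comp d2
      simp only [det3_eq]
      have a0 := k1 0; have a1 := k1 1; have a2 := k1 2
      have b0 := k2 0; have b1 := k2 1; have b2 := k2 2
      simp only [Function.comp_def] at a0 a1 a2 b0 b1 b2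
      fun_prop
    have hev : ∀ᶠ z in 𝓝 (x, y), det3 (g (z.1 2) - g (z.1 1)) (g z.2 - g (z.1 1)) w ≠ 0 :=
      hcont.continuousAt.eventually_ne hne
    rw [nhds_prod_eq] at hev
    obtain ⟨A, hA, B, hB, hAB⟩ := Filter.eventually_prod_iff.mp hev
    have hA' : ∀ᶠ x' in 𝓝[isolatedTriples g g' S p q] x, A x' := nhdsWithin_le_nhds hA
    obtain ⟨x', hx'B, hx'A, hx'⟩ := ((mapClusterPt_iff_frequently.mp hcl _ hB).and_eventually
      (hA'.and self_mem_nhdsWithin)).exists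
    exact hAB hx'A hx'B (hzero x' hx' w)
  have hsmall : ∀ x ∈ isolatedTriples g g' S p q, ∀ w, ∀ c > 0,
      ∀ᶠ y in 𝓝[isolatedTriples g g' S p q] x,
      |(y - x) 2 * det3 (g' (x 2)) (g (U x) - g (x 1)) w +
        (U y - U x) * det3 (g (x 2) - g (x 1)) (g' (U x)) w +
        (y - x) 1 * (-det3 (g' (x 1)) (g (U x) - g (x 1)) w -
          det3 (g (x 2) - g (x 1)) (g' (x 1)) w)| ≤ c * (‖y - x‖ + |U y - U x|) := by
    intro x hx w c hc
    obtain ⟨L, hL, hLe⟩ := exists_hasFDerivAt_det3_chords w (h _ hx.1) (h _ hx.2.1)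
      (h _ (hUS x hx))
    have ht : Tendsto (fun y => (y, U y)) (𝓝[isolatedTriples g g' S p q] x) (𝓝 (x, U x)) :=
      (tendsto_id'.mpr nhdsWithin_le_nhds).prodMk_nhds (hUt x hx)
    have h1 := ht.eventually (Asymptotics.isLittleO_iff.mp hL.isLittleO hc)
    filter_upwards [h1, self_mem_nhdsWithin] with y hy hyS
    rw [hzero x hx w, hzero y hyS w, sub_zero, zero_sub, norm_neg, hLe] at hy
    refine hy.trans (mul_le_mul_of_nonneg_left ?_ hc.le)
    rw [Prod.norm_def]
    exact max_le (by simp) (by simp)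
  refine volume_eq_zero_of_tangent (fun x =>
    det3 (g' (x 2)) (g (U x) - g (x 1)) (g' (U x)) • coord 2 +
    (-det3 (g' (x 1)) (g (U x) - g (x 1)) (g' (U x)) -
          det3 (g (x 2) - g (x 1)) (g' (x 1)) (g' (U x))) • coord 1) ?_ ?_
  · intro x hx h0
    obtain ⟨l, hl, hl'⟩ := hUl x hx
    have h1 := congrArg (fun T : E3 →L[ℝ] ℝ => T !₂[0, 0, 1]) h0
    have h1' : det3 (g' (x 2)) (g (U x) - g (x 1)) (g' (U x)) = 0 := by simpa using h1
    rw [hl'] at h1'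
    have h2 : l * det3 (g' (x 2)) (g' (U x)) (g (x 2) - g (x 1)) = 0 := by
      simp only [det3_eq, PiLp.smul_apply, smul_eq_mul] at h1' ⊢
      linear_combination (-1 : ℝ) * h1'
    rcases mul_eq_zero.mp h2 with h2 | h2
    exacts [hl h2, hUd x hx h2]
  · intro x hx c hc
    set A := det3 (g (x 2) - g (x 1)) (g' (U x)) (g' (x 2)) with hA
    have hA0 : A ≠ 0 := by
      intro h0
      apply hUd x hx
      rw [hA] at h0
      simp only [det3_eq] at h0 ⊢
      linear_combination (-1 : ℝ) * h0
    set B := -det3 (g' (x 1)) (g (U x) - g (x 1)) (g' (x 2)) -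
          det3 (g (x 2) - g (x 1)) (g' (x 1)) (g' (x 2)) with hB
    have hA1 : 0 < |A| := abs_pos.mpr hA0
    have hC : 0 ≤ (2 * |B| + |A|) / |A| := by positivity
    filter_upwards [hsmall x hx (g' (x 2)) (|A| / 2) (by positivity),
      hsmall x hx (g' (U x)) (c / (1 + (2 * |B| + |A|) / |A|)) (by positivity)] with y h1 h2
    have e1 : det3 (g' (x 2)) (g (U x) - g (x 1)) (g' (x 2)) = 0 := by
      simp only [det3_eq]; ring
    have e2 : det3 (g (x 2) - g (x 1)) (g' (U x)) (g' (U x)) = 0 := by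
      simp only [det3_eq]; ring
    rw [e1, ← hA, ← hB, mul_zero, zero_add] at h1
    rw [e2, mul_zero, add_zero] at h2
    have hc1 : |(y - x) 1| ≤ ‖y - x‖ := PiLp.norm_apply_le (y - x) 1
    have h3 : |U y - U x| ≤ (2 * |B| + |A|) / |A| * ‖y - x‖ := by
      rw [div_mul_eq_mul_div, le_div_iff₀ hA1]
      have k1 : |(U y - U x) * A| ≤ |(U y - U x) * A + (y - x) 1 * B| + |(y - x) 1 * B| := by
        have := abs_sub ((U y - U x) * A + (y - x) 1 * B) ((y - x) 1 * B)
        simpa using this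
      rw [abs_mul, abs_mul ((y - x) 1)] at k1
      have k2 : |(y - x) 1| * |B| ≤ ‖y - x‖ * |B| := by gcongr
      nlinarith
    have h4 : ‖y - x‖ + |U y - U x| ≤ (1 + (2 * |B| + |A|) / |A|) * ‖y - x‖ := by linarith
    simp only [add_apply, smul_apply, coord_apply,
      smul_eq_mul]
    rw [mul_comm _ ((y - x) 2), mul_comm _ ((y - x) 1)]
    refine h2.trans ?_
    calc _ ≤ c / (1 + (2 * |B| + |A|) / |A|) * ((1 + (2 * |B| + |A|) / |A|) * ‖y - x‖) := by gcongr
      _ = c * ‖y - x‖ := by field_simp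

/-- The directions of the transverse triple points of a curve form a null set. -/
theorem volume_triple {g' : ℝ → E3} {S : Set ℝ} (hg : Continuous g)
    (h : ∀ t ∈ S, HasDerivAt g (g' t) t) : MeasureTheory.volume
      {v : E3 | ∃ r : ℝ, ∃ s ∈ S, ∃ t ∈ S, ∃ u ∈ S, (∃ l : ℝ, l ≠ 0 ∧ g u - g s = l • (g t - g s)) ∧
        det3 (g' t) (g' u) (g t - g s) ≠ 0 ∧ v = r • (g t - g s)} = 0 := by
  have hnull : ∀ pq : ℚ × ℚ, MeasureTheory.volume ((fun x : E3 => x 0 • (g (x 2) - g (x 1))) ''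
      isolatedTriples g g' S pq.1 pq.2) = 0 := by
    intro pq
    refine MeasureTheory.addHaar_image_eq_zero_of_differentiableOn_of_addHaar_eq_zero _ ?_
      (volume_isolatedTriples hg h pq.1 pq.2)
    intro x hx
    exact ((hasFDerivAt_coord 0 x).smul ((hasFDerivAt_comp_coord 2 (h _ hx.2.1)).sub
      (hasFDerivAt_comp_coord 1 (h _ hx.1)))).differentiableAt.differentiableWithinAt
  refine MeasureTheory.measure_mono_null ?_ (MeasureTheory.measure_iUnion_null hnull)
  rintro v ⟨r, s, hs, t, ht, u, hu, ⟨l, hl, hl'⟩, hd, rfl⟩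
  -- Transversality makes this derivative nonzero, so u is the only solution in a small interval.
  -- Rational end points leave countably many sets of isolated triples to consider.
  have h1 : HasDerivAt (fun u' => det3 (g t - g s) (g u' - g s) (g' t))
      (det3 (g t - g s) (g' u) (g' t)) u := by
    have := (LinearMap.toContinuousLinearMap (det3Form (g' t) (g t - g s))).hasFDerivAt.comp_hasDerivAt u
      ((h u hu).sub_const (g s))
    exact this
  have h2 : det3 (g t - g s) (g' u) (g' t) ≠ 0 := by
    intro h0
    apply hd
    simp only [det3_eq] at h0 ⊢
    linear_combination (-1 : ℝ) * h0
  have h3 := h1.eventually_ne (c := 0) h2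
  obtain ⟨δ, hδ, hδ'⟩ := Metric.eventually_nhds_iff.mp (eventually_nhdsWithin_iff.mp h3)
  obtain ⟨p, hp1, hp2⟩ := exists_rat_btwn (show u - δ < u by linarith)
  obtain ⟨q, hq1, hq2⟩ := exists_rat_btwn (show u < u + δ by linarith)
  refine mem_iUnion.mpr ⟨(p, q), !₂[r, s, t], ⟨hs, ht, u, ⟨hp2.le, hq1.le⟩, hu, ⟨l, hl, hl'⟩, hd,
    ?_⟩, rfl⟩
  intro u' hu' hz
  by_contra hne
  refine hδ' (y := u') ?_ hne (hz _)
  rw [Real.dist_eq, abs_lt]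
  constructor <;> linarith [hu'.1, hu'.2]

end

/-- A union of lines through the origin which is a null set does not contain all directions of an
open set. -/
theorem exists_direction_notMem {U : Set S2} (hU : IsOpen U) (hne : U.Nonempty) {N : Set E3}
    (hN : MeasureTheory.volume N = 0) (hcone : ∀ v ∈ N, ∀ r : ℝ, r • v ∈ N) :
    ∃ ξ ∈ U, (ξ : E3) ∉ N := by
  obtain ⟨O, hO, rfl⟩ := isOpen_induced_iff.mp hU
  obtain ⟨η, hη⟩ := hne
  have hη1 : ‖(η : E3)‖ = 1 := norm_eq_of_mem_sphere η
  have hη0 : (η : E3) ≠ 0 := fun h => by rw [h, norm_zero] at hη1; exact zero_ne_one hη1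
  have hcont : ContinuousAt (fun v : E3 => ‖v‖⁻¹ • v) (η : E3) :=
    (continuousAt_id.norm.inv₀ (norm_ne_zero_iff.mpr hη0)).smul continuousAt_id
  have hmem : O ∈ 𝓝 (‖(η : E3)‖⁻¹ • (η : E3)) := by
    rw [hη1, inv_one, one_smul]; exact hO.mem_nhds hη
  have hV := (hcont.preimage_mem_nhds hmem)
  obtain ⟨v, ⟨hv, hv0⟩, hvN⟩ : ((fun v : E3 => ‖v‖⁻¹ • v) ⁻¹' O ∩ {0}ᶜ ∩ Nᶜ).Nonempty := by
    by_contra hemp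
    have hsub : (fun v : E3 => ‖v‖⁻¹ • v) ⁻¹' O ∩ {0}ᶜ ⊆ N := fun v hv => by
      by_contra hvN
      exact hemp ⟨v, hv, hvN⟩
    have hpos := MeasureTheory.Measure.measure_pos_of_mem_nhds MeasureTheory.volume
      (inter_mem hV (isOpen_compl_singleton.mem_nhds hη0))
    exact hpos.ne' (MeasureTheory.measure_mono_null hsub hN)
  have hvn : ‖v‖ ≠ 0 := norm_ne_zero_iff.mpr hv0
  refine ⟨⟨‖v‖⁻¹ • v, by simp [norm_smul, hvn]⟩, hv, fun h => hvN ?_⟩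
  have := hcone _ h ‖v‖
  rwa [smul_smul, mul_inv_cancel₀ hvn, one_smul] at this

theorem sub_eq_smul_of_projAlong_eq {ξ : S2} {x y : E3} (h : projAlong ξ x = projAlong ξ y)
    (hne : x ≠ y) : ∃ c : ℝ, c ≠ 0 ∧ x - y = c • (ξ : E3) := by
  refine ⟨inner ℝ (ξ : E3) x - inner ℝ (ξ : E3) y, ?_⟩
  rw [projAlong, projAlong, sub_eq_sub_iff_sub_eq_sub, ← sub_smul] at h
  refine ⟨fun h0 => hne ?_, h⟩
  rw [h0, zero_smul, sub_eq_zero] at h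
  exact h

/-! ### The degenerate directions and density of the regular ones. -/

namespace SimpleClosedCurve

variable (K : SimpleClosedCurve)

/-- The lines in the directions in which the diagram is degenerate, and those of the indicatrix. -/
def badCone : Set E3 :=
  {v | ∃ r : ℝ, ∃ t ∈ {t | ¬ K.IsCorner t}, v = r • deriv K.toFun t} ∪
  (⋃ k ∈ K.corners, {v | ∃ r s : ℝ, v = r • K.leftTangent k + s • K.rightTangent k}) ∪
  (⋃ k ∈ K.corners, {v | ∃ r : ℝ, ∃ t ∈ {t | ¬ K.IsCorner t}, v = r • (K.toFun t - K.toFun k)}) ∪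
  (⋃ k ∈ K.corners, ⋃ j ∈ K.corners,
    {v | ∃ r s : ℝ, v = r • (K.toFun j - K.toFun k) + s • (0 : E3)}) ∪
  {v | ∃ r : ℝ, ∃ s ∈ {t | ¬ K.IsCorner t}, ∃ t ∈ {t | ¬ K.IsCorner t},
      det3 (deriv K.toFun s) (deriv K.toFun t) (K.toFun s - K.toFun t) = 0 ∧
        v = r • (K.toFun s - K.toFun t)} ∪
  {v | ∃ r : ℝ, ∃ s ∈ {t | ¬ K.IsCorner t}, ∃ t ∈ {t | ¬ K.IsCorner t},
    ∃ u ∈ {t | ¬ K.IsCorner t},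
      (∃ l : ℝ, l ≠ 0 ∧ K.toFun u - K.toFun s = l • (K.toFun t - K.toFun s)) ∧
        det3 (deriv K.toFun t) (deriv K.toFun u) (K.toFun t - K.toFun s) ≠ 0 ∧
          v = r • (K.toFun t - K.toFun s)}

theorem smul_mem_badCone {v : E3} (hv : v ∈ K.badCone) (r : ℝ) : r • v ∈ K.badCone := by
  simp only [badCone, mem_union, mem_iUnion, mem_ofPred_eq, exists_prop] at hv ⊢
  rcases hv with ((((⟨r', t, ht, rfl⟩ | ⟨k, hk, r', s, rfl⟩) | ⟨k, hk, r', t, ht, rfl⟩) |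
    ⟨k, hk, j, hj, r', s, rfl⟩) | ⟨r', s, hs, t, ht, hd, rfl⟩) | ⟨r', s, hs, t, ht, u, hu, hl, hd, rfl⟩
  · exact .inl (.inl (.inl (.inl (.inl ⟨r * r', t, ht, by rw [smul_smul]⟩))))
  · exact .inl (.inl (.inl (.inl (.inr ⟨k, hk, r * r', r * s, by
      rw [smul_add, smul_smul, smul_smul]⟩))))
  · exact .inl (.inl (.inl (.inr ⟨k, hk, r * r', t, ht, by rw [smul_smul]⟩)))
  · exact .inl (.inl (.inr ⟨k, hk, j, hj, r * r', s, by simp [smul_smul]⟩))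
  · exact .inl (.inr ⟨r * r', s, hs, t, ht, hd, by rw [smul_smul]⟩)
  · exact .inr ⟨r * r', s, hs, t, ht, u, hu, hl, hd, by rw [smul_smul]⟩

variable {K} (hK : K.IsPiecewiseC2Knot)

include hK

theorem volume_badCone : MeasureTheory.volume K.badCone = 0 := by
  have hd : ∀ t ∈ {t | ¬ K.IsCorner t}, HasDerivAt K.toFun (deriv K.toFun t) t :=
    fun t ht => hasDerivAt hK ht
  refine MeasureTheory.measure_union_null (MeasureTheory.measure_union_null
    (MeasureTheory.measure_union_null (MeasureTheory.measure_union_null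
      (MeasureTheory.measure_union_null ?_ ?_) ?_) ?_) ?_) ?_
  · exact volume_cone fun t ht => (differentiableAt_deriv hK ht).hasDerivAt
  · exact (MeasureTheory.measure_biUnion_null_iff K.corners.countable_toSet).mpr
      fun k _ => volume_plane _ _
  · exact (MeasureTheory.measure_biUnion_null_iff K.corners.countable_toSet).mpr
      fun k _ => volume_cone (g := fun t => K.toFun t - K.toFun k)
        fun t ht => (hd t ht).sub_const (K.toFun k)
  · exact (MeasureTheory.measure_biUnion_null_iff K.corners.countable_toSet).mpr
      fun k _ => (MeasureTheory.measure_biUnion_null_iff K.corners.countable_toSet).mpr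
        fun j _ => volume_plane _ _
  · exact volume_tangential_chords hd
  · exact volume_triple K.continuous hd

theorem notMem_tangentIndicatrix_of_badCone {x : E3} (hx : x ∉ K.badCone) :
    x ∉ K.tangentIndicatrix := by
  intro h
  apply hx
  rw [mem_tangentIndicatrix hK] at h
  obtain ⟨t, ht⟩ := h
  by_cases hc : K.IsCorner t
  · rw [← leftTangent_fract hK, ← rightTangent_fract hK] at ht
    obtain ⟨-, a, b, -, -, rfl⟩ := ht
    exact .inl (.inl (.inl (.inl (.inr (mem_biUnion hc ⟨a, b, rfl⟩)))))
  · rw [leftTangent_eq hK hc, rightTangent_eq hK hc, greatArc_self (norm_unitTangent hK hc),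
      mem_singleton_iff] at ht
    exact .inl (.inl (.inl (.inl (.inl ⟨_, t, hc, ht⟩))))

/-- Every failure puts ξ on one of the lines of the cone: a double point with a corner gives a chord
ending at a corner, a tangential one a chord with vanishing determinant. A third point in a fibre
gives a collinear triple whose strands are transverse by the preceding case. -/
theorem regular_of_notMem_badCone {ξ : S2} (hξ : (ξ : E3) ∉ K.badCone) :
    ξ ∈ K.regularDirections ∧ ξ ∉ K.indicatrix := by
  have hchord : ∀ {s t : ℝ}, projAlong ξ (K.toFun s) = projAlong ξ (K.toFun t) →
      K.toFun s ≠ K.toFun t → ¬ K.IsCorner s := by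
    intro s t h hne hs
    obtain ⟨c, hc, he⟩ := sub_eq_smul_of_projAlong_eq h hne
    have he' : (ξ : E3) = (-c⁻¹) • (K.toFun t - K.toFun s) := by
      rw [neg_smul, ← smul_neg, neg_sub, he, smul_smul, inv_mul_cancel₀ hc, one_smul]
    apply hξ
    by_cases ht : K.IsCorner t
    · refine .inl (.inl (.inr (mem_biUnion hs (mem_biUnion ht ⟨-c⁻¹, 0, ?_⟩))))
      simp only [K.toFun_fract]
      rw [he', smul_zero, add_zero]
    · refine .inl (.inl (.inl (.inr (mem_biUnion hs ⟨-c⁻¹, t, ht, ?_⟩))))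
      rw [K.toFun_fract]
      exact he'
  have htr : ∀ {s t : ℝ}, projAlong ξ (K.toFun s) = projAlong ξ (K.toFun t) →
      K.toFun s ≠ K.toFun t → det3 (deriv K.toFun s) (deriv K.toFun t) (ξ : E3) ≠ 0 := by
    intro s t h hne h0
    obtain ⟨c, hc, he⟩ := sub_eq_smul_of_projAlong_eq h hne
    apply hξ
    refine .inl (.inr ⟨c⁻¹, s, hchord h hne, t, hchord h.symm hne.symm, ?_, ?_⟩)
    · rw [he]
      simp only [det3_eq, PiLp.smul_apply, smul_eq_mul] at h0 ⊢
      linear_combination c * h0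
    · rw [he, smul_smul, inv_mul_cancel₀ hc, one_smul]
  refine ⟨⟨fun v => ?_, fun p hp => ?_⟩, ?_⟩
  · rcases (K.fibre ξ v).eq_empty_or_nonempty with h0 | ⟨x, hx⟩
    · exact .inl h0
    by_cases hone : ∀ y ∈ K.fibre ξ v, y = x
    · exact .inr (.inl ⟨x, eq_singleton_iff_unique_mem.mpr ⟨hx, hone⟩⟩)
    push Not at hone
    obtain ⟨y, hy, hyx⟩ := hone
    obtain ⟨⟨s, hs, rfl⟩, hxv⟩ := hx
    obtain ⟨⟨t, ht, rfl⟩, hyv⟩ := hy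
    have hvert : ∀ {s t : ℝ}, s ∈ Ico (0 : ℝ) 1 →
        projAlong ξ (K.toFun s) = projAlong ξ (K.toFun t) → K.toFun s ≠ K.toFun t →
        K.toFun s ∉ K.vertices := by
      rintro s t hs h hne ⟨k, hk, hke⟩
      have := K.injective (K.corners_subset hk) hs hke
      apply hchord h hne
      rw [IsCorner, Int.fract_eq_self.mpr hs, ← this]
      exact hk
    refine .inr (.inr ⟨K.toFun s, K.toFun t, hyx.symm, hvert hs (hxv.trans hyv.symm) hyx.symm,
      hvert ht (hyv.trans hxv.symm) hyx, ?_⟩)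
    refine Subset.antisymm ?_ ?_
    · rintro z ⟨⟨u, hu, rfl⟩, hzv⟩
      by_contra hz
      simp only [mem_insert_iff, mem_singleton_iff, not_or] at hz
      obtain ⟨c, hc, he⟩ := sub_eq_smul_of_projAlong_eq (hyv.trans hxv.symm) hyx
      obtain ⟨c', hc', he'⟩ := sub_eq_smul_of_projAlong_eq (hzv.trans hxv.symm) hz.1
      apply hξ
      refine .inr ⟨c⁻¹, s, hchord (hxv.trans hyv.symm) hyx.symm, t,
        hchord (hyv.trans hxv.symm) hyx, u, hchord (hzv.trans hxv.symm) hz.1,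
        ⟨c' / c, div_ne_zero hc' hc, ?_⟩, ?_, ?_⟩
      · rw [he, he', smul_smul, div_mul_cancel₀ _ hc]
      · intro h0
        apply htr (hyv.trans hzv.symm) (Ne.symm hz.2)
        rw [he] at h0
        have h1 : c * det3 (deriv K.toFun t) (deriv K.toFun u) (ξ : E3) = 0 := by
          simp only [det3_eq, PiLp.smul_apply, smul_eq_mul] at h0 ⊢
          linear_combination h0
        exact (mul_eq_zero.mp h1).resolve_left hc
      · rw [he, smul_smul, inv_mul_cancel₀ hc, one_smul]
    · rintro z (rfl | rfl)
      exacts [⟨mem_carrier s, hxv⟩, ⟨mem_carrier t, hyv⟩]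
  · obtain ⟨-, -, h1, h2⟩ := mem_doublePoints.mp hp
    exact htr (projAlong_eq_iff.mpr ⟨h1, h2⟩).1 h2
  · rw [indicatrix, mem_ofPred_eq, not_or]
    refine ⟨notMem_tangentIndicatrix_of_badCone hK hξ,
      notMem_tangentIndicatrix_of_badCone hK fun h => hξ ?_⟩
    simpa using K.smul_mem_badCone h (-1)

/-- The regular directions off the indicatrix are dense. -/
theorem exists_regular {U : Set S2} (hU : IsOpen U) (hne : U.Nonempty) :
    ∃ ξ ∈ U, ξ ∈ K.regularDirections ∧ ξ ∉ K.indicatrix := by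
  obtain ⟨ξ, hξU, hξ⟩ := exists_direction_notMem hU hne (volume_badCone hK)
    (fun v hv r => K.smul_mem_badCone hv r)
  exact ⟨ξ, hξU, regular_of_notMem_badCone hK hξ⟩

end SimpleClosedCurve

/-! ### The Tait number on the complement of the indicatrix. -/

instance locallyPathConnectedSpace_S2 : LocallyPathConnectedSpace S2 := by
  have : Fact (Module.finrank ℝ E3 = 2 + 1) := ⟨by simp⟩
  exact ChartedSpace.locallyPathConnectedSpace (EuclideanSpace ℝ (Fin 2)) S2

namespace SimpleClosedCurve

variable {K : SimpleClosedCurve}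

theorem norm_pathMap {ξ ξ' : S2} (c : Path ξ ξ') (s : ℝ) : ‖pathMap c s‖ = 1 :=
  norm_eq_of_mem_sphere _

theorem continuous_pathMap {ξ ξ' : S2} (c : Path ξ ξ') : Continuous (pathMap c) :=
  continuous_subtype_val.comp c.continuous_extend

theorem pathMap_zero {ξ ξ' : S2} (c : Path ξ ξ') : pathMap c 0 = ξ := by
  rw [pathMap, c.extend_zero]

theorem pathMap_one {ξ ξ' : S2} (c : Path ξ ξ') : pathMap c 1 = ξ' := by
  rw [pathMap, c.extend_one]

theorem mem_tangentIndicatrix_of_mem_tangentPiece {x : E3} {t : ℝ} (ht : t ∈ Ico (0 : ℝ) 1)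
    (h : x ∈ K.tangentPiece t) : x ∈ K.tangentIndicatrix := mem_biUnion ht h

theorem transverseCurve_of_disjoint {c : ℝ → E3} {α β : ℝ} (h : α < β)
    (hc : ContinuousOn c (Icc α β)) (h1 : ∀ τ ∈ Icc α β, ‖c τ‖ = 1)
    (hd : ∀ τ ∈ Icc α β, c τ ∉ K.tangentIndicatrix) :
    K.TransverseCurve c α β ∧ K.curveCount c α β = 0 := by
  have he : K.curveMeets c α β = ∅ := eq_empty_of_forall_notMem fun p hp =>
    hd p.1 hp.1 (mem_tangentIndicatrix_of_mem_tangentPiece hp.2.1 hp.2.2)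
  refine ⟨⟨h, hc, h1, hd _ (left_mem_Icc.mpr h.le), hd _ (right_mem_Icc.mpr h.le), ?_, ?_⟩, ?_⟩
  · rw [he]; exact finite_empty
  · rw [he]; exact fun p hp => hp.elim
  · rw [curveCount, he, finsum_mem_empty]

variable (hK : K.IsPiecewiseC2Knot)

include hK

/-- A path inside U meets neither Γ nor -Γ and misses the pole, so the limit in
`tendsto_boundaryLog_sub` has no crossings. -/
theorem tendsto_boundaryLog_sub_zero (f : PosFrame) {q : S2} (hf : f.q = q)
    (hq : q ∉ K.indicatrix) {U : Set S2} (hU : IsPathConnected U)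
    (hUI : ∀ η ∈ U, η ∉ K.indicatrix ∧ η ≠ q) {η η' : S2} (hη : η ∈ U) (hη' : η' ∈ U) :
    Tendsto (fun ε => K.boundaryLog f (f.stereo η) ε - K.boundaryLog f (f.stereo η') ε)
      (𝓝[>] 0) (𝓝 0) := by
  obtain ⟨c, hc⟩ := hU.joinedIn η hη η' hη'
  have hcU : ∀ τ, c.extend τ ∈ U := by
    intro τ
    have hm : c.extend τ ∈ range c := c.extend_range ▸ mem_range_self τ
    obtain ⟨s, hs⟩ := hm
    rw [← hs]; exact hc s
  simp only [indicatrix, mem_ofPred_eq, not_or] at hUI hq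
  obtain ⟨h1, h1'⟩ := transverseCurve_of_disjoint (K := K) (c := pathMap c) zero_lt_one
    (continuous_pathMap c).continuousOn (fun τ _ => norm_pathMap c τ)
    (fun τ _ => (hUI _ (hcU τ)).1.1)
  obtain ⟨h2, h2'⟩ := transverseCurve_of_disjoint (K := K) (c := fun τ => -pathMap c τ) zero_lt_one
    (continuous_pathMap c).neg.continuousOn (fun τ _ => by rw [norm_neg]; exact norm_pathMap c τ)
    (fun τ _ => (hUI _ (hcU τ)).1.2)
  have h3 := tendsto_boundaryLog_sub hK h1 h2 f (hf ▸ hq.1) (hf ▸ hq.2)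
    (fun τ _ h => (hUI _ (hcU τ)).2 (Subtype.ext (h.trans hf)))
  rw [h1', h2', pathMap_zero, pathMap_one] at h3
  simpa using h3

/-- By `boundaryLog_eq` the difference of the boundary terms is eventually the constant 2πi (T(η') -
T(η)); the pole drops out, and the limit is zero. -/
theorem tait_eq_of_isPathConnected {q : S2} (hqr : q ∈ K.regularDirections)
    (hq : q ∉ K.indicatrix) {U : Set S2} (hU : IsPathConnected U)
    (hUI : ∀ η ∈ U, η ∉ K.indicatrix ∧ η ≠ q) {η η' : S2} (hη : η ∈ U) (hη' : η' ∈ U)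
    (hηr : η ∈ K.regularDirections) (hηr' : η' ∈ K.regularDirections) : K.tait η = K.tait η' := by
  obtain ⟨f, hf⟩ := PosFrame.exists_frame (norm_eq_of_mem_sphere q)
  have h := tendsto_boundaryLog_sub_zero hK f hf hq hU hUI hη hη'
  have h2 : Tendsto (fun _ : ℝ => 2 * Real.pi * Complex.I * ((K.tait η' - K.tait η : ℤ) : ℂ))
      (𝓝[>] 0) (𝓝 0) := by
    refine h.congr' ?_
    filter_upwards [boundaryLog_eq hK f hf (hUI η hη).2 hηr hqr (hUI η hη).1 hq,
      boundaryLog_eq hK f hf (hUI η' hη').2 hηr' hqr (hUI η' hη').1 hq] with ε h1 h2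
    rw [h1, h2]
    push_cast; ring
  have h3 := tendsto_nhds_unique h2 tendsto_const_nhds
  have h4 : ((K.tait η' - K.tait η : ℤ) : ℂ) = 0 :=
    (mul_eq_zero.mp h3.symm).resolve_left Complex.two_pi_I_ne_zero
  have h5 : K.tait η' - K.tait η = 0 := by exact_mod_cast h4
  omega

theorem exists_regular_ne {ξ : S2} {U : Set S2} (hU : U ∈ 𝓝 ξ) : ∃ q ∈ U, q ≠ ξ ∧
    q ∈ K.regularDirections ∧ q ∉ K.indicatrix := by
  obtain ⟨q, hqU, hq⟩ := exists_direction_notMem isOpen_interior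
    ⟨ξ, mem_interior_iff_mem_nhds.mpr hU⟩
    -- The line of ξ, as a degenerate plane, is added to the null set to keep q away from ξ.
    (MeasureTheory.measure_union_null (volume_badCone hK) (volume_plane (ξ : E3) 0))
    (by
      rintro v (hv | ⟨r', s', rfl⟩) r
      · exact .inl (K.smul_mem_badCone hv r)
      · exact .inr ⟨r * r', s', by simp [smul_smul]⟩)
  exact ⟨q, interior_subset hqU, fun h => hq (.inr ⟨1, 0, by simp [h]⟩),
    regular_of_notMem_badCone hK fun h => hq (.inl h)⟩

/-- A pole and a neighbourhood which are suitable for the comparison of two-ray maps. -/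
theorem exists_pole {ξ : S2} (hξ : ξ ∉ K.indicatrix) {V : Set S2} (hV : V ∈ 𝓝 ξ) :
    ∃ q ∈ K.regularDirections, q ∉ K.indicatrix ∧ q ≠ ξ ∧ ∃ U ∈ 𝓝 ξ, U ⊆ V ∧ IsPathConnected U ∧
      ∀ η ∈ U, η ∉ K.indicatrix ∧ η ≠ q := by
  obtain ⟨q, -, hqξ, hqr, hq⟩ := exists_regular_ne hK (univ_mem (f := 𝓝 ξ))
  have hW : V ∩ (K.indicatrixᶜ ∩ {q}ᶜ) ∈ 𝓝 ξ := inter_mem hV (inter_mem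
    ((isClosed_indicatrix hK).isOpen_compl.mem_nhds hξ) (isOpen_compl_singleton.mem_nhds hqξ.symm))
  obtain ⟨U, ⟨hU, hUp⟩, hUW⟩ := (path_connected_basis ξ).mem_iff.mp hW
  exact ⟨q, hqr, hq, hqξ, U, hU, fun η hη => (hUW hη).1, hUp, fun η hη => (hUW hη).2⟩

omit hK

variable (K) in
/-- The Tait number of the regular directions near `ξ`. -/
def localTait (ξ : S2) : ℤ :=
  open Classical in
  if h : ∃ n : ℤ, ∀ᶠ η in 𝓝 ξ, η ∈ K.regularDirections → K.tait η = n then h.choose else 0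

include hK

theorem eventually_tait_eq {ξ : S2} (hξ : ξ ∉ K.indicatrix) :
    ∀ᶠ η in 𝓝 ξ, η ∈ K.regularDirections → K.tait η = K.localTait ξ := by
  have h : ∃ n : ℤ, ∀ᶠ η in 𝓝 ξ, η ∈ K.regularDirections → K.tait η = n := by
    obtain ⟨q, hqr, hq, -, U, hU, -, hUp, hUI⟩ := exists_pole hK hξ univ_mem
    obtain ⟨η₀, hη₀, hη₀r, -⟩ := exists_regular hK isOpen_interior
      ⟨ξ, mem_interior_iff_mem_nhds.mpr hU⟩
    refine ⟨K.tait η₀, ?_⟩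
    filter_upwards [hU] with η hη hηr
    exact tait_eq_of_isPathConnected hK hqr hq hUp hUI hη (interior_subset hη₀) hηr hη₀r
  rw [localTait, dif_pos h]
  exact h.choose_spec

theorem localTait_eq_tait {η : S2} (hη : η ∉ K.indicatrix) (hηr : η ∈ K.regularDirections) :
    K.localTait η = K.tait η := ((eventually_tait_eq hK hη).self_of_nhds hηr).symm

/-- The values at ξ and at a nearby η are both read off at a regular direction close to η. -/
theorem eventually_localTait_eq {ξ : S2} (hξ : ξ ∉ K.indicatrix) :
    ∀ᶠ η in 𝓝 ξ, K.localTait η = K.localTait ξ := by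
  filter_upwards [eventually_eventually_nhds.mpr (eventually_tait_eq hK hξ),
    (isClosed_indicatrix hK).isOpen_compl.mem_nhds hξ] with η h1 h2
  obtain ⟨U, hUs, hU, hηU⟩ := eventually_nhds_iff.mp (h1.and (eventually_tait_eq hK h2))
  obtain ⟨η₀, hη₀, hη₀r, -⟩ := exists_regular hK hU ⟨η, hηU⟩
  rw [← (hUs η₀ hη₀).1 hη₀r, ← (hUs η₀ hη₀).2 hη₀r]

theorem localTait_eq_of_mem_connectedComponentIn {ξ η : S2}
    (h : η ∈ connectedComponentIn K.indicatrixᶜ ξ) : K.localTait η = K.localTait ξ := by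
  have hξ : ξ ∈ K.indicatrixᶜ := by
    by_contra hn
    rw [connectedComponentIn_eq_empty hn] at h
    exact h
  refine (isPreconnected_connectedComponentIn (F := K.indicatrixᶜ) (x := ξ)).constant
    (f := K.localTait) ?_ h (mem_connectedComponentIn hξ)
  intro x hx
  refine ContinuousAt.continuousWithinAt ?_
  exact (continuousAt_const (y := K.localTait x)).congr
    ((eventually_localTait_eq hK (connectedComponentIn_subset _ _ hx)).mono fun _ h => h.symm)

theorem exists_regular_mem_connectedComponentIn {ξ : S2} (hξ : ξ ∉ K.indicatrix) :
    ∃ η ∈ K.regularDirections, η ∈ connectedComponentIn K.indicatrixᶜ ξ := by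
  obtain ⟨η, h1, h2, -⟩ := exists_regular hK
    ((isClosed_indicatrix hK).isOpen_compl.connectedComponentIn (x := ξ))
    ⟨ξ, mem_connectedComponentIn hξ⟩
  exact ⟨η, h2, h1⟩

/-- `taitExt` chooses an arbitrary direction of O in the component; being locally constant,
`localTait` takes the same value at ξ and at that direction. -/
theorem taitExt_eq_localTait {O : Set S2} (hO : ∀ η, η ∉ K.indicatrix → η ∈ O →
    η ∈ K.regularDirections) (hO' : K.regularDirections ⊆ O) {ξ : S2} (hξ : ξ ∉ K.indicatrix) :
    K.taitExt O ξ = K.localTait ξ := by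
  have h : ∃ η ∈ O, η ∈ connectedComponentIn K.indicatrixᶜ ξ := by
    obtain ⟨η, h1, h2⟩ := exists_regular_mem_connectedComponentIn hK hξ
    exact ⟨η, hO' h1, h2⟩
  rw [taitExt, dif_pos h]
  obtain ⟨h1, h2⟩ := h.choose_spec
  have h3 := connectedComponentIn_subset _ _ h2
  rw [← localTait_eq_of_mem_connectedComponentIn hK h2, localTait_eq_tait hK h3 (hO _ h3 h1)]

/-- The exact value `boundaryLog_eq` requires regular ξ. Any other ξ off the indicatrix is compared
with a regular η in a path connected neighbourhood, and the identity survives as a limit. -/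
theorem tendsto_boundaryLog (f : PosFrame) {ξ q : S2} (hf : f.q = q) (hξq : ξ ≠ q)
    (hqr : q ∈ K.regularDirections) (hq : q ∉ K.indicatrix) (hξ : ξ ∉ K.indicatrix) :
    Tendsto (fun ε => K.boundaryLog f (f.stereo ξ) ε) (𝓝[>] 0)
      (𝓝 (2 * Real.pi * Complex.I * ((K.tait q - K.localTait ξ : ℤ) : ℂ))) := by
  have hW : K.indicatrixᶜ ∩ {q}ᶜ ∈ 𝓝 ξ := inter_mem
    ((isClosed_indicatrix hK).isOpen_compl.mem_nhds hξ) (isOpen_compl_singleton.mem_nhds hξq)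
  obtain ⟨U, ⟨hU, hUp⟩, hUW⟩ := (path_connected_basis ξ).mem_iff.mp
    (inter_mem hW (eventually_tait_eq hK hξ))
  obtain ⟨η, hη, hηr, hηI⟩ := exists_regular hK isOpen_interior
    ⟨ξ, mem_interior_iff_mem_nhds.mpr hU⟩
  have hηU := interior_subset hη
  have h1 := tendsto_boundaryLog_sub_zero hK f hf hq hUp (fun x hx => (hUW hx).1) (mem_of_mem_nhds hU)
    hηU
  have h2 : Tendsto (fun ε => K.boundaryLog f (f.stereo η) ε) (𝓝[>] 0)
      (𝓝 (2 * Real.pi * Complex.I * ((K.tait q - K.tait η : ℤ) : ℂ))) :=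
    tendsto_const_nhds.congr' ((boundaryLog_eq hK f hf (hUW hηU).1.2 hηr hqr hηI hq).mono
      fun _ h => h.symm)
  have h3 := h1.add h2
  rw [(hUW hηU).2 hηr, zero_add] at h3
  simpa using h3

end SimpleClosedCurve

/-! ### The variation formula for transverse paths. -/

namespace SimpleClosedCurve

variable {K : SimpleClosedCurve}

theorem mem_indicatrix {x : S2} :
    x ∈ K.indicatrix ↔ (x : E3) ∈ K.tangentIndicatrix ∨ -(x : E3) ∈ K.tangentIndicatrix := Iff.rfl

theorem curveMeets_mono {c : ℝ → E3} {α β α' β' : ℝ} (hα : α ≤ α') (hβ : β' ≤ β) :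
    K.curveMeets c α' β' ⊆ K.curveMeets c α β :=
  fun _ hp => ⟨⟨hα.trans hp.1.1, hp.1.2.trans hβ⟩, hp.2⟩

theorem TransverseCurve.mono {c : ℝ → E3} {α β α' β' : ℝ} (hc : ContinuousOn c (Icc α β))
    (h1 : ∀ τ ∈ Icc α β, ‖c τ‖ = 1) (hfin : (K.curveMeets c α β).Finite)
    (htr : ∀ p ∈ K.curveMeets c α β, DifferentiableAt ℝ c p.1 ∧ K.meetDet c p ≠ 0 ∧
      (p.2 ∈ K.corners → c p.1 ≠ K.leftTangent p.2 ∧ c p.1 ≠ K.rightTangent p.2))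
    (hα : α ≤ α') (hβ : β' ≤ β) (h : α' < β') (hα' : c α' ∉ K.tangentIndicatrix)
    (hβ' : c β' ∉ K.tangentIndicatrix) : K.TransverseCurve c α' β' :=
  ⟨h, hc.mono (Icc_subset_Icc hα hβ), fun τ hτ => h1 τ (Icc_subset_Icc hα hβ hτ), hα', hβ',
    hfin.subset (curveMeets_mono hα hβ), fun p hp => htr p (curveMeets_mono hα hβ hp)⟩

theorem curveCount_add {c : ℝ → E3} {α β γ : ℝ} (hαβ : α ≤ β) (hβγ : β ≤ γ)
    (hfin : (K.curveMeets c α γ).Finite) (hβ : c β ∉ K.tangentIndicatrix) :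
    K.curveCount c α β + K.curveCount c β γ = K.curveCount c α γ := by
  have hU : K.curveMeets c α γ = K.curveMeets c α β ∪ K.curveMeets c β γ := by
    refine Subset.antisymm ?_ (union_subset (curveMeets_mono le_rfl hβγ)
      (curveMeets_mono hαβ le_rfl))
    rintro p ⟨h1, h2⟩
    rcases le_total p.1 β with h | h
    exacts [.inl ⟨⟨h1.1, h⟩, h2⟩, .inr ⟨⟨h, h1.2⟩, h2⟩]
  have hd : Disjoint (K.curveMeets c α β) (K.curveMeets c β γ) := by
    rw [Set.disjoint_left]
    rintro p ⟨h1, h2, h3⟩ ⟨h1', -, -⟩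
    have e : p.1 = β := le_antisymm h1.2 h1'.1
    exact hβ (mem_tangentIndicatrix_of_mem_tangentPiece h2 (e ▸ h3))
  rw [curveCount, curveCount, curveCount, hU, finsum_mem_union hd
    (hfin.subset (curveMeets_mono le_rfl hβγ)) (hfin.subset (curveMeets_mono hαβ le_rfl))]

theorem meetDet_neg (c : ℝ → E3) (p : ℝ × ℝ) : K.meetDet (fun τ => -c τ) p = K.meetDet c p := by
  rw [meetDet, meetDet, deriv.fun_neg]
  simp only [det3_eq, PiLp.neg_apply]
  ring

theorem signedCrossings_eq {ξ ξ' : S2} (c : Path ξ ξ') : K.signedCrossings c =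
    K.curveCount (pathMap c) 0 1 + K.curveCount (fun τ => -pathMap c τ) 0 1 := by
  simp only [signedCrossings, curveCount, meetDet_neg]
  rfl

variable (hK : K.IsPiecewiseC2Knot)

include hK

/-- One limit computed twice: by crossings in `tendsto_boundaryLog_sub` and by Tait numbers in
`tendsto_boundaryLog`. The Tait number of the pole cancels. -/
theorem localTait_eq_add_of_pole {ξ ξ' : S2} {c : Path ξ ξ'} {α β : ℝ}
    (hc : K.TransverseCurve (pathMap c) α β) (hc' : K.TransverseCurve (fun τ => -pathMap c τ) α β)
    {q : S2} (hqr : q ∈ K.regularDirections) (hq : q ∉ K.indicatrix)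
    (hcq : ∀ τ ∈ Icc α β, c.extend τ ≠ q) :
    K.localTait (c.extend α) = K.localTait (c.extend β) +
      (K.curveCount (pathMap c) α β + K.curveCount (fun τ => -pathMap c τ) α β) := by
  obtain ⟨f, hf⟩ := PosFrame.exists_frame (norm_eq_of_mem_sphere q)
  have h1 := tendsto_boundaryLog_sub hK hc hc' f (hf ▸ fun h => hq (.inl h))
    (hf ▸ fun h => hq (.inr h)) (fun τ hτ h => hcq τ hτ (Subtype.ext (h.trans hf)))
  have hα : c.extend α ∉ K.indicatrix := by
    rw [mem_indicatrix, not_or]; exact ⟨hc.left_notMem, hc'.left_notMem⟩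
  have hβ : c.extend β ∉ K.indicatrix := by
    rw [mem_indicatrix, not_or]; exact ⟨hc.right_notMem, hc'.right_notMem⟩
  have h2 := (tendsto_boundaryLog hK f hf (hcq α (left_mem_Icc.mpr hc.lt.le)) hqr hq hα).sub
    (tendsto_boundaryLog hK f hf (hcq β (right_mem_Icc.mpr hc.lt.le)) hqr hq hβ)
  have h3 := tendsto_nhds_unique h1 h2
  have h4 : 2 * Real.pi * Complex.I * ((K.localTait (c.extend α) - K.localTait (c.extend β) -
      (K.curveCount (pathMap c) α β + K.curveCount (fun τ => -pathMap c τ) α β) : ℤ) : ℂ) = 0 := by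
    push_cast at h3 ⊢
    linear_combination h3
  have h5 := (mul_eq_zero.mp h4).resolve_left Complex.two_pi_I_ne_zero
  have h6 : K.localTait (c.extend α) - K.localTait (c.extend β) -
      (K.curveCount (pathMap c) α β + K.curveCount (fun τ => -pathMap c τ) α β) = 0 := by
    exact_mod_cast h5
  linarith

/-- The variation formula for transverse paths. -/
theorem localTait_eq_add_signedCrossings {ξ ξ' : S2} (hξ : ξ ∉ K.indicatrix)
    (hξ' : ξ' ∉ K.indicatrix) {c : Path ξ ξ'} (hc : K.IsTransversePath c) :
    K.localTait ξ = K.localTait ξ' + K.signedCrossings c := by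
  obtain ⟨hfin, hfin', htr⟩ := hc
  have hcont := continuous_pathMap c
  have htr₁ : ∀ p ∈ K.curveMeets (pathMap c) 0 1, DifferentiableAt ℝ (pathMap c) p.1 ∧
      K.meetDet (pathMap c) p ≠ 0 ∧ (p.2 ∈ K.corners →
        pathMap c p.1 ≠ K.leftTangent p.2 ∧ pathMap c p.1 ≠ K.rightTangent p.2) := by
    intro p hp
    obtain ⟨h1, h2, h3⟩ := htr p (.inl hp)
    exact ⟨h1, h2, fun h => ⟨(h3 h).1, (h3 h).2.1⟩⟩
  have htr₂ : ∀ p ∈ K.curveMeets (fun τ => -pathMap c τ) 0 1,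
      DifferentiableAt ℝ (fun τ => -pathMap c τ) p.1 ∧
      K.meetDet (fun τ => -pathMap c τ) p ≠ 0 ∧ (p.2 ∈ K.corners →
        -pathMap c p.1 ≠ K.leftTangent p.2 ∧ -pathMap c p.1 ≠ K.rightTangent p.2) := by
    intro p hp
    obtain ⟨h1, h2, h3⟩ := htr p (.inr hp)
    refine ⟨h1.fun_neg, by rw [meetDet_neg]; exact h2, fun h => ⟨fun h' => (h3 h).2.2.1 ?_,
      fun h' => (h3 h).2.2.2 ?_⟩⟩
    · rw [← h', neg_neg]
    · rw [← h', neg_neg]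
  have hT : ∀ {α β : ℝ}, 0 ≤ α → β ≤ 1 → α < β → c.extend α ∉ K.indicatrix →
      c.extend β ∉ K.indicatrix → K.TransverseCurve (pathMap c) α β ∧
        K.TransverseCurve (fun τ => -pathMap c τ) α β := by
    intro α β h0 h1 h hα hβ
    rw [mem_indicatrix, not_or] at hα hβ
    exact ⟨TransverseCurve.mono hcont.continuousOn (fun τ _ => norm_pathMap c τ) hfin htr₁ h0 h1 h
      hα.1 hβ.1, TransverseCurve.mono hcont.neg.continuousOn
        (fun τ _ => by rw [norm_neg]; exact norm_pathMap c τ) hfin' htr₂ h0 h1 h hα.2 hβ.2⟩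
  rw [signedCrossings_eq]
  -- The pole is chosen locally: close to τ the path stays away from some regular q ≠ c τ. The
  -- pieces are joined at parameters where the path is off the indicatrix.
  have key := rel_of_local (G := {τ | c.extend τ ∉ K.indicatrix}) (A := 0) (B := 1)
    (P := fun α β => K.localTait (c.extend α) = K.localTait (c.extend β) +
      (K.curveCount (pathMap c) α β + K.curveCount (fun τ => -pathMap c τ) α β))
    zero_lt_one (by simpa using hξ) (by simpa using hξ') ?_ ?_ ?_
  · simpa using key
  · intro x y hx hy hxy
    obtain ⟨z, hz, hz'⟩ := (Ioo_infinite hxy).exists_notMem_finite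
      ((hfin.image Prod.fst).union (hfin'.image Prod.fst))
    refine ⟨z, fun hzI => hz' ?_, hz.1, hz.2⟩
    have hzm : z ∈ Icc (0 : ℝ) 1 := ⟨hx.trans hz.1.le, hz.2.le.trans hy⟩
    rcases hzI with h | h
    · obtain ⟨t, ht, h⟩ := mem_iUnion₂.mp h
      exact .inl ⟨(z, t), ⟨hzm, ht, h⟩, rfl⟩
    · obtain ⟨t, ht, h⟩ := mem_iUnion₂.mp h
      exact .inr ⟨(z, t), ⟨hzm, ht, h⟩, rfl⟩
  · intro α β γ hαβ hβγ _ hβ _ h0 h1 e1 e2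
    rw [mem_ofPred_eq, mem_indicatrix, not_or] at hβ
    rw [← curveCount_add hαβ.le hβγ.le (hfin.subset (curveMeets_mono h0 h1)) hβ.1,
      ← curveCount_add hαβ.le hβγ.le (hfin'.subset (curveMeets_mono h0 h1)) hβ.2, e1, e2]
    ring
  · intro τ _
    obtain ⟨q, -, hqτ, hqr, hq⟩ := exists_regular_ne hK (univ_mem (f := 𝓝 (c.extend τ)))
    obtain ⟨δ, hδ, hδ'⟩ := Metric.eventually_nhds_iff.mp
      (c.continuous_extend.continuousAt.eventually_ne hqτ.symm)
    refine ⟨δ, hδ, fun α hα β hβ h0 h1 h2 h3 h4 h5 h6 => ?_⟩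
    obtain ⟨t1, t2⟩ := hT h0 h1 h6 hα hβ
    refine localTait_eq_add_of_pole hK t1 t2 hqr hq fun σ hσ => hδ' ?_
    rw [Real.dist_eq, abs_lt]
    constructor <;> linarith [hσ.1, hσ.2]

end SimpleClosedCurve

/-! ### Paths on the sphere -/

/-- The point of the sphere in the direction of a nonzero vector. -/
def toSphere (v : {v : E3 // v ≠ 0}) : S2 :=
  ⟨‖(v : E3)‖⁻¹ • (v : E3), by simp [norm_smul, v.2]⟩

theorem continuous_toSphere : Continuous toSphere :=
  Continuous.subtype_mk ((continuous_subtype_val.norm.inv₀ fun v => norm_ne_zero_iff.mpr v.2).smul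
    continuous_subtype_val) _

/-- The straight homotopy in space avoids the origin, since the segment between unit vectors that
are not opposite does, and it can be projected radially. -/
theorem homotopic_of_ne_neg {ξ ξ' : S2} {c c' : Path ξ ξ'} (h : ∀ s, (c' s : E3) ≠ -(c s : E3)) :
    c.Homotopic c' := by
  have hne : ∀ p : unitInterval × unitInterval,
      (1 - (p.1 : ℝ)) • (c p.2 : E3) + (p.1 : ℝ) • (c' p.2 : E3) ≠ 0 := by
    intro p h0
    refine zero_notMem_segment (norm_eq_of_mem_sphere (c p.2)) (norm_eq_of_mem_sphere (c' p.2))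
      (h p.2) ?_
    exact ⟨1 - p.1, p.1, by linarith [p.1.2.2], p.1.2.1, by ring, h0⟩
  have hcont : Continuous fun p : unitInterval × unitInterval =>
      (1 - (p.1 : ℝ)) • (c p.2 : E3) + (p.1 : ℝ) • (c' p.2 : E3) := by fun_prop
  refine ⟨⟨⟨⟨fun p => toSphere ⟨_, hne p⟩, continuous_toSphere.comp (hcont.subtype_mk _)⟩,
    fun s => ?_, fun s => ?_⟩, ?_⟩⟩
  · apply Subtype.ext
    simp [toSphere]
  · apply Subtype.ext
    simp [toSphere]
  · rintro t s (rfl | rfl)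
    all_goals
      apply Subtype.ext
      simp [toSphere, ← add_smul]

/-- Both paths lie in the stereographic chart from q, where the straight homotopy is available. -/
theorem homotopic_of_ne {ξ ξ' q : S2} {c c' : Path ξ ξ'} (h : ∀ s, c s ≠ q) (h' : ∀ s, c' s ≠ q) :
    c.Homotopic c' := by
  have hq : ‖(q : E3)‖ = 1 := norm_eq_of_mem_sphere q
  set e := stereographic hq with he
  have hs : ∀ x : S2, x ≠ q → x ∈ e.source := by
    intro x hx
    rw [he, stereographic_source]
    exact fun h => hx (by rw [h])
  have hc : Continuous fun s => e (c s) :=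
    e.continuousOn.comp_continuous c.continuous fun s => hs _ (h s)
  have hc' : Continuous fun s => e (c' s) :=
    e.continuousOn.comp_continuous c'.continuous fun s => hs _ (h' s)
  have hsymm : Continuous e.symm := (isOpenEmbedding_stereographic_symm hq).continuous
  refine ⟨⟨⟨⟨fun p => e.symm ((1 - (p.1 : ℝ)) • e (c p.2) + (p.1 : ℝ) • e (c' p.2)), ?_⟩,
    fun s => ?_, fun s => ?_⟩, ?_⟩⟩
  · refine hsymm.comp ?_
    have k1 := hc.comp (continuous_snd (X := unitInterval) (Y := unitInterval))
    have k2 := hc'.comp (continuous_snd (X := unitInterval) (Y := unitInterval))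
    have k3 : Continuous fun p : unitInterval × unitInterval => (p.1 : ℝ) := by fun_prop
    exact ((continuous_const.sub k3).smul k1).add (k3.smul k2)
  · simp [e.left_inv (hs _ (h s))]
  · simp [e.left_inv (hs _ (h' s))]
  · rintro t s hs'
    have e1 : c s = c' s := by
      rcases hs' with rfl | rfl <;> simp
    simp only [ContinuousMap.coe_mk, ← e1, ← add_smul]
    simp [e.left_inv (hs _ (h s))]

/-- A path is homotopic to one whose cone is a null set. -/
theorem exists_homotopic_null {ξ ξ' : S2} (c : Path ξ ξ') : ∃ c' : Path ξ ξ', c.Homotopic c' ∧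
    ∃ N : Set E3, MeasureTheory.volume N = 0 ∧ (∀ v ∈ N, ∀ r : ℝ, r • v ∈ N) ∧
      ∀ s, (c' s : E3) ∈ N := by
  -- Three coordinate errors below 1/12 give a norm below 1/4, as 3/144 < 1/16.
  have hcoord : ∀ i : Fin 3, ∃ p : Polynomial ℝ, ∀ s ∈ Icc (0 : ℝ) 1,
      |p.eval s - (SimpleClosedCurve.pathMap c s) i| < 1 / 12 := fun i =>
    exists_polynomial_near_of_continuousOn 0 1 _
      (((coord i).continuous.comp (SimpleClosedCurve.continuous_pathMap c)).continuousOn) _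
        (by norm_num)
  choose p hp using hcoord
  set P : ℝ → E3 := fun s => (p 0).eval s • EuclideanSpace.single 0 (1 : ℝ) +
    (p 1).eval s • EuclideanSpace.single 1 (1 : ℝ) +
    (p 2).eval s • EuclideanSpace.single 2 (1 : ℝ) with hP
  have hPd : Differentiable ℝ P := by
    have h := fun i => (p i).differentiable
    exact ((((h 0).smul_const _).add ((h 1).smul_const _)).add ((h 2).smul_const _))
  have hPc : ∀ s ∈ Icc (0 : ℝ) 1, ‖P s - SimpleClosedCurve.pathMap c s‖ < 1 / 4 := by
    intro s hs
    have h0 := hp 0 s hs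
    have h1 := hp 1 s hs
    have h2 := hp 2 s hs
    rw [EuclideanSpace.norm_eq, Real.sqrt_lt' (by norm_num), Fin.sum_univ_three]
    have e0 : P s 0 = (p 0).eval s := by simp [hP]
    have e1 : P s 1 = (p 1).eval s := by simp [hP]
    have e2 : P s 2 = (p 2).eval s := by simp [hP]
    simp only [PiLp.sub_apply, Real.norm_eq_abs, e0, e1, e2]
    have k0 := pow_lt_pow_left₀ h0 (abs_nonneg _) two_ne_zero
    have k1 := pow_lt_pow_left₀ h1 (abs_nonneg _) two_ne_zero
    have k2 := pow_lt_pow_left₀ h2 (abs_nonneg _) two_ne_zero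
    norm_num at k0 k1 k2 ⊢
    linarith
  -- The affine term restores the end points. The total error is below 3/4, so Q neither vanishes
  -- nor points opposite to c; being differentiable, it spans a null cone.
  set Q : ℝ → E3 := fun s => P s + ((1 - s) • ((ξ : E3) - P 0) + s • ((ξ' : E3) - P 1)) with hQ
  have hQd : ∀ s, HasDerivAt Q (deriv Q s) s := by
    intro s
    refine DifferentiableAt.hasDerivAt ?_
    have := hPd s
    simp only [hQ]
    fun_prop
  have hQcont : Continuous Q := continuous_iff_continuousAt.mpr fun s => (hQd s).continuousAt
  have hclose : ∀ s ∈ Icc (0 : ℝ) 1, ‖Q s - SimpleClosedCurve.pathMap c s‖ < 1 := by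
    intro s hs
    have h0 := hPc 0 ⟨le_rfl, zero_le_one⟩
    have h1 := hPc 1 ⟨zero_le_one, le_rfl⟩
    rw [SimpleClosedCurve.pathMap_zero, norm_sub_rev] at h0
    rw [SimpleClosedCurve.pathMap_one, norm_sub_rev] at h1
    have e : Q s - SimpleClosedCurve.pathMap c s = (P s - SimpleClosedCurve.pathMap c s) +
        ((1 - s) • ((ξ : E3) - P 0) + s • ((ξ' : E3) - P 1)) := by
      simp only [hQ]; abel
    rw [e]
    have k1 := norm_add_le (P s - SimpleClosedCurve.pathMap c s)
      ((1 - s) • ((ξ : E3) - P 0) + s • ((ξ' : E3) - P 1))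
    have k2 := norm_add_le ((1 - s) • ((ξ : E3) - P 0)) (s • ((ξ' : E3) - P 1))
    rw [norm_smul, norm_smul, Real.norm_of_nonneg hs.1, Real.norm_of_nonneg (by linarith [hs.2])]
      at k2
    have k3 : (1 - s) * ‖(ξ : E3) - P 0‖ ≤ 1 * (1 / 4) := by
      gcongr
      linarith [hs.1]
    have k4 : s * ‖(ξ' : E3) - P 1‖ ≤ 1 * (1 / 4) := by
      gcongr; exact hs.2
    linarith [hPc s hs]
  have hQ0 : ∀ s ∈ Icc (0 : ℝ) 1, Q s ≠ 0 := by
    intro s hs h0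
    have := hclose s hs
    rw [h0, zero_sub, norm_neg, SimpleClosedCurve.norm_pathMap] at this
    exact lt_irrefl _ this
  refine ⟨⟨⟨fun s => toSphere ⟨Q s, hQ0 s s.2⟩, continuous_toSphere.comp
    ((hQcont.comp continuous_subtype_val).subtype_mk _)⟩, ?_, ?_⟩, ?_,
    {v | ∃ r : ℝ, ∃ t ∈ (univ : Set ℝ), v = r • Q t}, volume_cone fun t _ => hQd t, ?_, ?_⟩
  · apply Subtype.ext
    simp [toSphere, hQ]
  · apply Subtype.ext
    simp [toSphere, hQ]
  · refine homotopic_of_ne_neg fun s h => ?_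
    have h1 : Q s = -(‖Q s‖ • (c s : E3)) := by
      have : ‖Q s‖⁻¹ • Q s = -(c s : E3) := h
      rw [← smul_neg, ← this, smul_smul, mul_inv_cancel₀ (norm_ne_zero_iff.mpr (hQ0 s s.2)),
        one_smul]
    have h2 := hclose s s.2
    have h3 : SimpleClosedCurve.pathMap c s = c s := by
      simp [SimpleClosedCurve.pathMap]
    have h4 : Q s - SimpleClosedCurve.pathMap c s = -((‖Q s‖ + 1) • (c s : E3)) := by
      rw [h3]; nth_rewrite 1 [h1]; rw [add_smul, one_smul]; abel
    rw [h4, norm_neg, norm_smul, norm_eq_of_mem_sphere, mul_one,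
      Real.norm_of_nonneg (by positivity)] at h2
    linarith [norm_nonneg (Q s)]
  · rintro v ⟨r', t, ht, rfl⟩ r
    exact ⟨r * r', t, ht, by rw [smul_smul]⟩
  · exact fun s => ⟨‖Q s‖⁻¹, s, trivial, rfl⟩

/-- Two paths on the sphere with the same end points are homotopic. -/
theorem homotopic_S2 {ξ ξ' : S2} (c c' : Path ξ ξ') : c.Homotopic c' := by
  obtain ⟨c₁, h₁, N₁, hN₁, hr₁, hm₁⟩ := exists_homotopic_null c
  obtain ⟨c₂, h₂, N₂, hN₂, hr₂, hm₂⟩ := exists_homotopic_null c'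
  -- Two null cones do not cover the sphere, so both approximating paths miss a common point.
  obtain ⟨q, -, hq⟩ := exists_direction_notMem isOpen_univ ⟨ξ, trivial⟩
    (MeasureTheory.measure_union_null hN₁ hN₂) (by
      rintro v (hv | hv) r
      exacts [.inl (hr₁ v hv r), .inr (hr₂ v hv r)])
  refine (h₁.trans (homotopic_of_ne (q := q) (fun s h => hq (.inl ?_))
    (fun s h => hq (.inr ?_)))).trans h₂.symm
  · rw [← h]; exact hm₁ s
  · rw [← h]; exact hm₂ s

/-! ### Linear algebra of unit vectors -/

theorem inner_sq_lt_one {u v : E3} (hu : ‖u‖ = 1) (hv : ‖v‖ = 1) (h1 : v ≠ u) (h2 : v ≠ -u) :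
    0 < 1 - inner ℝ u v ^ 2 := by
  have h3 : inner ℝ u v ≠ 1 := fun h => h1 ((inner_eq_one_iff_of_norm_eq_one hu hv).mp h).symm
  have h4 : inner ℝ u (-v) ≠ 1 := fun h => h2 (by
    rw [(inner_eq_one_iff_of_norm_eq_one hu (by rwa [norm_neg])).mp h, neg_neg])
  rw [inner_neg_right] at h4
  have h5 := abs_real_inner_le_norm u v
  rw [hu, hv, mul_one, abs_le] at h5
  have h6 : inner ℝ u v < 1 := lt_of_le_of_ne h5.2 h3
  have h7 : -1 < inner ℝ u v := lt_of_le_of_ne h5.1 fun h => h4 (by linarith)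
  nlinarith

theorem inner_self_eq_one {u : E3} (hu : ‖u‖ = 1) : inner ℝ u u = 1 := by
  rw [real_inner_self_eq_norm_sq, hu, one_pow]

/-- The Gram determinant. -/
theorem det3_sq (a b c : E3) : det3 a b c ^ 2 =
    inner ℝ a a * (inner ℝ b b * inner ℝ c c - inner ℝ b c ^ 2) -
    inner ℝ a b * (inner ℝ a b * inner ℝ c c - inner ℝ b c * inner ℝ a c) +
    inner ℝ a c * (inner ℝ a b * inner ℝ b c - inner ℝ b b * inner ℝ a c) := by
  simp only [det3_eq, inner3_eq]
  ring

/-- The coefficients solve the Gram system of the orthogonal projection to the plane of u and v. The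
remainder e is orthogonal to both, and its Gram determinant ‖e‖² (1 - c²) is zero. -/
theorem exists_smul_add_smul_of_det3_eq_zero {u v w : E3} (hu : ‖u‖ = 1) (hv : ‖v‖ = 1)
    (h1 : v ≠ u) (h2 : v ≠ -u) (h : det3 u v w = 0) : ∃ a b : ℝ, w = a • u + b • v := by
  have hd := inner_sq_lt_one hu hv h1 h2
  have hu' := inner_self_eq_one hu
  have hv' := inner_self_eq_one hv
  set c : ℝ := inner ℝ u v with hc
  set x : ℝ := inner ℝ u w with hx
  set y : ℝ := inner ℝ v w with hy
  set a : ℝ := (x - c * y) / (1 - c ^ 2) with ha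
  set b : ℝ := (y - c * x) / (1 - c ^ 2) with hb
  refine ⟨a, b, ?_⟩
  set e := w - (a • u + b • v) with he
  have e1 : inner ℝ u e = 0 := by
    rw [he, inner_sub_right, inner_add_right, inner_smul_right, inner_smul_right, hu', ← hc, ← hx,
      ha, hb]
    field_simp; ring
  have e2 : inner ℝ v e = 0 := by
    rw [he, inner_sub_right, inner_add_right, inner_smul_right, inner_smul_right, hv',
      real_inner_comm u v, ← hc, ← hy, ha, hb]
    field_simp; ring
  have e3 : det3 u v e = 0 := by
    have : det3 u v e = det3 u v w := by
      simp only [det3_eq, he, PiLp.sub_apply, PiLp.add_apply, PiLp.smul_apply, smul_eq_mul]; ring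
    rw [this, h]
  have e4 := det3_sq u v e
  rw [e3, e1, e2, hu', hv', ← hc] at e4
  have e5 : inner ℝ e e * (1 - c ^ 2) = 0 := by linarith
  have e6 : e = 0 := inner_self_eq_zero.mp ((mul_eq_zero.mp e5).resolve_right hd.ne')
  exact sub_eq_zero.mp e6

theorem exists_det3_ne_zero {u v : E3} (hu : ‖u‖ = 1) (hv : ‖v‖ = 1) (h1 : v ≠ u) (h2 : v ≠ -u) :
    ∃ x, det3 u v x ≠ 0 := by
  have hd := inner_sq_lt_one hu hv h1 h2
  have hu' := inner_self_eq_one hu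
  have hv' := inner_self_eq_one hv
  refine ⟨!₂[u 1 * v 2 - u 2 * v 1, u 2 * v 0 - u 0 * v 2, u 0 * v 1 - u 1 * v 0], ?_⟩
  have e : det3 u v !₂[u 1 * v 2 - u 2 * v 1, u 2 * v 0 - u 0 * v 2, u 0 * v 1 - u 1 * v 0] =
      1 - inner ℝ u v ^ 2 := by
    have : inner ℝ u u * inner ℝ v v = 1 := by rw [hu', hv', one_mul]
    rw [← this, inner3_eq u u, inner3_eq v v, inner3_eq u v]
    simp [det3_eq]
    ring
  rw [e]
  exact hd.ne'

theorem subsingleton_affine_zeros {A B : ℝ} (h : ¬ (A = 0 ∧ B = 0)) :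
    {s : ℝ | (1 - s) * A + s * B = 0}.Subsingleton := by
  intro s hs s' hs'
  simp only [mem_ofPred_eq] at hs hs'
  by_contra hne
  have h1 : (s - s') * (B - A) = 0 := by linear_combination hs - hs'
  have h2 : B - A = 0 := (mul_eq_zero.mp h1).resolve_left (sub_ne_zero.mpr hne)
  have h3 : A = 0 := by linear_combination hs - s * h2
  exact h ⟨h3, by linarith⟩

/-! ### Arcs of great circle -/

/-- The point of the chord which is projected to the arc of great circle. -/
def chordPoint (a b : E3) (s : ℝ) : E3 := (1 - s) • a + s • b

theorem det3_chordPoint (a b x y : E3) (s : ℝ) : det3 x y (chordPoint a b s) =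
    (1 - s) * det3 x y a + s * det3 x y b := by
  simp only [det3_eq, chordPoint, PiLp.add_apply, PiLp.smul_apply, smul_eq_mul]; ring

theorem chordPoint_ne_zero {a b : S2} (h : b ≠ -a) {s : ℝ} (hs : s ∈ Icc (0 : ℝ) 1) :
    chordPoint (a : E3) b s ≠ 0 := fun h0 =>
  zero_notMem_segment (norm_eq_of_mem_sphere a) (norm_eq_of_mem_sphere b)
    (fun h' => h (Subtype.ext h')) ⟨1 - s, s, by linarith [hs.2], hs.1, by ring, h0⟩

/-- The arc of great circle between two points of the sphere which are not antipodal. -/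
def arcPath (a b : S2) (h : b ≠ -a) : Path a b where
  toFun s := toSphere ⟨chordPoint a b s, chordPoint_ne_zero h s.2⟩
  continuous_toFun := continuous_toSphere.comp (Continuous.subtype_mk (by
    unfold chordPoint; fun_prop) _)
  source' := by
    apply Subtype.ext
    simp [toSphere, chordPoint]
  target' := by
    apply Subtype.ext
    simp [toSphere, chordPoint]

namespace SimpleClosedCurve

theorem pathMap_arcPath {a b : S2} (h : b ≠ -a) {s : ℝ} (hs : s ∈ Icc (0 : ℝ) 1) :
    pathMap (arcPath a b h) s = ‖chordPoint (a : E3) b s‖⁻¹ • chordPoint (a : E3) b s := by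
  rw [pathMap, Path.extend_apply _ hs]
  rfl

theorem arcPath_deriv {a b : S2} (h : b ≠ -a) {s : ℝ} (hs : s ∈ Ioo (0 : ℝ) 1) :
    DifferentiableAt ℝ (pathMap (arcPath a b h)) s ∧ ∃ r : ℝ, 0 < r ∧ ∀ d,
      det3 (pathMap (arcPath a b h) s) (deriv (pathMap (arcPath a b h)) s) d =
        r * det3 (a : E3) b d := by
  have hs' := Ioo_subset_Icc_self hs
  have h0 := chordPoint_ne_zero h hs'
  have hev : pathMap (arcPath a b h) =ᶠ[𝓝 s] fun s =>
      ‖chordPoint (a : E3) b s‖⁻¹ • chordPoint (a : E3) b s := by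
    filter_upwards [isOpen_Ioo.mem_nhds hs] with s' hs'
    exact pathMap_arcPath h (Ioo_subset_Icc_self hs')
  have hw : HasDerivAt (chordPoint (a : E3) b) ((b : E3) - a) s := by
    have h1 := (((hasDerivAt_id s).const_sub 1).smul_const (a : E3)).add
      ((hasDerivAt_id s).smul_const (b : E3))
    refine h1.congr_deriv ?_
    rw [neg_smul, one_smul, one_smul]; abel
  have hn : DifferentiableAt ℝ (fun s => ‖chordPoint (a : E3) b s‖⁻¹) s :=
    (hw.differentiableAt.norm ℝ h0).inv (norm_ne_zero_iff.mpr h0)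
  have hd := (hn.hasDerivAt.fun_smul hw).congr_of_eventuallyEq hev
  refine ⟨hd.differentiableAt, (‖chordPoint (a : E3) b s‖⁻¹) ^ 2,
    by have := norm_pos_iff.mpr h0; positivity, fun d => ?_⟩
  rw [hd.deriv, hev.self_of_nhds]
  simp only [det3_eq, chordPoint, PiLp.add_apply, PiLp.sub_apply, PiLp.smul_apply, smul_eq_mul]
  ring

theorem det3_pathMap_arcPath {a b : S2} (h : b ≠ -a) {s : ℝ} (hs : s ∈ Icc (0 : ℝ) 1) :
    det3 (a : E3) b (pathMap (arcPath a b h) s) = 0 := by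
  rw [pathMap_arcPath h hs]
  simp only [det3_eq, chordPoint, PiLp.add_apply, PiLp.smul_apply, smul_eq_mul]
  ring

theorem affine_of_det3_pathMap_arcPath {a b : S2} (h : b ≠ -a) {s : ℝ} (hs : s ∈ Icc (0 : ℝ) 1)
    {x y : E3} (h0 : det3 x y (pathMap (arcPath a b h) s) = 0) :
    (1 - s) * det3 x y a + s * det3 x y b = 0 := by
  rw [pathMap_arcPath h hs] at h0
  have h1 := norm_ne_zero_iff.mpr (chordPoint_ne_zero h hs)
  rw [← det3_chordPoint]
  have : ‖chordPoint (a : E3) b s‖⁻¹ * det3 x y (chordPoint (a : E3) b s) = 0 := by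
    rw [← h0]; simp only [det3_eq, PiLp.smul_apply, smul_eq_mul]; ring
  exact (mul_eq_zero.mp this).resolve_left (inv_ne_zero h1)

variable {K : SimpleClosedCurve}

/-- A linear form that vanishes on r - l takes the same value at l and r; if it also vanishes at a
point a • l + b • r of the arc, this value times a + b is zero. So a great circle tangent to a
corner arc at a meeting contains its end point. -/
theorem det3_left_eq_zero_of_mem_greatArc {x l r : E3} (σ : ℝ) (h : σ • x ∈ greatArc l r)
    (y z : E3) (h0 : det3 y z x = 0) (h1 : det3 y z (r - l) = 0) : det3 y z l = 0 := by
  obtain ⟨hn, a, b, ha, hb, he⟩ := h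
  have e1 : a * det3 y z l + b * det3 y z r = 0 := by
    have : det3 y z (σ • x) = a * det3 y z l + b * det3 y z r := by
      rw [he]; simp only [det3_eq, PiLp.add_apply, PiLp.smul_apply, smul_eq_mul]; ring
    rw [← this]
    have : det3 y z (σ • x) = σ * det3 y z x := by
      simp only [det3_eq, PiLp.smul_apply, smul_eq_mul]; ring
    rw [this, h0, mul_zero]
  have e2 : det3 y z r = det3 y z l := by
    have : det3 y z (r - l) = det3 y z r - det3 y z l := by
      simp only [det3_eq, PiLp.sub_apply]; ring
    linarith
  rw [e2, ← add_mul] at e1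
  refine (mul_eq_zero.mp e1).resolve_left fun hab => ?_
  have ha0 : a = 0 := by linarith
  have hb0 : b = 0 := by linarith
  rw [he, ha0, hb0] at hn
  simp at hn

variable (hK : K.IsPiecewiseC2Knot)

include hK

/-- The parameters at which the tangent indicatrix meets a great circle in general position. -/
theorem finite_plane_zeros {a b : E3} (H1 : ∀ t, ¬ K.IsCorner t → det3 a b (K.unitTangent t) = 0 →
      det3 a b (deriv K.unitTangent t) ≠ 0)
    (H2 : ∀ t, K.IsCorner t → det3 a b (K.leftTangent t) ≠ 0 ∧ det3 a b (K.rightTangent t) ≠ 0) :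
    {t ∈ Icc (0 : ℝ) 1 | ¬ K.IsCorner t ∧ det3 a b (K.unitTangent t) = 0}.Finite := by
  by_contra hinf
  obtain ⟨x, -, hx⟩ := Set.Infinite.exists_accPt_of_subset_isCompact hinf isCompact_Icc
    (fun t ht => ht.1)
  rw [accPt_iff_frequently_nhdsNE] at hx
  have hB : Continuous fun v => det3 a b v := by
    have := (coord 0).continuous; have := (coord 1).continuous; have := (coord 2).continuous
    simp only [det3_eq]
    fun_prop
  -- Zeros do not accumulate: at a corner both one-sided limits are nonzero, and elsewhere the value
  -- or the derivative is.
  have hev : ∀ᶠ t in 𝓝[≠] x, det3 a b (K.unitTangent t) ≠ 0 := by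
    by_cases hc : K.IsCorner x
    · rw [← nhdsLT_sup_nhdsGT, Filter.eventually_sup]
      exact ⟨((hB.tendsto _).comp (tendsto_leftTangent hK x)).eventually_ne (H2 x hc).1,
        ((hB.tendsto _).comp (tendsto_rightTangent hK x)).eventually_ne (H2 x hc).2⟩
    · have hd := (differentiableAt_unitTangent hK hc).hasDerivAt
      by_cases h0 : det3 a b (K.unitTangent x) = 0
      · have hd2 : HasDerivAt (fun t => det3 a b (K.unitTangent t))
            (det3 a b (deriv K.unitTangent x)) x := by
          have e : ∀ v, det3 a b v = det3Form b v a := by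
            intro v
            change _ = det3 v a b
            simp only [det3_eq]; ring
          have := (LinearMap.toContinuousLinearMap ((det3Form b).flip a)).hasFDerivAt.comp_hasDerivAt
            x hd
          simp only [e]
          exact this
        exact hd2.eventually_ne (H1 x hc h0)
      · exact nhdsWithin_le_nhds ((hB.continuousAt.comp hd.continuousAt).eventually_ne h0)
  obtain ⟨t, ht, ht'⟩ := (hx.and_eventually hev).exists
  exact ht' ht.2.2

/-- An arc of great circle in general position is transverse to the indicatrix. -/
theorem isTransversePath_arcPath {a b : S2} (h : b ≠ -a) (ha : a ∉ K.indicatrix)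
    (hb : b ∉ K.indicatrix) (H1 : ∀ t, ¬ K.IsCorner t → det3 (a : E3) b (K.unitTangent t) = 0 →
      det3 (a : E3) b (deriv K.unitTangent t) ≠ 0)
    (H2 : ∀ t, K.IsCorner t → det3 (a : E3) b (K.leftTangent t) ≠ 0 ∧
      det3 (a : E3) b (K.rightTangent t) ≠ 0)
    (H3 : ∀ t, K.IsCorner t → K.leftTangent t ≠ K.rightTangent t →
      ¬ (det3 (K.leftTangent t) (K.rightTangent t) a = 0 ∧
        det3 (K.leftTangent t) (K.rightTangent t) b = 0)) :
    K.IsTransversePath (arcPath a b h) := by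
  set c := arcPath a b h with hc
  have hpiece : ∀ t ∈ Ico (0 : ℝ) 1, K.tangentPiece t =
      greatArc (K.leftTangent t) (K.rightTangent t) := fun t ht => by
    rw [← tangentPiece_fract hK, Int.fract_eq_self.mpr ht]
  have hsmul : ∀ (σ : ℝ) (x : E3), det3 (a : E3) b (σ • x) = σ * det3 (a : E3) b x := by
    intro σ x; simp only [det3_eq, PiLp.smul_apply, smul_eq_mul]; ring
  -- meetings over regular parameters
  have hT : ∀ σ : ℝ, σ * σ = 1 → ∀ s ∈ Icc (0 : ℝ) 1, ∀ t ∈ Ico (0 : ℝ) 1, ¬ K.IsCorner t →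
      σ • pathMap c s ∈ K.tangentPiece t → K.unitTangent t = σ • pathMap c s ∧
        det3 (a : E3) b (K.unitTangent t) = 0 := by
    intro σ hσ s hs t ht hct hm
    rw [hpiece t ht, leftTangent_eq hK hct, rightTangent_eq hK hct,
      greatArc_self (norm_unitTangent hK hct), mem_singleton_iff] at hm
    exact ⟨hm.symm, by rw [← hm, hsmul, det3_pathMap_arcPath h hs, mul_zero]⟩
  have hfinT := (finite_plane_zeros hK H1 H2).union (K.finite_isCorner 0 1)
  have hfin : ∀ σ : ℝ, σ * σ = 1 → {p : ℝ × ℝ | p.1 ∈ Icc (0 : ℝ) 1 ∧ p.2 ∈ Ico (0 : ℝ) 1 ∧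
      σ • pathMap c p.1 ∈ K.tangentPiece p.2}.Finite := by
    intro σ hσ
    have hσ0 : σ ≠ 0 := fun h0 => by rw [h0, mul_zero] at hσ; exact zero_ne_one hσ
    -- Each piece is met at most once, because lying in a plane through the origin is an affine
    -- condition on the chord parameter. At a corner this plane carries the arc; elsewhere it
    -- contains the unit tangent and is chosen to miss a.
    have hslice : ∀ t ∈ Ico (0 : ℝ) 1,
        {s | s ∈ Icc (0 : ℝ) 1 ∧ σ • pathMap c s ∈ K.tangentPiece t}.Subsingleton := by
      intro t ht
      have hgen : ∀ x y : E3, ¬ (det3 x y a = 0 ∧ det3 x y b = 0) →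
          (∀ s ∈ Icc (0 : ℝ) 1, σ • pathMap c s ∈ K.tangentPiece t →
            det3 x y (σ • pathMap c s) = 0) →
          {s | s ∈ Icc (0 : ℝ) 1 ∧ σ • pathMap c s ∈ K.tangentPiece t}.Subsingleton := by
        intro x y hxy hz
        refine (subsingleton_affine_zeros hxy).anti fun s hs => ?_
        refine affine_of_det3_pathMap_arcPath h hs.1 ?_
        have h1 := hz s hs.1 hs.2
        have h2 : det3 x y (σ • pathMap c s) = σ * det3 x y (pathMap c s) := by
          simp only [det3_eq, PiLp.smul_apply, smul_eq_mul]; ring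
        rw [h2] at h1
        exact (mul_eq_zero.mp h1).resolve_left hσ0
      by_cases hct : K.IsCorner t
      · by_cases hlr : K.leftTangent t = K.rightTangent t
        · intro s hs
          exfalso
          have hm := hs.2
          rw [hpiece t ht, ← hlr, greatArc_self (norm_leftTangent hK t), mem_singleton_iff] at hm
          apply (H2 t hct).1
          rw [← hm, hsmul, det3_pathMap_arcPath h hs.1, mul_zero]
        · refine hgen _ _ (H3 t hct hlr) fun s _ hm => ?_
          rw [hpiece t ht] at hm
          obtain ⟨-, α, β, -, -, he⟩ := hm
          rw [he]
          simp only [det3_eq, PiLp.add_apply, PiLp.smul_apply, smul_eq_mul]; ring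
      · have hTa : (a : E3) ≠ K.unitTangent t := fun h' =>
          ha (.inl (h' ▸ unitTangent_mem_indicatrix hK hct))
        have hTa' : (a : E3) ≠ -K.unitTangent t := fun h' =>
          ha (.inr (by rw [h', neg_neg]; exact unitTangent_mem_indicatrix hK hct))
        obtain ⟨x, hx⟩ := exists_det3_ne_zero (norm_unitTangent hK hct) (norm_eq_of_mem_sphere a)
          hTa hTa'
        refine hgen x (K.unitTangent t) (fun h' => hx ?_) fun s hs hm => ?_
        · have := h'.1
          simp only [det3_eq] at this ⊢
          linear_combination this
        · rw [← (hT σ hσ s hs t ht hct hm).1]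
          simp only [det3_eq]; ring
    refine ((hfinT.inter_of_left (Ico 0 1)).biUnion (t := fun t =>
      (fun s => (s, t)) '' {s | s ∈ Icc (0 : ℝ) 1 ∧ t ∈ Ico (0 : ℝ) 1 ∧
        σ • pathMap c s ∈ K.tangentPiece t}) ?_).subset ?_
    · intro t ht
      exact ((hslice t ht.2).finite.subset fun s hs => ⟨hs.1, hs.2.2⟩).image _
    · rintro ⟨s, t⟩ ⟨hs, ht, hm⟩
      simp only at hs ht hm
      refine mem_biUnion (x := t) ⟨?_, ht⟩ ⟨s, ⟨hs, ht, hm⟩, rfl⟩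
      by_cases hct : K.IsCorner t
      · exact .inr ⟨Ico_subset_Icc_self ht, hct⟩
      · exact .inl ⟨Ico_subset_Icc_self ht, hct, (hT σ hσ s hs t ht hct hm).2⟩
  have hcross : ∀ σ : ℝ, σ = 1 ∨ σ = -1 → ∀ p : ℝ × ℝ, p.1 ∈ Icc (0 : ℝ) 1 →
      p.2 ∈ Ico (0 : ℝ) 1 → σ • pathMap c p.1 ∈ K.tangentPiece p.2 →
      DifferentiableAt ℝ (pathMap c) p.1 ∧ K.crossingDet c p ≠ 0 := by
    rintro σ hσ ⟨s, t⟩ hs ht hm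
    simp only at hs ht hm
    have hσ2 : σ * σ = 1 := by rcases hσ with rfl | rfl <;> norm_num
    have hIn : ∀ x : S2, x ∉ K.indicatrix → pathMap c s ≠ x := by
      intro x hx h'
      apply hx
      rw [h'] at hm
      have := mem_tangentIndicatrix_of_mem_tangentPiece ht hm
      rcases hσ with rfl | rfl
      · exact .inl (by simpa using this)
      · exact .inr (by simpa using this)
    have hs0 : s ≠ 0 := fun h0 => hIn a ha (by rw [h0, pathMap_zero])
    have hs1 : s ≠ 1 := fun h0 => hIn b hb (by rw [h0, pathMap_one])
    obtain ⟨hd, r, hr, hdet⟩ := arcPath_deriv h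
      ⟨lt_of_le_of_ne hs.1 hs0.symm, lt_of_le_of_ne hs.2 hs1⟩
    refine ⟨hd, ?_⟩
    rw [crossingDet]
    simp only
    rw [hc, hdet]
    refine mul_ne_zero hr.ne' ?_
    by_cases hct : K.IsCorner t
    · have e := tangentDir_fract_of_corner hK hct
      rw [Int.fract_eq_self.mpr ht] at e
      rw [e]
      intro h0
      rw [hpiece t ht] at hm
      exact (H2 t hct).1 (det3_left_eq_zero_of_mem_greatArc σ hm _ _ (det3_pathMap_arcPath h hs) h0)
    · have e := tangentDir_fract_of_not_corner hct
      rw [Int.fract_eq_self.mpr ht] at e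
      rw [e]
      exact H1 t hct (hT σ hσ2 s hs t ht hct hm).2
  refine ⟨?_, ?_, fun p hp => ?_⟩
  · refine (hfin 1 (by norm_num)).subset fun p hp => ?_
    rw [mem_ofPred_eq, one_smul]; exact hp
  · refine (hfin (-1) (by norm_num)).subset fun p hp => ?_
    rw [mem_ofPred_eq, neg_one_smul]; exact hp
  · have hp1 : p.1 ∈ Icc (0 : ℝ) 1 := by rcases hp with hp | hp <;> exact hp.1
    have hp2 : p.2 ∈ Ico (0 : ℝ) 1 := by rcases hp with hp | hp <;> exact hp.2.1
    have hd : DifferentiableAt ℝ (pathMap c) p.1 ∧ K.crossingDet c p ≠ 0 := by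
      rcases hp with hp | hp
      · exact hcross 1 (.inl rfl) p hp1 hp2 (by simpa using hp.2.2)
      · exact hcross (-1) (.inr rfl) p hp1 hp2 (by simpa using hp.2.2)
    refine ⟨hd.1, hd.2, fun hk => ?_⟩
    obtain ⟨h2, h2'⟩ := H2 p.2 ((K.isCorner_iff hp2).mpr hk)
    have h0 := det3_pathMap_arcPath h hp1
    have hne : ∀ v : E3, det3 (a : E3) b v ≠ 0 → pathMap c p.1 ≠ v ∧ pathMap c p.1 ≠ -v := by
      refine fun v hv => ⟨fun h' => hv (h' ▸ h0), fun h' => hv ?_⟩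
      have := hsmul (-1) v
      rw [neg_one_smul, ← h', h0] at this
      linarith
    exact ⟨(hne _ h2).1, (hne _ h2').1, (hne _ h2).2, (hne _ h2').2⟩

end SimpleClosedCurve

/-! ### General position and the existence of transverse paths. -/

namespace SimpleClosedCurve

variable {K : SimpleClosedCurve}

/-- A direction `p` is in general position with respect to `ξ` if the great circle through `ξ` and
`p` is in general position with respect to the indicatrix. -/
structure GeneralPosition (K : SimpleClosedCurve) (ξ p : E3) : Prop where
  regular : ∀ t, ¬ K.IsCorner t → det3 ξ p (K.unitTangent t) = 0 →
    det3 ξ p (deriv K.unitTangent t) ≠ 0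
  corner : ∀ t, K.IsCorner t → det3 ξ p (K.leftTangent t) ≠ 0 ∧ det3 ξ p (K.rightTangent t) ≠ 0
  arc : ∀ t, K.IsCorner t → K.leftTangent t ≠ K.rightTangent t →
    ¬ (det3 (K.leftTangent t) (K.rightTangent t) ξ = 0 ∧
      det3 (K.leftTangent t) (K.rightTangent t) p = 0)

theorem det3_swap (a b c : E3) : det3 b a c = -det3 a b c := by
  simp only [det3_eq]; ring

theorem GeneralPosition.symm {ξ p : E3} (h : K.GeneralPosition ξ p) : K.GeneralPosition p ξ := by
  refine ⟨fun t ht h0 => ?_, fun t ht => ?_, fun t ht hlr h0 => h.arc t ht hlr h0.symm⟩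
  · rw [det3_swap, neg_ne_zero]
    rw [det3_swap, neg_eq_zero] at h0
    exact h.regular t ht h0
  · rw [det3_swap ξ p, neg_ne_zero, det3_swap ξ p, neg_ne_zero]
    exact h.corner t ht

variable (K) in
/-- The union of the lines in the directions which are not in general position with respect to
`ξ`. -/
def specialCone (ξ : E3) : Set E3 :=
  K.badCone ∪ {v | ∃ r s : ℝ, v = r • ξ + s • (0 : E3)} ∪
  (⋃ k ∈ K.corners, {v | ∃ r s : ℝ, v = r • ξ + s • K.leftTangent k}) ∪
  (⋃ k ∈ K.corners, {v | ∃ r s : ℝ, v = r • ξ + s • K.rightTangent k}) ∪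
  {v | ∃ a b : ℝ, ∃ t ∈ {t | ¬ K.IsCorner t}, det3 ξ (K.unitTangent t) (deriv K.unitTangent t) = 0 ∧
    v = a • ξ + b • K.unitTangent t}

theorem smul_mem_specialCone {ξ v : E3} (hv : v ∈ K.specialCone ξ) (r : ℝ) :
    r • v ∈ K.specialCone ξ := by
  simp only [specialCone, mem_union, mem_iUnion, exists_prop] at hv ⊢
  rcases hv with (((hv | ⟨a, b, rfl⟩) | ⟨k, hk, a, b, rfl⟩) | ⟨k, hk, a, b, rfl⟩) |
    ⟨a, b, t, ht, hd, rfl⟩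
  · exact .inl (.inl (.inl (.inl (K.smul_mem_badCone hv r))))
  · exact .inl (.inl (.inl (.inr ⟨r * a, r * b, by rw [smul_add, smul_smul, smul_smul]⟩)))
  · exact .inl (.inl (.inr ⟨k, hk, r * a, r * b, by rw [smul_add, smul_smul, smul_smul]⟩))
  · exact .inl (.inr ⟨k, hk, r * a, r * b, by rw [smul_add, smul_smul, smul_smul]⟩)
  · exact .inr ⟨r * a, r * b, t, ht, hd, by rw [smul_add, smul_smul, smul_smul]⟩

variable (hK : K.IsPiecewiseC2Knot)

include hK

theorem volume_specialCone (ξ : E3) : MeasureTheory.volume (K.specialCone ξ) = 0 := by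
  refine MeasureTheory.measure_union_null (MeasureTheory.measure_union_null
    (MeasureTheory.measure_union_null (MeasureTheory.measure_union_null (volume_badCone hK)
      (volume_plane _ _)) ?_) ?_) ?_
  · exact (MeasureTheory.measure_biUnion_null_iff K.corners.countable_toSet).mpr
      fun k _ => volume_plane _ _
  · exact (MeasureTheory.measure_biUnion_null_iff K.corners.countable_toSet).mpr
      fun k _ => volume_plane _ _
  · exact volume_tangent_planes (fun t ht => (differentiableAt_unitTangent hK ht).hasDerivAt) ξ

/-- If the plane of ξ and p contains a tangent vector x, then p lies in the span of ξ and x, since x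
is not ± ξ off the indicatrix. The planes that occur for the forbidden x make up `specialCone`. -/
theorem generalPosition_of_notMem {ξ : S2} (hξ : ξ ∉ K.indicatrix) {p : E3}
    (hp : p ∉ K.specialCone ξ) : K.GeneralPosition ξ p := by
  have hξ1 : ‖(ξ : E3)‖ = 1 := norm_eq_of_mem_sphere ξ
  have hne : ∀ x ∈ K.tangentIndicatrix, x ≠ ξ ∧ x ≠ -(ξ : E3) := fun x hx =>
    ⟨fun h => hξ (.inl (h ▸ hx)), fun h => hξ (.inr (h ▸ hx))⟩
  have hswap : ∀ x : E3, det3 (ξ : E3) x p = -det3 (ξ : E3) p x := fun x => by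
    simp only [det3_eq]; ring
  have hspan : ∀ x ∈ K.tangentIndicatrix, ‖x‖ = 1 → det3 (ξ : E3) p x = 0 →
      ∃ a b : ℝ, p = a • (ξ : E3) + b • x := fun x hx hx1 h0 =>
    exists_smul_add_smul_of_det3_eq_zero hξ1 hx1 (hne x hx).1 (hne x hx).2
      (by rw [hswap, h0, neg_zero])
  refine ⟨fun t ht h0 h1 => ?_, fun t ht => ⟨fun h0 => ?_, fun h0 => ?_⟩, fun t ht hlr h0 => ?_⟩
  · obtain ⟨a, b, hab⟩ := hspan _ (unitTangent_mem_indicatrix hK ht) (norm_unitTangent hK ht) h0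
    have h2 : b * det3 (ξ : E3) (K.unitTangent t) (deriv K.unitTangent t) = 0 := by
      rw [← h1, hab]
      simp only [det3_eq, PiLp.add_apply, PiLp.smul_apply, smul_eq_mul]; ring
    rcases mul_eq_zero.mp h2 with hb | hd
    · exact hp (.inl (.inl (.inl (.inr ⟨a, 0, by rw [hab, hb, zero_smul, zero_smul]⟩))))
    · exact hp (.inr ⟨a, b, t, ht, hd, hab⟩)
  · have hm : K.leftTangent t ∈ K.tangentIndicatrix := (mem_tangentIndicatrix hK).mpr
      ⟨t, left_mem_greatArc (norm_leftTangent hK t) _⟩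
    obtain ⟨a, b, hab⟩ := hspan _ hm (norm_leftTangent hK t) h0
    refine hp (.inl (.inl (.inr (mem_biUnion (x := Int.fract t) ht ⟨a, b, ?_⟩))))
    rw [leftTangent_fract hK]; exact hab
  · have hm : K.rightTangent t ∈ K.tangentIndicatrix := (mem_tangentIndicatrix hK).mpr
      ⟨t, right_mem_greatArc _ (norm_rightTangent hK t)⟩
    obtain ⟨a, b, hab⟩ := hspan _ hm (norm_rightTangent hK t) h0
    refine hp (.inl (.inr (mem_biUnion (x := Int.fract t) ht ⟨a, b, ?_⟩)))
    rw [rightTangent_fract hK]; exact hab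
  · obtain ⟨a, b, hab⟩ := exists_smul_add_smul_of_det3_eq_zero (norm_leftTangent hK t)
      (norm_rightTangent hK t) (Ne.symm hlr) (rightTangent_ne hK t) h0.2
    refine hp (.inl (.inl (.inl (.inl ?_))))
    refine .inl (.inl (.inl (.inl (.inr (mem_biUnion (x := Int.fract t) ht ⟨a, b, ?_⟩)))))
    rw [leftTangent_fract hK, rightTangent_fract hK]; exact hab

omit hK

/-- The junction is no meeting, as p is off the indicatrix. Near every meeting the concatenation is
one of the two paths run at double speed, which multiplies the determinant by 2. -/
theorem isTransversePath_trans {ξ p ξ' : S2} {c : Path ξ p} {c' : Path p ξ'}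
    (hp : p ∉ K.indicatrix) (hc : K.IsTransversePath c) (hc' : K.IsTransversePath c') :
    K.IsTransversePath (c.trans c') := by
  have e1 : ∀ s ≤ 1 / 2, pathMap (c.trans c') s = pathMap c (2 * s) := fun s hs => by
    rw [pathMap, Path.extend_trans_of_le_half _ _ hs]; rfl
  have e2 : ∀ s, 1 / 2 ≤ s → pathMap (c.trans c') s = pathMap c' (2 * s - 1) := fun s hs => by
    rw [pathMap, Path.extend_trans_of_half_le _ _ hs]; rfl
  have key : ∀ s ∈ Icc (0 : ℝ) 1, s ≤ 1 / 2 ∧ 2 * s ∈ Icc (0 : ℝ) 1 ∨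
      1 / 2 ≤ s ∧ 2 * s - 1 ∈ Icc (0 : ℝ) 1 := fun s hs => by
    rcases le_total s (1 / 2) with h | h
    · exact .inl ⟨h, by linarith [hs.1], by linarith⟩
    · exact .inr ⟨h, by linarith, by linarith [hs.2]⟩
  refine ⟨?_, ?_, ?_⟩
  · refine ((hc.1.image fun p => (p.1 / 2, p.2)).union
      (hc'.1.image fun p => ((p.1 + 1) / 2, p.2))).subset ?_
    rintro ⟨s, t⟩ ⟨hs, ht, h⟩
    simp only at hs ht h
    rcases key s hs with ⟨h1, h2⟩ | ⟨h1, h2⟩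
    · rw [e1 s h1] at h
      exact .inl ⟨(2 * s, t), ⟨h2, ht, h⟩, Prod.ext (by simp) rfl⟩
    · rw [e2 s h1] at h
      exact .inr ⟨(2 * s - 1, t), ⟨h2, ht, h⟩, Prod.ext (by simp) rfl⟩
  · refine ((hc.2.1.image fun p => (p.1 / 2, p.2)).union
      (hc'.2.1.image fun p => ((p.1 + 1) / 2, p.2))).subset ?_
    rintro ⟨s, t⟩ ⟨hs, ht, h⟩
    simp only at hs ht h
    rcases key s hs with ⟨h1, h2⟩ | ⟨h1, h2⟩
    · rw [e1 s h1] at h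
      exact .inl ⟨(2 * s, t), ⟨h2, ht, h⟩, Prod.ext (by simp) rfl⟩
    · rw [e2 s h1] at h
      exact .inr ⟨(2 * s - 1, t), ⟨h2, ht, h⟩, Prod.ext (by simp) rfl⟩
  · rintro ⟨s, t⟩ hst
    have hs : s ∈ Icc (0 : ℝ) 1 := by rcases hst with h | h <;> exact h.1
    have ht : t ∈ Ico (0 : ℝ) 1 := by rcases hst with h | h <;> exact h.2.1
    have hpc : pathMap (c.trans c') s ∈ K.tangentPiece t ∨
        -pathMap (c.trans c') s ∈ K.tangentPiece t := by
      rcases hst with h | h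
      exacts [.inl h.2.2, .inr h.2.2]
    have hhalf : s ≠ 1 / 2 := by
      rintro rfl
      rw [e1 _ le_rfl, mul_one_div_cancel two_ne_zero, pathMap_one] at hpc
      exact hp (hpc.imp (mem_tangentIndicatrix_of_mem_tangentPiece ht)
        (mem_tangentIndicatrix_of_mem_tangentPiece ht))
    have fin : ∀ (g : ℝ → E3) (w : ℝ), pathMap (c.trans c') =ᶠ[𝓝 s] (fun σ => g (2 * σ - w)) →
        DifferentiableAt ℝ g (2 * s - w) →
        det3 (g (2 * s - w)) (deriv g (2 * s - w)) (K.tangentDir t) ≠ 0 →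
        DifferentiableAt ℝ (pathMap (c.trans c')) s ∧ K.crossingDet (c.trans c') (s, t) ≠ 0 := by
      intro g w he hg hd
      have hlin : HasDerivAt (fun σ : ℝ => 2 * σ - w) 2 s := by
        simpa using ((hasDerivAt_id s).const_mul 2).sub_const w
      have h1 : HasDerivAt (pathMap (c.trans c')) ((2 : ℝ) • deriv g (2 * s - w)) s :=
        (hg.hasDerivAt.scomp s hlin).congr_of_eventuallyEq he
      refine ⟨h1.differentiableAt, ?_⟩
      rw [crossingDet]
      simp only
      rw [h1.deriv, he.self_of_nhds]
      have : det3 (g (2 * s - w)) ((2 : ℝ) • deriv g (2 * s - w)) (K.tangentDir t) =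
          2 * det3 (g (2 * s - w)) (deriv g (2 * s - w)) (K.tangentDir t) := by
        simp only [det3_eq, PiLp.smul_apply, smul_eq_mul]; ring
      rw [this]
      exact mul_ne_zero two_ne_zero hd
    rcases key s hs with ⟨h1, h2⟩ | ⟨h1, h2⟩
    · rw [e1 s h1] at hpc
      have hm : (2 * s, t) ∈ K.meets c ∪ K.meetsNeg c :=
        hpc.imp (fun h => ⟨h2, ht, h⟩) (fun h => ⟨h2, ht, h⟩)
      obtain ⟨k1, k2, k3⟩ := hc.2.2 _ hm
      simp only at k1 k2 k3
      have he : pathMap (c.trans c') =ᶠ[𝓝 s] (fun σ => pathMap c (2 * σ - 0)) := by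
        filter_upwards [Iio_mem_nhds (lt_of_le_of_ne h1 hhalf)] with σ hσ
        rw [sub_zero]; exact e1 σ (le_of_lt hσ)
      obtain ⟨k4, k5⟩ := fin _ 0 he (by simpa using k1) (by simpa [crossingDet] using k2)
      refine ⟨k4, k5, fun hk => ?_⟩
      simp only
      rw [e1 s h1]
      exact k3 hk
    · rw [e2 s h1] at hpc
      have hm : (2 * s - 1, t) ∈ K.meets c' ∪ K.meetsNeg c' :=
        hpc.imp (fun h => ⟨h2, ht, h⟩) (fun h => ⟨h2, ht, h⟩)
      obtain ⟨k1, k2, k3⟩ := hc'.2.2 _ hm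
      simp only at k1 k2 k3
      have he : pathMap (c.trans c') =ᶠ[𝓝 s] (fun σ => pathMap c' (2 * σ - 1)) := by
        filter_upwards [Ioi_mem_nhds (lt_of_le_of_ne h1 (Ne.symm hhalf))] with σ hσ
        exact e2 σ (le_of_lt hσ)
      obtain ⟨k4, k5⟩ := fin _ 1 he k1 k2
      refine ⟨k4, k5, fun hk => ?_⟩
      simp only
      rw [e2 s h1]
      exact k3 hk

include hK

/-- Two directions off the indicatrix are joined by a transverse path. -/
theorem exists_isTransversePath {ξ ξ' : S2} (hξ : ξ ∉ K.indicatrix) (hξ' : ξ' ∉ K.indicatrix) :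
    ∃ c : Path ξ ξ', K.IsTransversePath c := by
  -- The two directions may be antipodal or in special position; a direction p generic for both is
  -- inserted, and two arcs of great circle are joined at it.
  obtain ⟨p, -, hp⟩ := exists_direction_notMem isOpen_univ ⟨ξ, trivial⟩
    (MeasureTheory.measure_union_null (volume_specialCone hK ξ) (volume_specialCone hK ξ')) (by
      rintro v (hv | hv) r
      exacts [.inl (smul_mem_specialCone hv r), .inr (smul_mem_specialCone hv r)])
  rw [mem_union, not_or] at hp
  have hpI : p ∉ K.indicatrix :=
    (regular_of_notMem_badCone hK fun h => hp.1 (.inl (.inl (.inl (.inl h))))).2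
  have hline : ∀ η : S2, (p : E3) ∉ K.specialCone η → p ≠ -η := fun η hη h => by
    refine hη (.inl (.inl (.inl (.inr ⟨-1, 0, ?_⟩))))
    rw [h]; simp
  have g1 := generalPosition_of_notMem hK hξ hp.1
  have g2 := (generalPosition_of_notMem hK hξ' hp.2).symm
  refine ⟨_, isTransversePath_trans hpI
    (isTransversePath_arcPath hK (hline ξ hp.1) hξ hpI g1.regular g1.corner g1.arc)
    (isTransversePath_arcPath hK (a := p) (b := ξ') (fun h => hline ξ' hp.2 ?_) hpI hξ' g2.regular
      g2.corner g2.arc)⟩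
  rw [h, neg_neg]

end SimpleClosedCurve

namespace SimpleClosedCurve

variable {K : SimpleClosedCurve} (hP : K.IsPLKnot)

include hP

/-! ### Polygonal knots -/

theorem IsPLKnot.hasDerivAt {t : ℝ} (ht : ¬ K.IsCorner t) : ∃ w : E3, w ≠ 0 ∧
    (∀ᶠ s in 𝓝 t, K.toFun s = K.toFun t + (s - t) • w) ∧ ∀ᶠ s in 𝓝 t, HasDerivAt K.toFun w s := by
  obtain ⟨w, hw, h⟩ := hP (Int.fract t) ⟨Int.fract_nonneg t, Int.fract_lt_one t⟩ ht
  have h1 : Tendsto (fun s : ℝ => s - ⌊t⌋) (𝓝 t) (𝓝 (Int.fract t)) := by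
    rw [← Int.self_sub_floor]
    exact (continuous_id.sub continuous_const).tendsto t
  have h2 : ∀ᶠ s in 𝓝 t, K.toFun s = K.toFun t + (s - t) • w := by
    filter_upwards [h1.eventually h] with s hs
    rw [K.toFun_sub_int, K.toFun_fract, ← Int.self_sub_floor] at hs
    rw [hs]
    congr 2
    ring
  refine ⟨w, hw, h2, ?_⟩
  filter_upwards [eventually_eventually_nhds.mpr h2] with s hs
  have h3 : HasDerivAt (fun s' : ℝ => K.toFun t + (s' - t) • w) w s := by
    simpa using (((hasDerivAt_id s).sub_const t).smul_const w).const_add (K.toFun t)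
  exact h3.congr_of_eventuallyEq hs

/-- A polygonal knot is affine on each interval without corners. -/
theorem IsPLKnot.affine {p κ X : ℝ} (h : ∀ y ∈ Ico 0 X, ¬ K.IsCorner (p + κ * y)) :
    ∀ y ∈ Icc 0 X, K.toFun (p + κ * y) = K.toFun p + (κ * y) • deriv K.toFun p := by
  have hlin : ∀ y, HasDerivAt (fun y : ℝ => p + κ * y) κ y := fun y => by
    simpa using ((hasDerivAt_id y).const_mul κ).const_add p
  have hderiv : ∀ y ∈ Ico 0 X, HasDerivAt (fun y => deriv K.toFun (p + κ * y)) 0 y := by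
    intro y hy
    obtain ⟨w, -, -, hw⟩ := hP.hasDerivAt (h y hy)
    have h1 : ∀ᶠ y' in 𝓝 y, HasDerivAt K.toFun w (p + κ * y') :=
      (hlin y).continuousAt.eventually hw
    exact (hasDerivAt_const y w).congr_of_eventuallyEq (h1.mono fun y' h' => h'.deriv)
  have hconst : ∀ y ∈ Ico 0 X, deriv K.toFun (p + κ * y) = deriv K.toFun p := by
    intro y hy
    have h2 := constant_of_has_deriv_right_zero (a := 0) (b := y)
      (f := fun y => deriv K.toFun (p + κ * y))
      (fun z hz => (hderiv z ⟨hz.1, hz.2.trans_lt hy.2⟩).continuousAt.continuousWithinAt)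
      (fun z hz => (hderiv z ⟨hz.1, hz.2.trans hy.2⟩).hasDerivWithinAt) y ⟨hy.1, le_rfl⟩
    simpa using h2
  have hc := K.continuous
  have h3 := constant_of_has_deriv_right_zero (a := 0) (b := X)
    (f := fun y => K.toFun (p + κ * y) - (κ * y) • deriv K.toFun p)
    (by apply Continuous.continuousOn; fun_prop) (fun y hy => by
      obtain ⟨w, -, -, hw⟩ := hP.hasDerivAt (h y hy)
      have e := hconst y hy
      rw [hw.self_of_nhds.deriv] at e
      have k1 : HasDerivAt (fun y => K.toFun (p + κ * y)) (κ • w) y :=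
        hw.self_of_nhds.scomp y (hlin y)
      have k2 : HasDerivAt (fun y : ℝ => (κ * y) • deriv K.toFun p) (κ • deriv K.toFun p) y := by
        simpa using ((hasDerivAt_id y).const_mul κ).smul_const (deriv K.toFun p)
      have k3 := k1.sub k2
      rw [← e, sub_self] at k3
      rw [← e]
      exact k3.hasDerivWithinAt)
  intro y hy
  have h4 := h3 y hy
  simp only [mul_zero, add_zero, zero_smul, sub_zero] at h4
  rw [← h4]
  abel

/-- A polygonal knot moves along a segment on both sides of each parameter. -/
theorem IsPLKnot.exists_side (t : ℝ) {σ : ℝ} (hσ : σ = 1 ∨ σ = -1) : ∃ δ > 0, ∃ w : E3, w ≠ 0 ∧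
    (∀ y ∈ Icc 0 δ, K.toFun (t + σ * y) = K.toFun t + (σ * y) • w) ∧
    ∀ y ∈ Ioo 0 δ, deriv K.toFun (t + σ * y) = w := by
  have hev := eventually_not_isCorner (K := K) t
  obtain ⟨ε, hε, hε'⟩ := Metric.eventually_nhds_iff.mp (eventually_nhdsWithin_iff.mp hev)
  have hσ0 : σ ≠ 0 := by rcases hσ with rfl | rfl <;> norm_num
  have hσ1 : |σ| = 1 := by rcases hσ with rfl | rfl <;> norm_num
  have hσ2 : σ * σ = 1 := by rcases hσ with rfl | rfl <;> norm_num
  have hnc : ∀ y, 0 < y → y < ε → ¬ K.IsCorner (t + σ * y) := by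
    intro y h0 h1
    refine hε' ?_ ?_
    · rw [Real.dist_eq, add_sub_cancel_left, abs_mul, hσ1, one_mul, abs_of_pos h0]; exact h1
    · simp [hσ0, h0.ne']
  set δ := ε / 2 with hδ
  have hδ0 : 0 < δ := by positivity
  have haff := hP.affine (p := t + σ * δ) (κ := -σ) (X := δ) (fun y hy => by
    have : t + σ * δ + -σ * y = t + σ * (δ - y) := by ring
    rw [this]
    exact hnc _ (by linarith [hy.2]) (by linarith [hy.1]))
  set w := deriv K.toFun (t + σ * δ) with hw
  obtain ⟨w', hw'0, -, hw'⟩ := hP.hasDerivAt (hnc δ hδ0 (by linarith))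
  have hw0 : w ≠ 0 := by rw [hw, hw'.self_of_nhds.deriv]; exact hw'0
  have e0 := haff δ ⟨hδ0.le, le_rfl⟩
  have e0' : t + σ * δ + -σ * δ = t := by ring
  rw [e0'] at e0
  have hmain : ∀ y ∈ Icc 0 δ, K.toFun (t + σ * y) = K.toFun t + (σ * y) • w := by
    intro y hy
    have e1 := haff (δ - y) ⟨by linarith [hy.2], by linarith [hy.1]⟩
    have e1' : t + σ * δ + -σ * (δ - y) = t + σ * y := by ring
    rw [e1'] at e1
    rw [e1, e0, add_assoc, ← add_smul]
    congr 2
    ring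
  refine ⟨δ, hδ0, w, hw0, hmain, fun y hy => ?_⟩
  have h1 : HasDerivAt (fun s => K.toFun t + (s - t) • w) w (t + σ * y) := by
    simpa using (((hasDerivAt_id (t + σ * y)).sub_const t).smul_const w).const_add (K.toFun t)
  refine (h1.congr_of_eventuallyEq ?_).deriv
  have hcont : ContinuousAt (fun s => σ * (s - t)) (t + σ * y) := by fun_prop
  have hm : Ioo 0 δ ∈ 𝓝 (σ * (t + σ * y - t)) := by
    rw [add_sub_cancel_left, ← mul_assoc, hσ2, one_mul]
    exact isOpen_Ioo.mem_nhds hy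
  filter_upwards [hcont.preimage_mem_nhds hm] with s hs
  have h2 := hmain (σ * (s - t)) ⟨le_of_lt hs.1, le_of_lt hs.2⟩
  rw [← mul_assoc, hσ2, one_mul, add_sub_cancel] at h2
  exact h2

/-- If the one-sided directions at a parameter were opposite, the two segments there would overlap,
against injectivity. -/
theorem IsPLKnot.isPiecewiseC2Knot : K.IsPiecewiseC2Knot := by
  refine ⟨fun t ht hc => ?_, fun t _ => ?_⟩
  · obtain ⟨w, -, h⟩ := hP t ht hc
    refine ContDiffAt.congr_of_eventuallyEq ?_ h
    fun_prop
  · obtain ⟨δ, hδ, r, hr, har, hdr⟩ := hP.exists_side t (.inl rfl)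
    obtain ⟨δ', hδ', l, hl, hal, hdl⟩ := hP.exists_side t (.inr rfl)
    refine ⟨l, r, hl, hr, ?_, ?_, fun hopp => ?_⟩
    · refine tendsto_const_nhds.congr' ?_
      filter_upwards [Ioo_mem_nhdsLT (show t - δ' < t by linarith)] with s hs
      rw [← hdl (t - s) ⟨by linarith [hs.2], by linarith [hs.1]⟩]
      congr 1; ring
    · refine tendsto_const_nhds.congr' ?_
      filter_upwards [Ioo_mem_nhdsGT (show t < t + δ by linarith)] with s hs
      rw [← hdr (s - t) ⟨by linarith [hs.1], by linarith [hs.2]⟩]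
      congr 1; ring
    · have hln := norm_pos_iff.mpr hl
      have hrn := norm_pos_iff.mpr hr
      -- A common length that fits on both segments and takes parameter time at most 1/4 on each, so
      -- that the two parameters differ by less than a period.
      set x := min (min (δ * ‖r‖) (δ' * ‖l‖)) (min (‖r‖ / 4) (‖l‖ / 4)) with hx
      have hx0 : 0 < x := by positivity
      have x1 : x ≤ δ * ‖r‖ := (min_le_left _ _).trans (min_le_left _ _)
      have x2 : x ≤ δ' * ‖l‖ := (min_le_left _ _).trans (min_le_right _ _)
      have x3 : x ≤ ‖r‖ / 4 := (min_le_right _ _).trans (min_le_left _ _)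
      have x4 : x ≤ ‖l‖ / 4 := (min_le_right _ _).trans (min_le_right _ _)
      have e1 := har (x / ‖r‖) ⟨by positivity, by rwa [div_le_iff₀ hrn]⟩
      have e2 := hal (x / ‖l‖) ⟨by positivity, by rwa [div_le_iff₀ hln]⟩
      have y1 : x / ‖r‖ ≤ 1 / 4 := by rw [div_le_iff₀ hrn]; linarith
      have y2 : x / ‖l‖ ≤ 1 / 4 := by rw [div_le_iff₀ hln]; linarith
      have y3 : 0 < x / ‖r‖ := by positivity
      have y4 : 0 < x / ‖l‖ := by positivity
      refine K.toFun_ne (s := t + -1 * (x / ‖l‖)) (t := t + 1 * (x / ‖r‖)) (by linarith)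
        (by linarith) ?_
      rw [e1, e2]
      have z1 : (1 * (x / ‖r‖)) • r = x • (‖r‖⁻¹ • r) := by rw [smul_smul, one_mul]; rfl
      have z2 : (-1 * (x / ‖l‖)) • l = -(x • (‖l‖⁻¹ • l)) := by
        rw [smul_smul, neg_one_mul, neg_smul]; rfl
      rw [z1, z2, hopp, smul_neg, sub_self]

omit hP in
theorem isClosed_isCorner : IsClosed {t | K.IsCorner t} := by
  rw [← isOpen_compl_iff, isOpen_iff_mem_nhds]
  exact fun t ht => K.eventually_not_isCorner_nhds ht

/-- For polygonal knots the double points of good projections off the indicatrix are transverse. -/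
theorem IsPLKnot.isTransverseDiagram {ξ : S2} (hξ : K.IsGood ξ) (hξI : ξ ∉ K.indicatrix) :
    K.IsTransverseDiagram ξ := by
  have hK := hP.isPiecewiseC2Knot
  intro p hp h0
  obtain ⟨-, -, hch, hne⟩ := mem_doublePoints.mp hp
  obtain ⟨hc1, hc2⟩ := hξ.not_isCorner (projAlong_eq_iff.mpr ⟨hch, hne⟩).1 hne
  set s₀ := p.1
  set t₀ := p.2
  set a := deriv K.toFun s₀ with ha
  set b := deriv K.toFun t₀ with hb
  set k := ‖K.toFun s₀ - K.toFun t₀‖ with hk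
  have hk0 : 0 < k := norm_pos_iff.mpr (sub_ne_zero.mpr hne)
  have ha0 : a ≠ 0 := deriv_ne_zero hK hc1
  have hb0 : b ≠ 0 := deriv_ne_zero hK hc2
  have hTne : ∀ t, ¬ K.IsCorner t → K.unitTangent t ≠ ξ ∧ K.unitTangent t ≠ -(ξ : E3) :=
    fun t ht => ⟨fun h => hξI (.inl (h ▸ unitTangent_mem_indicatrix hK ht)),
      fun h => hξI (.inr (h ▸ unitTangent_mem_indicatrix hK ht))⟩
  -- The projected strands are parallel. The coefficient l is nonzero, as otherwise the lower strand
  -- would have the direction ξ or -ξ, which lies on the indicatrix.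
  obtain ⟨l, m, hl, hbm⟩ : ∃ l m : ℝ, l ≠ 0 ∧ b = l • a + m • (ξ : E3) := by
    obtain ⟨x, y, hxy⟩ := exists_smul_add_smul_of_det3_eq_zero (w := b) (norm_eq_of_mem_sphere ξ)
      (norm_unitTangent hK hc1) (hTne _ hc1).1 (hTne _ hc1).2 (by
        have : det3 (ξ : E3) (K.unitTangent s₀) b = ‖a‖⁻¹ * det3 a b (ξ : E3) := by
          rw [unitTangent, ← ha]
          simp only [det3_eq, PiLp.smul_apply, smul_eq_mul]; ring
        rw [this, h0, mul_zero])
    refine ⟨y * ‖a‖⁻¹, x, fun hy => ?_, ?_⟩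
    · have hy0 : y = 0 :=
        (mul_eq_zero.mp hy).resolve_right (inv_ne_zero (norm_ne_zero_iff.mpr ha0))
      rw [hy0, zero_smul, add_zero] at hxy
      have hT : K.unitTangent t₀ = (‖b‖⁻¹ * x) • (ξ : E3) := by
        rw [unitTangent, ← hb, mul_smul, ← hxy]
      have hn := norm_unitTangent hK hc2
      rw [hT, norm_smul, norm_eq_of_mem_sphere, mul_one, Real.norm_eq_abs] at hn
      rcases eq_or_eq_neg_of_abs_eq hn with h | h
      · exact (hTne _ hc2).1 (by rw [hT, h, one_smul])
      · exact (hTne _ hc2).2 (by rw [hT, h, neg_one_smul])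
    · rw [mul_smul, ha, ← unitTangent, add_comm]; exact hxy
  -- the direction in which the distance of the strands does not decrease
  obtain ⟨σ, hσ, hσm⟩ : ∃ σ : ℝ, (σ = 1 ∨ σ = -1) ∧ 0 ≤ -(σ * (m / l)) := by
    rcases le_total (m / l) 0 with h | h
    · exact ⟨1, .inl rfl, by linarith⟩
    · exact ⟨-1, .inr rfl, by linarith⟩
  -- Moving with parameter speed σ on the upper and σ / l on the lower strand keeps the two points
  -- over each other. C consists of the times at which one of them is at a corner.
  set C : Set ℝ := {x | 0 ≤ x ∧ (K.IsCorner (s₀ + σ * x) ∨ K.IsCorner (t₀ + σ / l * x))} with hC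
  have hCc : IsClosed C := by
    refine isClosed_Ici.inter (IsClosed.union ?_ ?_)
    · exact K.isClosed_isCorner.preimage (by fun_prop : Continuous fun x : ℝ => s₀ + σ * x)
    · exact K.isClosed_isCorner.preimage (by fun_prop : Continuous fun x : ℝ => t₀ + σ / l * x)
  -- Without a corner ahead, the knot would be affine with nonzero velocity over a full period and
  -- could not close up.
  have hCne : C.Nonempty := by
    by_contra hemp
    have hnc : ∀ y ∈ Ico (0 : ℝ) 1, ¬ K.IsCorner (s₀ + σ * y) := fun y hy hy' =>
      hemp ⟨y, hy.1, .inl hy'⟩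
    have h1 := hP.affine hnc 1 ⟨zero_le_one, le_rfl⟩
    have h2 : K.toFun (s₀ + σ * 1) = K.toFun s₀ := by
      rcases hσ with rfl | rfl
      · rw [one_mul, K.periodic]
      · rw [← K.periodic (s₀ + -1 * 1)]; congr 1; ring
    rw [h2, ← ha, left_eq_add, smul_eq_zero] at h1
    rcases h1 with h1 | h1
    · rcases hσ with rfl | rfl <;> norm_num at h1
    · exact ha0 h1
  have hCb : BddBelow C := ⟨0, fun x hx => hx.1⟩
  set X := sInf C with hX
  obtain ⟨hX0, hXc⟩ := hCc.csInf_mem hCne hCb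
  have hXpos : 0 < X := by
    refine lt_of_le_of_ne hX0 fun h => ?_
    rw [← hX, ← h, mul_zero, mul_zero, add_zero, add_zero] at hXc
    exact hXc.elim hc1 hc2
  have hnot : ∀ y ∈ Ico 0 X, ¬ K.IsCorner (s₀ + σ * y) ∧ ¬ K.IsCorner (t₀ + σ / l * y) := by
    intro y hy
    rw [← not_or]
    exact fun h => not_le.mpr hy.2 (csInf_le hCb ⟨hy.1, h⟩)
  have e1 := hP.affine (fun y hy => (hnot y hy).1) X ⟨hX0, le_rfl⟩
  have e2 := hP.affine (fun y hy => (hnot y hy).2) X ⟨hX0, le_rfl⟩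
  -- At the first corner time X the points still have the same projection, and by the choice of σ
  -- their distance is at least k > 0. A fibre with two points thus contains a corner, which a good
  -- direction excludes.
  have e3 : K.toFun (s₀ + σ * X) - K.toFun (t₀ + σ / l * X) =
      (k + -(σ * (m / l)) * X) • (ξ : E3) := by
    have e4 : K.toFun s₀ = K.toFun t₀ + k • (ξ : E3) := by rw [← hch]; abel
    rw [e1, e2, e4, ← ha, ← hb, hbm, smul_add, smul_smul, smul_smul]
    have e5 : σ / l * X * l = σ * X := by field_simp
    have e6 : k + -(σ * (m / l)) * X = k - σ / l * X * m := by
      field_simp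
      ring
    rw [e5, e6, sub_smul]
    abel
  have hpos : 0 < k + -(σ * (m / l)) * X := by positivity
  have hn : ‖K.toFun (s₀ + σ * X) - K.toFun (t₀ + σ / l * X)‖ = k + -(σ * (m / l)) * X := by
    rw [e3, norm_smul, norm_eq_of_mem_sphere, mul_one, Real.norm_of_nonneg hpos.le]
  have hne' : K.toFun (s₀ + σ * X) ≠ K.toFun (t₀ + σ / l * X) := fun h => by
    rw [h, sub_self, norm_zero] at hn
    exact hpos.ne hn
  obtain ⟨k1, k2⟩ := hξ.not_isCorner
    (projAlong_eq_iff.mpr ⟨by rw [hn]; exact e3, hne'⟩).1 hne'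
  exact hXc.elim k1 k2

end SimpleClosedCurve

end

theorem mainTheorem5 (K : SimpleClosedCurve) (O : Set S2)
    (hK : (K.IsPLKnot ∧ O = K.goodDirections) ∨
      (K.IsPiecewiseC2Knot ∧ O = K.regularDirections)) :
    -- the Tait number is a finite sum, and its extension off the indicatrix is well defined
    (∀ η ∈ O, η ∉ K.indicatrix → (K.doublePoints η).Finite) ∧
    (∀ ξ, ξ ∉ K.indicatrix →
      (∃ η ∈ O, η ∈ connectedComponentIn K.indicatrixᶜ ξ) ∧
      ∀ η ∈ O, η ∈ connectedComponentIn K.indicatrixᶜ ξ → K.taitExt O ξ = K.tait η) ∧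
    -- the variation formula
    ∀ ξ ξ' : S2, ξ ∉ K.indicatrix → ξ' ∉ K.indicatrix → ∀ c : Path ξ ξ',
      (∃ n : ℤ, K.IsIntersectionNumber c n) ∧
      ∀ n : ℤ, K.IsIntersectionNumber c n → K.taitExt O ξ = K.taitExt O ξ' + n := by
  -- Both cases become one: a piecewise C² knot with a set O that contains the regular directions
  -- and agrees with them off the indicatrix.
  obtain ⟨hC, hO, hO'⟩ : K.IsPiecewiseC2Knot ∧ (∀ η, η ∉ K.indicatrix → η ∈ O →
      η ∈ K.regularDirections) ∧ K.regularDirections ⊆ O := by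
    rcases hK with ⟨hP, rfl⟩ | ⟨hC, rfl⟩
    · exact ⟨hP.isPiecewiseC2Knot, fun η hη h => ⟨h, hP.isTransverseDiagram h hη⟩,
        fun η hη => hη.1⟩
    · exact ⟨hC, fun η _ h => h, subset_rfl⟩
  refine ⟨fun η hη hI => SimpleClosedCurve.finite_doublePoints hC (hO η hI hη) hI,
    fun ξ hξ => ⟨?_, fun η hη hm => ?_⟩, fun ξ ξ' hξ hξ' c => ⟨?_, ?_⟩⟩
  · obtain ⟨η, h1, h2⟩ := SimpleClosedCurve.exists_regular_mem_connectedComponentIn hC hξ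
    exact ⟨η, hO' h1, h2⟩
  · have hI := connectedComponentIn_subset _ _ hm
    rw [SimpleClosedCurve.taitExt_eq_localTait hC hO hO' hξ,
      ← SimpleClosedCurve.localTait_eq_of_mem_connectedComponentIn hC hm,
      SimpleClosedCurve.localTait_eq_tait hC hI (hO η hI hη)]
  · obtain ⟨c', hc'⟩ := SimpleClosedCurve.exists_isTransversePath hC hξ hξ'
    exact ⟨_, c', homotopic_S2 c c', hc', rfl⟩
  -- The formula for transverse paths expresses the crossing number through the end points, so all
  -- transverse paths give the same number.
  · rintro n ⟨c', -, hc', rfl⟩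
    rw [SimpleClosedCurve.taitExt_eq_localTait hC hO hO' hξ,
      SimpleClosedCurve.taitExt_eq_localTait hC hO hO' hξ',
      SimpleClosedCurve.localTait_eq_add_signedCrossings hC hξ hξ' hc']
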